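/- Let $M$ be a smooth manifold of real dimension $4n$. A generalized Kähler structure on $M$ is a triple $(g,I,J)$ of integrable complex structures $I,J$ and a Riemannian metric $g$ Hermitian with respect to both, such that, with $\omega_I(X,Y)=g(IX,Y)$, $\omega_J(X,Y)=g(JX,Y)$ and $d^c=\sqrt{-1}(\bar\partial-\partial)$, $$d^c_I\omega_I=H=-d^c_J\omega_J,\qquad dH=0 .$$ It is nondegenerate if $\sigma=[I,J]g^{-1}$ is a nondegenerate pairing on each fibre of $T^*M$; then $I\pm J$ are invertible, and one sets $F_\pm=-2g(I\pm J)^{-1}$ (two $2$-forms) and defines the Ricci potential $\Phi=\log\frac{F_+^{2n}}{F_-^{2n}}$, the logarithm of a ratio of forms of top degree. Let $\theta_I(X)=\frac12\sum_i d\omega_I(e_i,Ie_i,X)$ be the Lee form ($\{e_i\}$ a $g$-orthonormal basis), and similarly $\theta_J$. Let $(\rho_B)_I$ be the Bismut–Ricci form of $(g,I)$, $(\rho_B)_I(X,Y)=\frac12\operatorname{tr}(R^B(X,Y)\circ I)$, where $R^B$ is the curvature of the connection $g(\nabla^B_XY,Z)=g(\nabla_XY,Z)-\frac12 d^c_I\omega_I(X,Y,Z)$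 and $\nabla$ is the Levi-Civita connection. Let $\Delta^C_g f=\langle dd^c_I f,\omega_I\rangle_g$ be the Chern Laplacian of $(g,I)$. Let $(g_t,I,J_t)$, $t\in[0,T)$, $0<T\le\infty$, be a solution of the generalized Kähler–Ricci flow in the $I$-fixed gauge, that is, a family of generalized Kähler structures, smooth on $M\times[0,T)$, with $$\tfrac{\partial}{\partial t}\omega_I=-2(\rho_B)_I^{1,1},\qquad \tfrac{\partial}{\partial t}J=\mathcal L_{\theta_J^\sharp-\theta_I^\sharp}J ,$$ and suppose that the initial structure $(g_0,I,J_0)$ is nondegenerate. Then $(g_t,I,J_t)$ is nondegenerate for every $t\in[0,T)$, the ratio $F_+^{2n}/F_-^{2n}$ is everywhere positive, the family $\Phi_t$ of Ricci potentials is smooth on $M\times[0,T)$, and $$\Big(\tfrac{\partial}{\partial t}-\Delta^C_{g_t}\Big)\Phi=0\quad\text{on }M\times[0,T)$$ (with the one-sided time derivative at $t=0$). Consequently, if $M$ is compact, $\sup_M|\Phi_t|$ is finite and nonincreasing in $t\in[0,T)$. -/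

import Mathlib

open scoped Manifold ContDiff Matrix

noncomputable section

namespace GKRF

/-! ### Tensor calculus in coordinates

A field of bilinear forms `b` on (an open subset of) `ℝ^N` is the matrix field `b_ij = b(∂_i, ∂_j)`;
a field of endomorphisms `A` is the matrix field with `A ∂_j = ∑_i A_ij ∂_i`.
-/

/-- Matrix-valued functions of `N` real coordinates. -/
abbrev MatField (N : ℕ) : Type := EuclideanSpace ℝ (Fin N) → Matrix (Fin N) (Fin N) ℝ

/-- The partial derivative `∂_i f`. -/
def pd {N : ℕ} (i : Fin N) (f : EuclideanSpace ℝ (Fin N) → ℝ) (x : EuclideanSpace ℝ (Fin N)) : ℝ :=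
  fderiv ℝ f x (EuclideanSpace.single i 1)

/-- The entrywise partial derivative of a matrix field. -/
def pdMat {N : ℕ} (i : Fin N) (A : MatField N) : MatField N := fun x =>
  Matrix.of fun k l => pd i (fun y => A y k l) x

/-- `(dα)_ij` for a 1-form `α`. -/
def extDerivOne {N : ℕ} (α : Fin N → EuclideanSpace ℝ (Fin N) → ℝ) : MatField N := fun x =>
  Matrix.of fun i j => pd i (α j) x - pd j (α i) x

/-- `(dβ)_ijk` for a 2-form `β`. -/
def extDerivTwo {N : ℕ} (β : MatField N) (i j k : Fin N) (x : EuclideanSpace ℝ (Fin N)) : ℝ :=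
  pd i (fun y => β y j k) x + pd j (fun y => β y k i) x + pd k (fun y => β y i j) x

/-- `(dγ)_ijkl` for a 3-form `γ`. -/
def extDerivThree {N : ℕ} (γ : Fin N → Fin N → Fin N → EuclideanSpace ℝ (Fin N) → ℝ)
    (i j k l : Fin N) (x : EuclideanSpace ℝ (Fin N)) : ℝ :=
  pd i (γ j k l) x - pd j (γ i k l) x + pd k (γ i j l) x - pd l (γ i j k) x

/-- The Nijenhuis tensor: the `i`-th component of
`[A∂_j, A∂_k] - A[A∂_j, ∂_k] - A[∂_j, A∂_k] + A²[∂_j, ∂_k]`. -/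
def nijenhuis {N : ℕ} (A : MatField N) (i j k : Fin N) (x : EuclideanSpace ℝ (Fin N)) : ℝ :=
  ∑ l, (A x l j * pd l (fun y => A y i k) x - A x l k * pd l (fun y => A y i j) x
    + A x i l * pd k (fun y => A y l j) x - A x i l * pd j (fun y => A y l k) x)

/-- The inner product `⟨β, γ⟩_g = ½ g^{ia} g^{jb} β_ij γ_ab` of two 2-forms. -/
def formInner {N : ℕ} (g β γ : Matrix (Fin N) (Fin N) ℝ) : ℝ :=
  (1 / 2) * ∑ i, ∑ j, ∑ a, ∑ b, g⁻¹ i a * g⁻¹ j b * β i j * γ a b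

/-- The Kähler form `ω(X, Y) = g(IX, Y)`. -/
def kahlerForm {N : ℕ} (g I : MatField N) : MatField N := fun x => (I x)ᵀ * g x

/-- `d^c ω = i(∂̄ - ∂)ω`, i.e. `(d^c ω)(X, Y, Z) = -(dω)(IX, IY, IZ)`, for the Kähler form `ω` of
`(g, I)`. -/
def dcKahler {N : ℕ} (g I : MatField N) (i j k : Fin N) (x : EuclideanSpace ℝ (Fin N)) : ℝ :=
  -∑ a, ∑ b, ∑ c, I x a i * I x b j * I x c k * extDerivTwo (kahlerForm g I) a b c x

/-- The Lee form `θ(X) = ½ ∑ dω(e_i, I e_i, X)`, i.e. `θ(X) = ⟨dω(·, ·, X), ω⟩_g`. -/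
def leeForm {N : ℕ} (g I : MatField N) (k : Fin N) (x : EuclideanSpace ℝ (Fin N)) : ℝ :=
  formInner (g x) (Matrix.of fun i j => extDerivTwo (kahlerForm g I) i j k x) (kahlerForm g I x)

/-- The matrix of `Y ↦ ∇^B_{∂_i} Y - ∂_i Y` for the Bismut connection
`g(∇^B_X Y, Z) = g(∇_X Y, Z) - ½ d^c ω(X, Y, Z)`, with `∇` the Levi-Civita connection. -/
def bismutConn {N : ℕ} (g I : MatField N) (i : Fin N) : MatField N := fun x =>
  Matrix.of fun k j => ∑ l, (g x)⁻¹ k l * ((1 / 2) * (pd i (fun y => g y j l) x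
    + pd j (fun y => g y i l) x - pd l (fun y => g y i j) x) - (1 / 2) * dcKahler g I i j l x)

/-- The curvature endomorphism `R^B(∂_i, ∂_j) = [∇^B_i, ∇^B_j]` of the Bismut connection. -/
def bismutCurv {N : ℕ} (g I : MatField N) (i j : Fin N) : MatField N := fun x =>
  pdMat i (bismutConn g I j) x - pdMat j (bismutConn g I i) x
    + bismutConn g I i x * bismutConn g I j x - bismutConn g I j x * bismutConn g I i x

/-- The Bismut-Ricci form `ρ_B(X, Y) = ½ ∑ g(R^B(X, Y) I e_i, e_i) = ½ tr (R^B(X, Y) ∘ I)`;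
the sign is the one for which `ρ_B(X, Y) = Ric(IX, Y)` if `(g, I)` is Kähler. -/
def bismutRicci {N : ℕ} (g I : MatField N) : MatField N := fun x =>
  Matrix.of fun i j => (1 / 2) * (bismutCurv g I i j x * I x).trace

/-- The `(1,1)`-part `½ (β + β(I·, I·))` of a 2-form. -/
def oneOnePart {N : ℕ} (I β : Matrix (Fin N) (Fin N) ℝ) : Matrix (Fin N) (Fin N) ℝ :=
  (1 / 2 : ℝ) • (β + Iᵀ * β * I)

/-- The vector field `θ_J^♯ - θ_I^♯`. -/
def leeDiff {N : ℕ} (g I J : MatField N) (i : Fin N) (x : EuclideanSpace ℝ (Fin N)) : ℝ :=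
  ∑ j, (g x)⁻¹ i j * (leeForm g J j x - leeForm g I j x)

/-- The Lie derivative `(L_X A) Y = [X, AY] - A[X, Y]` of an endomorphism field. -/
def lieDerivEnd {N : ℕ} (X : Fin N → EuclideanSpace ℝ (Fin N) → ℝ) (A : MatField N) :
    MatField N := fun x =>
  Matrix.of fun i j => ∑ k, (X k x * pd k (fun y => A y i j) x - A x k j * pd k (X i) x
    + A x i k * pd j (X k) x)

/-- `d^c f = i(∂̄ - ∂)f`, i.e. `(d^c f)(X) = -df(IX)`. -/
def dcFun {N : ℕ} (I : MatField N) (f : EuclideanSpace ℝ (Fin N) → ℝ) (j : Fin N)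
    (x : EuclideanSpace ℝ (Fin N)) : ℝ :=
  -∑ k, pd k f x * I x k j

/-- The Chern Laplacian `Δ^C f = ⟨d d^c f, ω⟩_g`. -/
def chernLaplacianCoord {N : ℕ} (g I : MatField N) (f : EuclideanSpace ℝ (Fin N) → ℝ)
    (x : EuclideanSpace ℝ (Fin N)) : ℝ :=
  formInner (g x) (extDerivOne (dcFun I f) x) (kahlerForm g I x)

/-! ### Tensors on a manifold and their components in a chart -/

section Manifold

variable {N : ℕ} {M : Type*} [TopologicalSpace M] [ChartedSpace (EuclideanSpace ℝ (Fin N)) M]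

/-- Fields of endomorphisms of the tangent spaces. -/
abbrev EndField (N : ℕ) (M : Type*) [TopologicalSpace M]
    [ChartedSpace (EuclideanSpace ℝ (Fin N)) M] : Type _ :=
  ∀ x : M, TangentSpace (𝓡 N) x →L[ℝ] TangentSpace (𝓡 N) x

/-- The smooth charts of `M`. -/
abbrev charts (N : ℕ) (M : Type*) [TopologicalSpace M]
    [ChartedSpace (EuclideanSpace ℝ (Fin N)) M] :
    Set (OpenPartialHomeomorph M (EuclideanSpace ℝ (Fin N))) :=
  IsManifold.maximalAtlas (𝓡 N) ∞ M

/-- The coordinate vector `∂_i` of the chart `e`, at the point with coordinates `y`. -/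
def frame (e : OpenPartialHomeomorph M (EuclideanSpace ℝ (Fin N)))
    (y : EuclideanSpace ℝ (Fin N)) (i : Fin N) : TangentSpace (𝓡 N) (e.symm y) :=
  mfderiv (𝓡 N) (𝓡 N) e.symm y (EuclideanSpace.single i (1 : ℝ) : EuclideanSpace ℝ (Fin N))

/-- The `i`-th component, with respect to the chart `e`, of a tangent vector. -/
def coframe (e : OpenPartialHomeomorph M (EuclideanSpace ℝ (Fin N)))
    (y : EuclideanSpace ℝ (Fin N)) (i : Fin N) (v : TangentSpace (𝓡 N) (e.symm y)) : ℝ :=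
  (show EuclideanSpace ℝ (Fin N) from mfderiv (𝓡 N) (𝓡 N) e (e.symm y) v) i

/-- The components of an endomorphism field in the chart `e`. -/
def endComp (e : OpenPartialHomeomorph M (EuclideanSpace ℝ (Fin N))) (A : EndField N M) :
    MatField N := fun y =>
  Matrix.of fun i j => coframe e y i (A (e.symm y) (frame e y j))

/-- Smooth Riemannian metrics on `M`. -/
abbrev Metric (N : ℕ) (M : Type*) [TopologicalSpace M]
    [ChartedSpace (EuclideanSpace ℝ (Fin N)) M] [IsManifold (𝓡 N) ∞ M] : Type _ :=
  Bundle.ContMDiffRiemannianMetric (𝓡 N) ∞ (EuclideanSpace ℝ (Fin N))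
    (fun x : M => TangentSpace (𝓡 N) x)

/-- The components of a metric in the chart `e`. -/
def metricComp [IsManifold (𝓡 N) ∞ M] (e : OpenPartialHomeomorph M (EuclideanSpace ℝ (Fin N)))
    (g : Metric N M) : MatField N := fun y =>
  Matrix.of fun i j => g.inner (e.symm y) (frame e y i) (frame e y j)

/-- Smooth integrable complex structures: `I² = -1` with vanishing Nijenhuis tensor. -/
structure IsComplexStructure (I : EndField N M) : Prop where
  smooth : ∀ e ∈ charts N M, ∀ i j, ContDiffOn ℝ ∞ (fun y => endComp e I y i j) e.target
  sq : ∀ (x : M) (v : TangentSpace (𝓡 N) x), I x (I x v) = -v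
  integrable : ∀ e ∈ charts N M, ∀ y ∈ e.target, ∀ i j k, nijenhuis (endComp e I) i j k y = 0

end Manifold

/-- Generalized Kähler structures `(g, I, J)`: `g` is Hermitian for the complex structures `I` and
`J`, and `d^c_I ω_I = H = -d^c_J ω_J` with `dH = 0`. -/
structure GKStructure (N : ℕ) (M : Type*) [TopologicalSpace M]
    [ChartedSpace (EuclideanSpace ℝ (Fin N)) M] [IsManifold (𝓡 N) ∞ M] where
  g : Metric N M
  I : EndField N M
  J : EndField N M
  complexI : IsComplexStructure I
  complexJ : IsComplexStructure J
  hermitianI : ∀ (x : M) (v w : TangentSpace (𝓡 N) x), g.inner x (I x v) (I x w) = g.inner x v w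
  hermitianJ : ∀ (x : M) (v w : TangentSpace (𝓡 N) x), g.inner x (J x v) (J x w) = g.inner x v w
  torsion_eq : ∀ e ∈ charts N M, ∀ y ∈ e.target, ∀ i j k,
    dcKahler (metricComp e g) (endComp e I) i j k y
      = -dcKahler (metricComp e g) (endComp e J) i j k y
  torsion_closed : ∀ e ∈ charts N M, ∀ y ∈ e.target, ∀ i j k l,
    extDerivThree (dcKahler (metricComp e g) (endComp e I)) i j k l y = 0

namespace GKStructure

variable {N : ℕ} {M : Type*} [TopologicalSpace M] [ChartedSpace (EuclideanSpace ℝ (Fin N)) M]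
  [IsManifold (𝓡 N) ∞ M]

/-- The vector `α^♯ = g⁻¹α` dual to the covector `α`. -/
def sharp (S : GKStructure N M) (x : M) (α : TangentSpace (𝓡 N) x →L[ℝ] ℝ) :
    TangentSpace (𝓡 N) x :=
  (S.g.inner x).inverse α

/-- The bivector `σ = [I, J] g⁻¹`, as a pairing on covectors. -/
def poisson (S : GKStructure N M) (x : M) (α β : TangentSpace (𝓡 N) x →L[ℝ] ℝ) : ℝ :=
  β (S.I x (S.J x (S.sharp x α)) - S.J x (S.I x (S.sharp x α)))

/-- `σ` is a nondegenerate pairing on each cotangent space. -/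
def IsNondegenerate (S : GKStructure N M) : Prop :=
  ∀ (x : M) (α : TangentSpace (𝓡 N) x →L[ℝ] ℝ), (∀ β, S.poisson x α β = 0) → α = 0

/-- `F_+ = -2 g (I + J)⁻¹`. -/
def Fplus (S : GKStructure N M) (x : M) (u v : TangentSpace (𝓡 N) x) : ℝ :=
  -2 * S.g.inner x ((S.I x + S.J x).inverse u) v

/-- `F_- = -2 g (I - J)⁻¹`. -/
def Fminus (S : GKStructure N M) (x : M) (u v : TangentSpace (𝓡 N) x) : ℝ :=
  -2 * S.g.inner x ((S.I x - S.J x).inverse u) v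

/-- The Chern Laplacian `Δ^C f = ⟨d d^c_I f, ω_I⟩_g` of a function on `M`. -/
def chernLaplacian (S : GKStructure N M) (f : M → ℝ) (x : M) : ℝ :=
  chernLaplacianCoord (metricComp (chartAt (EuclideanSpace ℝ (Fin N)) x) S.g)
    (endComp (chartAt (EuclideanSpace ℝ (Fin N)) x) S.I)
    (fun y => f ((chartAt (EuclideanSpace ℝ (Fin N)) x).symm y))
    (chartAt (EuclideanSpace ℝ (Fin N)) x x)

end GKStructure

/-- The value on `4n` vectors of the `2n`-fold wedge power `F ∧ ⋯ ∧ F` of a 2-form `F`. -/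
def topPower {n : ℕ} {W : Type*} (F : W → W → ℝ) (v : Fin (4 * n) → W) : ℝ :=
  (1 / 2 ^ (2 * n)) * ∑ σ : Equiv.Perm (Fin (4 * n)), ((Equiv.Perm.sign σ : ℤ) : ℝ) *
    ∏ i : Fin (2 * n), F (v (σ ⟨2 * i, by omega⟩)) (v (σ ⟨2 * i + 1, by omega⟩))

/-- The ratio `F_+^{2n} / F_-^{2n}` of top degree forms, computed on a basis of the tangent space
(all bases give the same value). -/
def volumeRatio {n : ℕ} {M : Type*} [TopologicalSpace M]
    [ChartedSpace (EuclideanSpace ℝ (Fin (4 * n))) M] [IsManifold (𝓡 (4 * n)) ∞ M]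
    (S : GKStructure (4 * n) M) (x : M) : ℝ :=
  topPower (S.Fplus x)
      (fun i => (EuclideanSpace.single i (1 : ℝ) : EuclideanSpace ℝ (Fin (4 * n)))) /
    topPower (S.Fminus x)
      (fun i => (EuclideanSpace.single i (1 : ℝ) : EuclideanSpace ℝ (Fin (4 * n))))

/-- The Ricci potential `Φ = log (F_+^{2n} / F_-^{2n})`. -/
def ricciPotential {n : ℕ} {M : Type*} [TopologicalSpace M]
    [ChartedSpace (EuclideanSpace ℝ (Fin (4 * n))) M] [IsManifold (𝓡 (4 * n)) ∞ M]
    (S : GKStructure (4 * n) M) (x : M) : ℝ :=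
  Real.log (volumeRatio S x)

/-- The time interval `[0, T)`, where `T = ∞` is allowed. -/
def timeSet (T : EReal) : Set ℝ := {t : ℝ | 0 ≤ t ∧ (t : EReal) < T}

/-- Smooth solutions on `[0, T)` of the generalized Kähler-Ricci flow in the `I`-fixed gauge:
families of generalized Kähler structures `(g_t, I, J_t)`, smooth on `M × [0, T)`, with
`∂_t ω_I = -2 (ρ_B)_I^{1,1}` and `∂_t J = L_{θ_J^♯ - θ_I^♯} J`. -/
structure IsGKRFSolution {N : ℕ} {M : Type*} [TopologicalSpace M]
    [ChartedSpace (EuclideanSpace ℝ (Fin N)) M] [IsManifold (𝓡 N) ∞ M]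
    (T : EReal) (S : ℝ → GKStructure N M) : Prop where
  I_fixed : ∀ t ∈ timeSet T, (S t).I = (S 0).I
  smooth_g : ∀ e ∈ charts N M, ∀ i j,
    ContDiffOn ℝ ∞ (fun p : ℝ × EuclideanSpace ℝ (Fin N) => metricComp e (S p.1).g p.2 i j)
      (timeSet T ×ˢ e.target)
  smooth_J : ∀ e ∈ charts N M, ∀ i j,
    ContDiffOn ℝ ∞ (fun p : ℝ × EuclideanSpace ℝ (Fin N) => endComp e (S p.1).J p.2 i j)
      (timeSet T ×ˢ e.target)
  flow_omega : ∀ e ∈ charts N M, ∀ t ∈ timeSet T, ∀ y ∈ e.target, ∀ i j,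
    HasDerivWithinAt
      (fun s => kahlerForm (metricComp e (S s).g) (endComp e (S s).I) y i j)
      (-2 * oneOnePart (endComp e (S t).I y)
        (bismutRicci (metricComp e (S t).g) (endComp e (S t).I) y) i j)
      (timeSet T) t
  flow_J : ∀ e ∈ charts N M, ∀ t ∈ timeSet T, ∀ y ∈ e.target, ∀ i j,
    HasDerivWithinAt (fun s => endComp e (S s).J y i j)
      (lieDerivEnd
        (leeDiff (metricComp e (S t).g) (endComp e (S t).I) (endComp e (S t).J))
        (endComp e (S t).J) y i j)
      (timeSet T) t

end GKRF

end

/-!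
# The Ricci potential along the generalized Kähler-Ricci flow

Write `Q = [I, J] = (I - J)(I + J)`, `σ = Q g⁻¹`, `K = Q⁻¹` and `Ω = σ⁻¹ = g K` where `Q` is
invertible. `I` and `J` anticommute with `Q` and `K`. Everything rests on identities between the
1-jets of `g`, `I`, `J` at a point of a chart, encoded by `HermJet` and `GKJet`; only the curvature
involves second derivatives.

*Torsion.* Let `H = d^c_I ω_I = -d^c_J ω_J`. Integrability of `I` implies that its Bismut
connection, which has the torsion `-H`, preserves `I` (`HermJet.conn`) and that `H` is of type
`(2,1) + (1,2)` with respect to `I` (`HermJet.tri_torsion_type`); with `-H` in place of `H` the same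
holds for `J`. Let `H_X` be the endomorphism with `g(H_X Y, Z) = H(X, Y, Z)`. The type condition
says `tr (H_X I A) = -tr (H_{IX} A)` for all `A` that anticommute with `I`. Since
`J = 2 I K + J (I J + J I) K`, and similarly for `I`, these trace identities compare the Lee forms
`θ_I(X) = -½ tr (H_{IX} I)` and `θ_J(X) = ½ tr (H_{JX} J)` with the differential
`dΦ(X) = -2 tr (H_X K)` of the potential (`GKJet.potential_deriv`). The outcome is that
`X = θ_J^♯ - θ_I^♯` is Hamiltonian, `Ω X = -½ dΦ` (`GKJet.symplectic_mulVec_leeDiff`).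

*The two evolution equations have the same right-hand side.* The forms `Ω` and `Ω J` are closed
(`GKJet.tri_symplectic_closed`, `GKJet.tri_symplectic_comp_closed`), so that Cartan's formula gives
`Ω (L_X J) = ½ d(dΦ ∘ J)` (`GKJet.symplectic_mul_lie`). On the other hand `Ω` is the real part of a
holomorphic symplectic form, whose top power trivializes the canonical bundle of `I`; in this
trivialization the Bismut connection has a connection form proportional to `dΦ ∘ J`
(`GKJet.canonical_conn`), and its curvature is `ρ_B = ½ d(dΦ ∘ J)` (`trace_curvature`,
`LocalGK.bismutRicci_eq`). Hence `Ω (∂_t J) = ρ_B`.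

*Nondegeneracy.* Together with `∂_t ω_I = -2 ρ_B^{1,1}` this gives `∂_t g = Ω [I, ∂_t J]`, which
says `∂_t σ = 0` where `σ` is nondegenerate (`IsGKRFSolution.hasDerivWithinAt_bivector`). The
derivation says nothing at times at which `σ` degenerates. But `(det σ)²` has vanishing derivative
there too, simply because `det σ = 0`; so `(det σ)²` is constant in time, and `σ` never degenerates
(`IsGKRFSolution.nondegAt`).

*The potential.* By the normal form of symplectic matrices, the square of the top power of a 2-form
is its determinant up to a universal factor (`topForm_sq`), which gives
`(F_+^{2n} / F_-^{2n})² = det (I - J) / det (I + J)`. The ratio itself is positive, because the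
family `I + s J`, `-1 ≤ s ≤ 1`, of invertible endomorphisms joins `I - J` to `I + J`
(`topForm_ratio`). Therefore `Φ = ½ log (det (I - J) / det (I + J))`, and `∂_t Φ = -tr (J K ∂_t J)`.
As `Ω (∂_t J) = ½ d(dΦ ∘ J)`, the latter is the Chern Laplacian of `(g, J)` applied to `Φ`
(`GKJet.potential_variation`). It differs from the Chern Laplacian of `(g, I)` by the derivative in
the direction of `X`, which vanishes on `Φ` as `X` is the Hamiltonian vector field of a multiple of
`Φ` (`GKJet.chern_eq`).

*Bounds.* The Chern Laplacian is the trace of the Hessian plus first order terms, so it is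
nonpositive at maxima, and the weak maximum principle applies to `Φ` and to `-Φ`
(`le_of_deriv_nonpos_at_max`).
-/

noncomputable section

namespace GKRF

/-! ### Trilinear identities -/

section Trilinear

variable {V : Type*} [AddCommGroup V] [Module ℝ V]

/-- Real trilinear forms. -/
abbrev Trilin (V : Type*) [AddCommGroup V] [Module ℝ V] : Type _ :=
  V →ₗ[ℝ] V →ₗ[ℝ] V →ₗ[ℝ] ℝ

/-- The Bismut connection preserves `I`, for the 1-jet at a point of a Hermitian structure. Here `G
x y z = (∂_x g)(y, z)`, `P x y z = g((∂_x I) y, z)`, and `D`, `H` stand for `dω` and `d^c ω`. The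
hypotheses `herm` and `hN` are the derivative of `g(I·, I·) = g` and the vanishing of the Nijenhuis
tensor; the left-hand side of the conclusion is `g((∇^B_x I) y, z)`. -/
theorem trilin_nabla_eq_zero (G P : Trilin V) (I : V →ₗ[ℝ] V) (D H : V → V → V → ℝ)
    (hI : ∀ x, I (I x) = -x) (hG : ∀ x y z, G x y z = G x z y)
    (herm : ∀ x y z, G x (I y) (I z) + P x y (I z) + P x z (I y) = G x y z)
    (hN : ∀ x y z, P (I x) y z - P (I y) x z - P y x (I z) + P x y (I z) = 0)
    (hD : ∀ x y z, D x y z = G x (I y) z + P x y z + (G y (I z) x + P y z x)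
      + (G z (I x) y + P z x y))
    (hH : ∀ x y z, H x y z = -D (I x) (I y) (I z)) (x y z : V) :
    P x y z + (1 / 2) * (G x (I y) z + G (I y) x z - G z x (I y)) - (1 / 2) * H x (I y) z
      + ((1 / 2) * (G x y (I z) + G y x (I z) - G (I z) x y) - (1 / 2) * H x y (I z)) = 0 := by
  -- The claim is a linear combination of these instances of the hypotheses, modulo the symmetry of
  -- `G x`.
  have e1 := herm x y (I z)
  have e2 := herm y x (I z)
  have e3 := herm (I x) (I z) (I y)
  have e4 := herm (I y) x z
  have e5 := hN y x (I z)
  have e6 := hN (I x) (I z) (I y)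
  simp only [hH, hD, hI, map_neg, LinearMap.neg_apply] at *
  have s1 := hG (I x) y z
  have s2 := hG (I x) (I z) (I y)
  have s3 := hG x (I y) z
  have s4 := hG z x (I y)
  have s5 := hG (I z) x y
  have s6 := hG z (I x) y
  have s7 := hG y (I x) z
  have s8 := hG y (I z) x
  have s9 := hG y (I x) (I z)
  have s10 := hG (I y) (I x) (I z)
  have s11 := hG (I y) x z
  have s12 := hG (I z) (I x) (I y)
  have s13 := hG z (I y) x
  linarith

/-- In the notation of `trilin_nabla_eq_zero`, the 3-form `d^c ω` is of type `(2,1) + (1,2)`. The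
hypothesis `sq` is the derivative of `I² = -1`. -/
theorem trilin_type (G P : Trilin V) (I : V →ₗ[ℝ] V) (D H : V → V → V → ℝ)
    (hI : ∀ x, I (I x) = -x) (hG : ∀ x y z, G x y z = G x z y)
    (herm : ∀ x y z, G x (I y) (I z) + P x y (I z) + P x z (I y) = G x y z)
    (sq : ∀ x y z, P x (I y) z = P x y (I z))
    (hN : ∀ x y z, P (I x) y z - P (I y) x z - P y x (I z) + P x y (I z) = 0)
    (hD : ∀ x y z, D x y z = G x (I y) z + P x y z + (G y (I z) x + P y z x)
      + (G z (I x) y + P z x y))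
    (hH : ∀ x y z, H x y z = -D (I x) (I y) (I z)) (x y z : V) :
    H x y z = H (I x) (I y) z + H (I x) y (I z) + H x (I y) (I z) := by
  -- The claim is a linear combination of these instances of the hypotheses, modulo the symmetry of
  -- `G x`.
  have e1 := herm (I y) x (I z)
  have e2 := herm (I z) x (I y)
  have e3 := herm x y z
  have e4 := herm y (I x) (I z)
  have e5 := hN (I x) z (I y)
  have e6 := herm (I x) (I y) z
  have e7 := sq x y z
  have e8 := sq y x z
  have e9 := hN x y z
  have e10 := herm z (I x) (I y)
  have e11 := hN (I y) z (I x)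
  have e12 := sq z x y
  simp only [hH, hD, hI, map_neg, LinearMap.neg_apply] at *
  have s1 := hG x y z
  have s2 := hG x y (I z)
  have s3 := hG x (I y) z
  have s4 := hG x (I y) (I z)
  have s5 := hG (I x) y z
  have s6 := hG (I x) y (I z)
  have s7 := hG (I x) (I y) z
  have s8 := hG (I x) (I y) (I z)
  have s9 := hG y x z
  have s10 := hG y x (I z)
  have s11 := hG y (I x) z
  have s12 := hG y (I x) (I z)
  have s13 := hG (I y) x z
  have s14 := hG (I y) x (I z)
  have s15 := hG (I y) (I x) z
  have s16 := hG (I y) (I x) (I z)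
  have s17 := hG z x y
  have s18 := hG z x (I y)
  have s19 := hG z (I x) y
  have s20 := hG z (I x) (I y)
  have s21 := hG (I z) x y
  have s22 := hG (I z) x (I y)
  have s23 := hG (I z) (I x) y
  have s24 := hG (I z) (I x) (I y)
  linarith

/-- The derivatives of the Kähler form are skew. -/
theorem trilin_kahler_skew (G P : Trilin V) (I : V →ₗ[ℝ] V)
    (hI : ∀ x, I (I x) = -x) (hG : ∀ x y z, G x y z = G x z y)
    (herm : ∀ x y z, G x (I y) (I z) + P x y (I z) + P x z (I y) = G x y z)
    (sq : ∀ x y z, P x (I y) z = P x y (I z)) (x y z : V) :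
    G x (I y) z + P x y z = -(G x (I z) y + P x z y) := by
  have e1 := herm x (I y) z
  have e2 := sq x y (I z)
  simp only [hI, map_neg, LinearMap.neg_apply] at *
  have s1 := hG x y (I z)
  linarith

/-- The identity behind the closedness of `g [I, J]⁻¹`: it holds for every 3-form of type `(2,1) +
(1,2)` with respect to both `I` and `J`. For the torsion of the Bismut connection, the cyclic sum of
`S` at `x`, `y`, `z` is the exterior derivative of `g [I, J]⁻¹` at `[I, J] x`, `[I, J] y`, `[I, J]
z`. -/
theorem trilin_closed_of_type (H : Trilin V) (I J : V →ₗ[ℝ] V)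
    (alt1 : ∀ x y z, H x y z = -H y x z) (alt2 : ∀ x y z, H x y z = -H x z y)
    (tI : ∀ x y z, H x y z = H (I x) (I y) z + H (I x) y (I z) + H x (I y) (I z))
    (tJ : ∀ x y z, H x y z = H (J x) (J y) z + H (J x) y (J z) + H x (J y) (J z))
    (S : V → V → V → ℝ)
    (hS : ∀ x y z, S x y z = H (I (J x) - J (I x)) (J z) (I y)
      + H (I (J x) - J (I x)) z (J (I y)) + H (I (J x) - J (I x)) (J (I z)) y
      + H (I (J x) - J (I x)) (I z) (J y)
      - H (I (J x) - J (I x)) (I (J y) - J (I y)) z) (x y z : V) :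
    S x y z + S y z x + S z x y = 0 := by
  -- The claim is a linear combination of these instances of the type conditions, modulo the skew
  -- symmetry of `H`.
  have e1 := tI x (J y) (J z)
  have e2 := tJ x (I y) (I z)
  have e3 := tJ (I x) y (I z)
  have e4 := tJ (I x) (I y) z
  have e5 := tI (J x) y (J z)
  have e6 := tI (J x) (J y) z
  have e7 := tI x y z
  have e8 := tJ x y z
  have c1 : ∀ x y z, H y z x = H x y z := fun x y z => by rw [alt2 y z x, alt1 y x z, neg_neg]
  have c2 : ∀ x y z, H z y x = -H x y z := fun x y z => by rw [alt1 z y x, c1]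
  rw [hS x y z, hS y z x, hS z x y]
  have s1 := alt2 (I (J x) - J (I x)) (J z) (I y)
  have s2 := alt2 (I (J x) - J (I x)) z (J (I y))
  have s3 := alt2 (I (J x) - J (I x)) (J (I z)) y
  have s4 := alt2 (I (J x) - J (I x)) (I z) (J y)
  have s5 := alt1 (I (J y) - J (I y)) (J x) (I z)
  have s6 := alt1 (I (J y) - J (I y)) x (J (I z))
  have s7 := alt1 (I (J y) - J (I y)) (J (I x)) z
  have s8 := alt1 (I (J y) - J (I y)) (I x) (J z)
  have s9 := c1 x (I (J y) - J (I y)) (I (J z) - J (I z))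
  have s10 := c2 (I x) (J y) (I (J z) - J (I z))
  have s11 := c2 (J (I x)) y (I (J z) - J (I z))
  have s12 := c2 x (J (I y)) (I (J z) - J (I z))
  have s13 := c2 (J x) (I y) (I (J z) - J (I z))
  have s14 := c1 (I (J z) - J (I z)) (I (J x) - J (I x)) y
  simp only [map_sub, LinearMap.sub_apply] at *
  linarith

/-- If a closed 2-form `Ω` is compatible with an integrable complex structure `J`, in the sense that
`Ω(J·, ·) = Ω(·, J·)`, then `Ω(J·, ·)` is closed as well. Here `W x y z = (∂_x Ω)(y, z)` and `R x y
z = Ω((∂_x J) y, z)`. -/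
theorem trilin_closed_comp (W R : Trilin V) (J : V →ₗ[ℝ] V) (hJ : ∀ x, J (J x) = -x)
    (hW : ∀ x y z, W x y z = -W x z y)
    (compat : ∀ x y z, W x (J y) z + R x y z = W x y (J z) - R x z y)
    (sq : ∀ x y z, R x (J y) z = -R x y (J z))
    (hN : ∀ x y z, R (J x) y z - R (J y) x z + R y x (J z) - R x y (J z) = 0)
    (closed : ∀ x y z, W x y z + W y z x + W z x y = 0) (x y z : V) :
    W x (J y) z + R x y z + (W y (J z) x + R y z x) + (W z (J x) y + R z x y) = 0 := by
  -- The claim is a linear combination of these instances of the hypotheses, modulo the skew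
  -- symmetry of `W x`.
  have e1 := compat x y z
  have e2 := compat y z x
  have e3 := sq y z (J x)
  have e4 := sq x (J y) z
  have e5 := hN x (J y) z
  have e6 := hN (J z) y x
  have e7 := compat z y x
  have e8 := compat (J x) z (J y)
  have e9 := hN x z (J y)
  have e10 := compat (J y) (J z) x
  have e11 := compat (J z) (J x) y
  have e12 := sq (J z) (J x) (J y)
  have e13 := closed y (J z) x
  have e14 := closed (J y) z x
  have e15 := closed y z (J x)
  have e16 := closed (J x) (J y) (J z)
  simp only [hJ, map_neg, LinearMap.neg_apply] at *
  have s1 := hW x (J y) z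
  have s2 := hW x y (J z)
  have s3 := hW y (J x) z
  have s4 := hW y x (J z)
  have s5 := hW z (J x) y
  have s6 := hW z x (J y)
  have s7 := hW (J x) y z
  have s8 := hW (J y) x z
  have s9 := hW (J z) x y
  have s10 := hW (J x) (J y) (J z)
  have s11 := hW (J y) (J x) (J z)
  have s12 := hW (J z) (J x) (J y)
  linarith

end Trilinear

/-! ### First jets of Hermitian structures -/

section Tri

variable {N : ℕ}

/-- The trilinear form `(X, Y, Z) ↦ ∑ X_i Yᵀ T_i Z` on `ℝ^N`. -/
def tri (T : Fin N → Matrix (Fin N) (Fin N) ℝ) : Trilin (Fin N → ℝ) :=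
  ∑ i, (LinearMap.proj i : (Fin N → ℝ) →ₗ[ℝ] ℝ).smulRight (Matrix.toBilin' (T i))

theorem tri_apply (T : Fin N → Matrix (Fin N) (Fin N) ℝ) (X Y Z : Fin N → ℝ) :
    tri T X Y Z = ∑ i, X i * (Y ⬝ᵥ T i *ᵥ Z) := by
  simp [tri, LinearMap.sum_apply, Matrix.toBilin'_apply']

theorem tri_apply_eq_sum (T : Fin N → Matrix (Fin N) (Fin N) ℝ) (X Y Z : Fin N → ℝ) :
    tri T X Y Z = ∑ i, ∑ j, ∑ k, X i * Y j * Z k * T i j k := by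
  rw [tri_apply]
  refine Finset.sum_congr rfl fun i _ => ?_
  simp only [dotProduct, Matrix.mulVec, Finset.mul_sum]
  refine Finset.sum_congr rfl fun j _ => Finset.sum_congr rfl fun k _ => by ring

@[simp]
theorem tri_single (T : Fin N → Matrix (Fin N) (Fin N) ℝ) (i j k : Fin N) :
    tri T (Pi.single i 1) (Pi.single j 1) (Pi.single k 1) = T i j k := by
  rw [tri_apply, Finset.sum_eq_single i] <;> simp +contextual

theorem tri_mulVec_left (T : Fin N → Matrix (Fin N) (Fin N) ℝ) (A : Matrix (Fin N) (Fin N) ℝ)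
    (X Y Z : Fin N → ℝ) :
    tri T (A *ᵥ X) Y Z = tri (fun i => ∑ a, A a i • T a) X Y Z := by
  rw [tri_apply, tri_apply]
  simp only [Matrix.sum_mulVec, Matrix.smul_mulVec, dotProduct_sum, dotProduct_smul, smul_eq_mul,
    Finset.mul_sum]
  rw [Finset.sum_comm]
  refine Finset.sum_congr rfl fun a _ => ?_
  rw [Matrix.mulVec, dotProduct, Finset.sum_mul]
  exact Finset.sum_congr rfl fun i _ => by ring

theorem tri_mulVec_mid (T : Fin N → Matrix (Fin N) (Fin N) ℝ) (A : Matrix (Fin N) (Fin N) ℝ)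
    (X Y Z : Fin N → ℝ) : tri T X (A *ᵥ Y) Z = tri (fun i => Aᵀ * T i) X Y Z := by
  rw [tri_apply, tri_apply]
  refine Finset.sum_congr rfl fun i _ => ?_
  rw [← Matrix.mulVec_mulVec, Matrix.dotProduct_mulVec Y, Matrix.vecMul_transpose]

theorem tri_mulVec_right (T : Fin N → Matrix (Fin N) (Fin N) ℝ) (A : Matrix (Fin N) (Fin N) ℝ)
    (X Y Z : Fin N → ℝ) : tri T X Y (A *ᵥ Z) = tri (fun i => T i * A) X Y Z := by
  rw [tri_apply, tri_apply]
  refine Finset.sum_congr rfl fun i _ => ?_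
  rw [Matrix.mulVec_mulVec]

theorem tri_transpose (T : Fin N → Matrix (Fin N) (Fin N) ℝ) (X Y Z : Fin N → ℝ) :
    tri (fun i => (T i)ᵀ) X Y Z = tri T X Z Y := by
  rw [tri_apply, tri_apply]
  refine Finset.sum_congr rfl fun i _ => ?_
  rw [Matrix.mulVec_transpose, dotProduct_comm, Matrix.dotProduct_mulVec]

theorem tri_add (S T : Fin N → Matrix (Fin N) (Fin N) ℝ) (X Y Z : Fin N → ℝ) :
    tri (fun i => S i + T i) X Y Z = tri S X Y Z + tri T X Y Z := by
  simp only [tri_apply, Matrix.add_mulVec, dotProduct_add, mul_add, Finset.sum_add_distrib]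

theorem tri_neg (T : Fin N → Matrix (Fin N) (Fin N) ℝ) (X Y Z : Fin N → ℝ) :
    tri (fun i => -T i) X Y Z = -tri T X Y Z := by
  simp only [tri_apply, Matrix.neg_mulVec, dotProduct_neg, mul_neg, Finset.sum_neg_distrib]

theorem tri_sub (S T : Fin N → Matrix (Fin N) (Fin N) ℝ) (X Y Z : Fin N → ℝ) :
    tri (fun i => S i - T i) X Y Z = tri S X Y Z - tri T X Y Z := by
  simp only [tri_apply, Matrix.sub_mulVec, dotProduct_sub, mul_sub, Finset.sum_sub_distrib]

theorem tri_smul (c : ℝ) (T : Fin N → Matrix (Fin N) (Fin N) ℝ) (X Y Z : Fin N → ℝ) :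
    tri (fun i => c • T i) X Y Z = c * tri T X Y Z := by
  simp only [tri_apply, Matrix.smul_mulVec, dotProduct_smul, smul_eq_mul, Finset.mul_sum]
  exact Finset.sum_congr rfl fun i _ => by ring

theorem tri_congr {S T : Fin N → Matrix (Fin N) (Fin N) ℝ} (h : ∀ i, S i = T i)
    (X Y Z : Fin N → ℝ) : tri S X Y Z = tri T X Y Z := by
  rw [funext h]

theorem tri_zero (X Y Z : Fin N → ℝ) : tri (fun _ => 0) X Y Z = 0 := by
  simp [tri_apply]

/-- The components `t_ijk` of a 3-tensor, arranged as a family of matrices. -/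
def tens (t : Fin N → Fin N → Fin N → ℝ) : Fin N → Matrix (Fin N) (Fin N) ℝ :=
  fun i => Matrix.of (t i)

theorem tri_tens_cyclic (t : Fin N → Fin N → Fin N → ℝ) (X Y Z : Fin N → ℝ) :
    tri (tens fun i j k => t j k i) X Y Z = tri (tens t) Y Z X := by
  simp only [tri_apply_eq_sum, tens, Matrix.of_apply]
  rw [Finset.sum_comm]
  refine Finset.sum_congr rfl fun j _ => ?_
  rw [Finset.sum_comm]
  refine Finset.sum_congr rfl fun k _ => Finset.sum_congr rfl fun i _ => by ring

theorem tri_tens_swap (t : Fin N → Fin N → Fin N → ℝ) (X Y Z : Fin N → ℝ) :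
    tri (tens fun i j k => t j i k) X Y Z = tri (tens t) Y X Z := by
  simp only [tri_apply_eq_sum, tens, Matrix.of_apply]
  rw [Finset.sum_comm]
  refine Finset.sum_congr rfl fun j _ => Finset.sum_congr rfl fun k _ =>
    Finset.sum_congr rfl fun i _ => by ring

theorem tri_tens_pullback (t : Fin N → Fin N → Fin N → ℝ) (A : Matrix (Fin N) (Fin N) ℝ)
    (X Y Z : Fin N → ℝ) :
    tri (tens fun i j k => ∑ a, ∑ b, ∑ c, A a i * A b j * A c k * t a b c) X Y Z
      = tri (tens t) (A *ᵥ X) (A *ᵥ Y) (A *ᵥ Z) := by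
  rw [tri_mulVec_left, tri_mulVec_mid, tri_mulVec_right]
  refine congrArg (fun T => tri T X Y Z) (funext fun i => ?_)
  ext j k
  simp only [tens, Matrix.of_apply, Matrix.mul_apply, Matrix.sum_apply, Matrix.smul_apply,
    smul_eq_mul, Matrix.transpose_apply, Finset.sum_mul, Finset.mul_sum]
  refine ((Finset.sum_congr rfl fun a _ => Finset.sum_comm).trans (Finset.sum_comm.trans
    (Finset.sum_congr rfl fun c _ => Finset.sum_comm))).trans ?_
  refine Finset.sum_congr rfl fun c _ => ?_
  rw [Finset.sum_comm]
  exact Finset.sum_congr rfl fun b _ => Finset.sum_congr rfl fun a _ => by ring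

theorem tri_eq_zero_of_forall {T : Fin N → Matrix (Fin N) (Fin N) ℝ}
    (h : ∀ X Y Z, tri T X Y Z = 0) (i : Fin N) : T i = 0 := by
  ext j k
  rw [← tri_single T i j k, h]
  rfl

end Tri

section HermJet

variable {N : ℕ}

/-- The 1-jet at a point of a Hermitian structure: the components `g`, `I` of a metric and of an
integrable complex structure, and their partial derivatives `dg i`, `dI i`. -/
structure HermJet (g I : Matrix (Fin N) (Fin N) ℝ) (dg dI : Fin N → Matrix (Fin N) (Fin N) ℝ) :
    Prop where
  g_symm : gᵀ = g
  g_unit : IsUnit g.det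
  sq : I * I = -1
  herm : Iᵀ * g * I = g
  dg_symm : ∀ i, (dg i)ᵀ = dg i
  dsq : ∀ i, dI i * I + I * dI i = 0
  dherm : ∀ i, (dI i)ᵀ * g * I + Iᵀ * dg i * I + Iᵀ * g * dI i = dg i
  nij : ∀ i j k, ∑ l, (I l j * dI l i k - I l k * dI l i j + I i l * dI k l j
    - I i l * dI j l k) = 0

/-- The partial derivatives of the Kähler form. -/
def jetKahler (g I : Matrix (Fin N) (Fin N) ℝ) (dg dI : Fin N → Matrix (Fin N) (Fin N) ℝ) :
    Fin N → Matrix (Fin N) (Fin N) ℝ := fun i => (dI i)ᵀ * g + Iᵀ * dg i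

/-- The exterior derivative of a 2-form with partial derivatives `W i`. -/
def jetExt (W : Fin N → Matrix (Fin N) (Fin N) ℝ) (i j k : Fin N) : ℝ :=
  W i j k + W j k i + W k i j

theorem tri_jetExt (W : Fin N → Matrix (Fin N) (Fin N) ℝ) (X Y Z : Fin N → ℝ) :
    tri (tens (jetExt W)) X Y Z = tri W X Y Z + tri W Y Z X + tri W Z X Y := by
  have h1 := tri_tens_cyclic (fun i j k => W i j k) X Y Z
  have h2 := tri_tens_cyclic (fun i j k => W j k i) X Y Z
  have h3 := tri_tens_cyclic (fun i j k => W i j k) Y Z X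
  have e : tens (fun i j k => W i j k) = W := rfl
  rw [e] at h1 h3
  rw [h3] at h2
  rw [← h1, ← h2, ← tri_add, ← tri_add]
  rfl

/-- The components of `d^c ω`. -/
def jetTorsion (g I : Matrix (Fin N) (Fin N) ℝ) (dg dI : Fin N → Matrix (Fin N) (Fin N) ℝ)
    (i j k : Fin N) : ℝ :=
  -∑ a, ∑ b, ∑ c, I a i * I b j * I c k * jetExt (jetKahler g I dg dI) a b c

/-- The connection matrices `Γ_i` of the Bismut connection, for which `∇_i Y = ∂_i Y + Γ_i Y`; the
3-form `t` stands for `d^c ω`, and the torsion is `-t`. -/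
def jetConn (g : Matrix (Fin N) (Fin N) ℝ) (dg : Fin N → Matrix (Fin N) (Fin N) ℝ)
    (t : Fin N → Fin N → Fin N → ℝ) (i : Fin N) : Matrix (Fin N) (Fin N) ℝ :=
  g⁻¹ * Matrix.of fun l j =>
    (1 / 2) * (dg i j l + dg j i l - dg l i j) - (1 / 2) * t i j l

/-- The endomorphism `H_X` with `g(H_X Y, Z) = t(X, Y, Z)`. -/
def torsionEnd (g : Matrix (Fin N) (Fin N) ℝ) (t : Fin N → Fin N → Fin N → ℝ) :
    (Fin N → ℝ) →ₗ[ℝ] Matrix (Fin N) (Fin N) ℝ :=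
  ∑ i, (LinearMap.proj i : (Fin N → ℝ) →ₗ[ℝ] ℝ).smulRight (g⁻¹ * (tens t i)ᵀ)

theorem torsionEnd_apply (g : Matrix (Fin N) (Fin N) ℝ) (t : Fin N → Fin N → Fin N → ℝ)
    (X : Fin N → ℝ) : torsionEnd g t X = ∑ i, X i • (g⁻¹ * (tens t i)ᵀ) := by
  simp [torsionEnd, LinearMap.sum_apply]

theorem torsionEnd_single (g : Matrix (Fin N) (Fin N) ℝ) (t : Fin N → Fin N → Fin N → ℝ)
    (i : Fin N) : torsionEnd g t (Pi.single i 1) = g⁻¹ * (tens t i)ᵀ := by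
  rw [torsionEnd_apply, Finset.sum_eq_single i] <;> simp +contextual

theorem torsionEnd_neg (g : Matrix (Fin N) (Fin N) ℝ) (t : Fin N → Fin N → Fin N → ℝ)
    (X : Fin N → ℝ) : torsionEnd g (fun i j k => -t i j k) X = -torsionEnd g t X := by
  rw [torsionEnd_apply, torsionEnd_apply, ← Finset.sum_neg_distrib]
  refine Finset.sum_congr rfl fun i _ => ?_
  rw [← smul_neg, ← Matrix.mul_neg]
  rfl

theorem dotProduct_torsionEnd {g : Matrix (Fin N) (Fin N) ℝ} (hg : IsUnit g.det)
    (t : Fin N → Fin N → Fin N → ℝ) (X Y Z : Fin N → ℝ) :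
    Z ⬝ᵥ (g * torsionEnd g t X) *ᵥ Y = tri (tens t) X Y Z := by
  rw [torsionEnd_apply, Finset.mul_sum, Matrix.sum_mulVec, dotProduct_sum, tri_apply]
  refine Finset.sum_congr rfl fun i _ => ?_
  rw [Matrix.mul_smul, Matrix.mul_nonsing_inv_cancel_left _ _ hg, Matrix.smul_mulVec,
    dotProduct_smul, smul_eq_mul, Matrix.mulVec_transpose, dotProduct_comm,
    Matrix.dotProduct_mulVec]

theorem matrix_ext_dotProduct {A B : Matrix (Fin N) (Fin N) ℝ}
    (h : ∀ Y Z : Fin N → ℝ, Z ⬝ᵥ A *ᵥ Y = Z ⬝ᵥ B *ᵥ Y) : A = B := by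
  ext i j
  simpa using h (Pi.single j 1) (Pi.single i 1)

/-- Complex structures which preserve `g` are skew for `g`. -/
theorem transpose_mul_of_invariant {g A : Matrix (Fin N) (Fin N) ℝ} (hA : A * A = -1)
    (hg : Aᵀ * g * A = g) : Aᵀ * g = -(g * A) := by
  conv_rhs => rw [← hg]
  rw [Matrix.mul_assoc, hA, Matrix.mul_neg, Matrix.mul_one, neg_neg]

theorem transpose_mul_commutator {g A B : Matrix (Fin N) (Fin N) ℝ} (hA : Aᵀ * g = -(g * A))
    (hB : Bᵀ * g = -(g * B)) : (A * B - B * A)ᵀ * g = -(g * (A * B - B * A)) := by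
  rw [Matrix.transpose_sub, Matrix.transpose_mul, Matrix.transpose_mul, Matrix.sub_mul,
    Matrix.mul_assoc, Matrix.mul_assoc, hA, hB, Matrix.mul_neg, Matrix.mul_neg,
    ← Matrix.mul_assoc, ← Matrix.mul_assoc, hA, hB, Matrix.mul_sub]
  simp only [Matrix.neg_mul, Matrix.mul_assoc]
  abel

theorem transpose_mul_of_right_inv {g Q K : Matrix (Fin N) (Fin N) ℝ} (hQ : Qᵀ * g = -(g * Q))
    (hQK : Q * K = 1) : Kᵀ * g = -(g * K) := by
  have h1 := congrArg (fun A => Kᵀ * A * K) hQ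
  simp only [Matrix.mul_neg, Matrix.neg_mul, Matrix.mul_assoc, hQK, Matrix.mul_one] at h1
  rw [← Matrix.mul_assoc Kᵀ, ← Matrix.transpose_mul, hQK, Matrix.transpose_one,
    Matrix.one_mul] at h1
  rw [h1, neg_neg]

namespace HermJet

variable {g I : Matrix (Fin N) (Fin N) ℝ} {dg dI : Fin N → Matrix (Fin N) (Fin N) ℝ}

theorem skew (h : HermJet g I dg dI) : Iᵀ * g = -(g * I) :=
  transpose_mul_of_invariant h.sq h.herm

theorem inv_symm (h : HermJet g I dg dI) : (g⁻¹)ᵀ = g⁻¹ := by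
  rw [Matrix.transpose_nonsing_inv, h.g_symm]

theorem inv_skew (h : HermJet g I dg dI) : g⁻¹ * Iᵀ = -(I * g⁻¹) := by
  have h1 := congrArg (fun A => g⁻¹ * A * g⁻¹) h.skew
  simp only [Matrix.mul_neg, Matrix.neg_mul, Matrix.mul_assoc,
    Matrix.mul_nonsing_inv _ h.g_unit, Matrix.mul_one] at h1
  rw [h1, Matrix.nonsing_inv_mul_cancel_left _ _ h.g_unit]

theorem dg_apply_comm (h : HermJet g I dg dI) (i a b : Fin N) : dg i a b = dg i b a := by
  conv_lhs => rw [← h.dg_symm i]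
  rfl

theorem jetConn_transpose_mul (h : HermJet g I dg dI) (t : Fin N → Fin N → Fin N → ℝ) (i : Fin N) :
    (jetConn g dg t i)ᵀ * g = Matrix.of fun j l =>
      (1 / 2) * (dg i j l + dg j i l - dg l i j) - (1 / 2) * t i j l := by
  rw [jetConn, Matrix.transpose_mul, h.inv_symm, Matrix.mul_assoc,
    Matrix.nonsing_inv_mul _ h.g_unit, Matrix.mul_one]
  rfl

theorem tri_symm (h : HermJet g I dg dI) (X Y Z : Fin N → ℝ) :
    tri dg X Y Z = tri dg X Z Y := by
  rw [← tri_transpose]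
  exact tri_congr h.dg_symm _ _ _

theorem mulVec_mulVec_neg (h : HermJet g I dg dI) (X : Fin N → ℝ) : I *ᵥ I *ᵥ X = -X := by
  rw [Matrix.mulVec_mulVec, h.sq, Matrix.neg_mulVec, Matrix.one_mulVec]

/-- The derivative of `g(I·, I·) = g`. -/
theorem tri_herm (h : HermJet g I dg dI) (X Y Z : Fin N → ℝ) :
    tri dg X (I *ᵥ Y) (I *ᵥ Z) + tri (fun i => (dI i)ᵀ * g) X Y (I *ᵥ Z)
      + tri (fun i => (dI i)ᵀ * g) X Z (I *ᵥ Y) = tri dg X Y Z := by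
  rw [← tri_transpose (fun i => (dI i)ᵀ * g) X (I *ᵥ Y) Z, tri_mulVec_mid dg I,
    tri_mulVec_mid _ I, tri_mulVec_right, tri_mulVec_right, ← tri_add, ← tri_add]
  refine tri_congr (fun i => ?_) _ _ _
  refine Eq.trans ?_ (h.dherm i)
  simp only [Matrix.transpose_mul, Matrix.transpose_transpose, h.g_symm, Matrix.mul_assoc]
  abel

/-- The derivative of `I² = -1`. -/
theorem tri_sq (h : HermJet g I dg dI) (X Y Z : Fin N → ℝ) :
    tri (fun i => (dI i)ᵀ * g) X (I *ᵥ Y) Z = tri (fun i => (dI i)ᵀ * g) X Y (I *ᵥ Z) := by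
  rw [tri_mulVec_mid, tri_mulVec_right]
  refine tri_congr (fun i => ?_) _ _ _
  have := congrArg Matrix.transpose (eq_neg_of_add_eq_zero_left (h.dsq i))
  simp only [Matrix.transpose_mul, Matrix.transpose_neg] at this
  rw [Matrix.mul_assoc, ← neg_eq_iff_eq_neg.mpr h.skew, Matrix.mul_neg, ← Matrix.mul_assoc,
    ← Matrix.mul_assoc, this, Matrix.neg_mul]

/-- Vanishing of the Nijenhuis tensor. -/
theorem tri_nij (h : HermJet g I dg dI) (X Y Z : Fin N → ℝ) :
    tri (fun i => (dI i)ᵀ * g) (I *ᵥ X) Y Z - tri (fun i => (dI i)ᵀ * g) (I *ᵥ Y) X Z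
      - tri (fun i => (dI i)ᵀ * g) Y X (I *ᵥ Z)
      + tri (fun i => (dI i)ᵀ * g) X Y (I *ᵥ Z) = 0 := by
  have hs : ∀ (T : Fin N → Matrix (Fin N) (Fin N) ℝ),
      tri T Y X Z = tri (tens fun i j k => T j i k) X Y Z := fun T =>
    (tri_tens_swap (fun i j k => T i j k) X Y Z).symm
  rw [tri_mulVec_left, tri_mulVec_left, tri_mulVec_right, tri_mulVec_right, hs, hs, ← tri_sub,
    ← tri_sub, ← tri_add, ← tri_zero X Y Z]
  refine tri_congr (fun j => ?_) _ _ _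
  ext k m
  have key : ∀ a, (dI a)ᵀ * g * I = -((I * dI a)ᵀ * g) := fun a => by
    rw [Matrix.mul_assoc, ← neg_eq_iff_eq_neg.mpr h.skew, Matrix.mul_neg, ← Matrix.mul_assoc,
      Matrix.transpose_mul]
  have hz : ∑ i, (∑ l, (I l j * dI l i k - I l k * dI l i j + I i l * dI k l j
      - I i l * dI j l k)) * g i m = 0 := by simp [h.nij]
  simp only [key]
  simp only [tens, Matrix.of_apply, Matrix.add_apply, Matrix.sub_apply, Matrix.neg_apply,
    Matrix.sum_apply, Matrix.smul_apply, Matrix.mul_apply, Matrix.transpose_apply, smul_eq_mul,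
    Matrix.zero_apply]
  rw [← hz]
  simp only [Finset.sum_mul, Finset.mul_sum, add_mul, sub_mul, Finset.sum_add_distrib,
    Finset.sum_sub_distrib]
  rw [Finset.sum_comm (f := fun l i => I l j * (dI l i k * g i m)),
    Finset.sum_comm (f := fun l i => I l k * (dI l i j * g i m))]
  simp only [mul_assoc]
  ring

theorem tri_ext (g I : Matrix (Fin N) (Fin N) ℝ) (dg dI : Fin N → Matrix (Fin N) (Fin N) ℝ)
    (X Y Z : Fin N → ℝ) :
    tri (tens (jetExt (jetKahler g I dg dI))) X Y Z
      = tri dg X (I *ᵥ Y) Z + tri (fun i => (dI i)ᵀ * g) X Y Z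
      + (tri dg Y (I *ᵥ Z) X + tri (fun i => (dI i)ᵀ * g) Y Z X)
      + (tri dg Z (I *ᵥ X) Y + tri (fun i => (dI i)ᵀ * g) Z X Y) := by
  have hW : ∀ X Y Z, tri dg X (I *ᵥ Y) Z + tri (fun i => (dI i)ᵀ * g) X Y Z
      = tri (jetKahler g I dg dI) X Y Z := fun X Y Z => by
    rw [tri_mulVec_mid, add_comm, ← tri_add]
    rfl
  rw [hW, hW, hW, tri_jetExt]

theorem tri_torsion (g I : Matrix (Fin N) (Fin N) ℝ)
    (dg dI : Fin N → Matrix (Fin N) (Fin N) ℝ) (X Y Z : Fin N → ℝ) :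
    tri (tens (jetTorsion g I dg dI)) X Y Z
      = -tri (tens (jetExt (jetKahler g I dg dI))) (I *ᵥ X) (I *ᵥ Y) (I *ᵥ Z) := by
  rw [← tri_tens_pullback, ← tri_neg]
  rfl

/-- The Bismut connection preserves the complex structure. -/
theorem conn (h : HermJet g I dg dI) (i : Fin N) :
    dI i = I * jetConn g dg (jetTorsion g I dg dI) i
      - jetConn g dg (jetTorsion g I dg dI) i * I := by
  set t := jetTorsion g I dg dI with ht
  set C : Fin N → Matrix (Fin N) (Fin N) ℝ := fun i => Matrix.of fun l j =>
    (1 / 2) * (dg i j l + dg j i l - dg l i j) - (1 / 2) * t i j l with hC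
  have hCtri : ∀ X Y Z, tri (fun i => (C i)ᵀ) X Y Z
      = (1 / 2) * (tri dg X Y Z + tri dg Y X Z - tri dg Z X Y) - (1 / 2) * tri (tens t) X Y Z := by
    intro X Y Z
    have h1 := tri_tens_swap (fun i j k => dg i j k) X Y Z
    have h2 := tri_tens_cyclic (fun i j k => dg j k i) X Y Z
    have h3 := tri_tens_cyclic (fun i j k => dg i j k) Y Z X
    have e : tens (fun i j k => dg i j k) = dg := rfl
    rw [e] at h1 h3
    rw [h3] at h2
    rw [← h1, ← h2, ← tri_add, ← tri_sub, ← tri_smul, ← tri_smul, ← tri_sub]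
    rfl
  have hT := trilin_nabla_eq_zero (tri dg) (tri fun i => (dI i)ᵀ * g) (Matrix.mulVecLin I)
    (fun x y z => tri (tens (jetExt (jetKahler g I dg dI))) x y z)
    (fun x y z => tri (tens t) x y z) h.mulVec_mulVec_neg h.tri_symm h.tri_herm
    h.tri_nij (tri_ext g I dg dI) (tri_torsion g I dg dI)
  simp only [Matrix.mulVecLin_apply] at hT
  have hz : (dI i)ᵀ * g + Iᵀ * (C i)ᵀ + (C i)ᵀ * I = 0 := by
    refine tri_eq_zero_of_forall (T := fun i => (dI i)ᵀ * g + Iᵀ * (C i)ᵀ + (C i)ᵀ * I)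
      (fun X Y Z => ?_) i
    rw [tri_add, tri_add, ← tri_mulVec_mid (fun i => (C i)ᵀ), ← tri_mulVec_right (fun i => (C i)ᵀ),
      hCtri, hCtri]
    rw [add_assoc, ← hT X Y Z]
    ring
  have hz' := congrArg Matrix.transpose hz
  simp only [Matrix.transpose_add, Matrix.transpose_mul, Matrix.transpose_transpose, h.g_symm,
    Matrix.transpose_zero] at hz'
  have hΓ : jetConn g dg t i = g⁻¹ * C i := rfl
  have h2 := congrArg (g⁻¹ * ·) hz'
  simp only [Matrix.mul_add, Matrix.mul_zero, ← Matrix.mul_assoc,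
    Matrix.nonsing_inv_mul _ h.g_unit, Matrix.one_mul, h.inv_skew] at h2
  rw [hΓ, ← Matrix.mul_assoc, ← sub_eq_zero, ← h2]
  simp only [Matrix.neg_mul]
  abel

/-- The 3-form `d^c ω` is of type `(2,1) + (1,2)`. -/
theorem tri_torsion_type (h : HermJet g I dg dI) (X Y Z : Fin N → ℝ) :
    tri (tens (jetTorsion g I dg dI)) X Y Z
      = tri (tens (jetTorsion g I dg dI)) (I *ᵥ X) (I *ᵥ Y) Z
        + tri (tens (jetTorsion g I dg dI)) (I *ᵥ X) Y (I *ᵥ Z)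
        + tri (tens (jetTorsion g I dg dI)) X (I *ᵥ Y) (I *ᵥ Z) :=
  trilin_type (tri dg) (tri fun i => (dI i)ᵀ * g) (Matrix.mulVecLin I)
    (fun x y z => tri (tens (jetExt (jetKahler g I dg dI))) x y z)
    (fun x y z => tri (tens (jetTorsion g I dg dI)) x y z) h.mulVec_mulVec_neg h.tri_symm h.tri_herm
    h.tri_sq h.tri_nij (tri_ext g I dg dI) (tri_torsion g I dg dI) X Y Z

theorem tri_torsion_swap_right (h : HermJet g I dg dI) (X Y Z : Fin N → ℝ) :
    tri (tens (jetTorsion g I dg dI)) X Y Z = -tri (tens (jetTorsion g I dg dI)) X Z Y := by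
  have hs := trilin_kahler_skew (tri dg) (tri fun i => (dI i)ᵀ * g) (Matrix.mulVecLin I)
    h.mulVec_mulVec_neg h.tri_symm h.tri_herm h.tri_sq
  simp only [Matrix.mulVecLin_apply] at hs
  rw [tri_torsion, tri_torsion, tri_ext, tri_ext, hs (I *ᵥ X), hs (I *ᵥ Y), hs (I *ᵥ Z)]
  ring

theorem tri_torsion_swap_left (h : HermJet g I dg dI) (X Y Z : Fin N → ℝ) :
    tri (tens (jetTorsion g I dg dI)) X Y Z = -tri (tens (jetTorsion g I dg dI)) Y X Z := by
  have hs := trilin_kahler_skew (tri dg) (tri fun i => (dI i)ᵀ * g) (Matrix.mulVecLin I)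
    h.mulVec_mulVec_neg h.tri_symm h.tri_herm h.tri_sq
  simp only [Matrix.mulVecLin_apply] at hs
  rw [tri_torsion, tri_torsion, tri_ext, tri_ext, hs (I *ᵥ X), hs (I *ᵥ Y), hs (I *ᵥ Z)]
  ring

theorem torsion_swap_left (h : HermJet g I dg dI) (i j l : Fin N) :
    jetTorsion g I dg dI i j l = -jetTorsion g I dg dI j i l := by
  have := h.tri_torsion_swap_left (Pi.single i 1) (Pi.single j 1) (Pi.single l 1)
  rwa [tri_single, tri_single] at this

theorem torsion_swap_right (h : HermJet g I dg dI) (i j l : Fin N) :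
    jetTorsion g I dg dI i j l = -jetTorsion g I dg dI i l j := by
  have := h.tri_torsion_swap_right (Pi.single i 1) (Pi.single j 1) (Pi.single l 1)
  rwa [tri_single, tri_single] at this

end HermJet

end HermJet

/-! ### First jets of nondegenerate generalized Kähler structures -/

section TypeOperator

variable {N : ℕ}

/-- The type condition `(2,1) + (1,2)` on a 3-form, in terms of the endomorphisms `H_X`. -/
theorem torsionEnd_type {g I : Matrix (Fin N) (Fin N) ℝ} {t : Fin N → Fin N → Fin N → ℝ}
    (hg : IsUnit g.det) (hsk : Iᵀ * g = -(g * I))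
    (ht : ∀ X Y Z, tri (tens t) X Y Z = tri (tens t) (I *ᵥ X) (I *ᵥ Y) Z
      + tri (tens t) (I *ᵥ X) Y (I *ᵥ Z) + tri (tens t) X (I *ᵥ Y) (I *ᵥ Z)) (X : Fin N → ℝ) :
    torsionEnd g t X + I * torsionEnd g t X * I
      = torsionEnd g t (I *ᵥ X) * I - I * torsionEnd g t (I *ᵥ X) := by
  have hgI : ∀ A : Matrix (Fin N) (Fin N) ℝ, g * (I * A) = -(Iᵀ * (g * A)) := fun A => by
    rw [← Matrix.mul_assoc, ← neg_eq_iff_eq_neg.mpr hsk, Matrix.neg_mul, Matrix.mul_assoc]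
  have hcancel : ∀ A B : Matrix (Fin N) (Fin N) ℝ, g * A = g * B → A = B := fun A B h => by
    have := congrArg (g⁻¹ * ·) h
    simpa only [Matrix.nonsing_inv_mul_cancel_left _ _ hg] using this
  apply hcancel
  refine matrix_ext_dotProduct fun Y Z => ?_
  have hT : ∀ (A : Matrix (Fin N) (Fin N) ℝ), Z ⬝ᵥ (Iᵀ * A) *ᵥ Y = (I *ᵥ Z) ⬝ᵥ A *ᵥ Y := fun A => by
    rw [← Matrix.mulVec_mulVec, Matrix.dotProduct_mulVec Z, Matrix.vecMul_transpose]
  rw [Matrix.mul_add, Matrix.mul_sub, Matrix.mul_assoc, hgI, hgI, ← Matrix.mul_assoc g,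
    ← Matrix.mul_assoc g, Matrix.add_mulVec, Matrix.sub_mulVec, Matrix.neg_mulVec,
    Matrix.neg_mulVec, dotProduct_add, dotProduct_sub, dotProduct_neg, dotProduct_neg, hT, hT,
    ← Matrix.mulVec_mulVec Y _ I, ← Matrix.mulVec_mulVec Y _ I, dotProduct_torsionEnd hg,
    dotProduct_torsionEnd hg, dotProduct_torsionEnd hg, dotProduct_torsionEnd hg, ht X Y Z]
  ring

/-- For a 3-form of type `(2,1) + (1,2)` with respect to `I`, and for `A` anticommuting with `I`,
one has `tr (H_X A) = tr (H_{IX} I A)`: the two sides of `torsionEnd_type` are traced against `A`.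
-/
theorem trace_torsionEnd_mul {g I : Matrix (Fin N) (Fin N) ℝ} {t : Fin N → Fin N → Fin N → ℝ}
    (hg : IsUnit g.det) (hsq : I * I = -1) (hsk : Iᵀ * g = -(g * I))
    (ht : ∀ X Y Z, tri (tens t) X Y Z = tri (tens t) (I *ᵥ X) (I *ᵥ Y) Z
      + tri (tens t) (I *ᵥ X) Y (I *ᵥ Z) + tri (tens t) X (I *ᵥ Y) (I *ᵥ Z))
    {A : Matrix (Fin N) (Fin N) ℝ} (hA : I * A = -(A * I)) (X : Fin N → ℝ) :
    (torsionEnd g t X * A).trace = (torsionEnd g t (I *ᵥ X) * (I * A)).trace := by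
  have h := congrArg (fun B => (B * A).trace) (torsionEnd_type hg hsk ht X)
  simp only [Matrix.add_mul, Matrix.sub_mul, Matrix.trace_add, Matrix.trace_sub] at h
  rw [Matrix.mul_assoc I, Matrix.mul_assoc I, Matrix.mul_assoc I, Matrix.trace_mul_comm I,
    Matrix.trace_mul_comm I, Matrix.mul_assoc, Matrix.mul_assoc, Matrix.mul_assoc,
    Matrix.mul_assoc] at h
  have e1 : I * (A * I) = A := by
    rw [← neg_eq_iff_eq_neg.mpr hA, Matrix.mul_neg, ← Matrix.mul_assoc, hsq]
    simp
  have e2 : A * I = -(I * A) := (neg_eq_iff_eq_neg.mpr hA).symm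
  rw [e1, e2, Matrix.mul_neg, Matrix.trace_neg] at h
  linarith

end TypeOperator

section GKJet

variable {N : ℕ}

/-- The 1-jet at a point of a nondegenerate generalized Kähler structure; `K` stands for the inverse
of the commutator `[I, J]`, so that `g * K` is the real part of a holomorphic symplectic form. Besides
the equations that say so, only the derivatives of those algebraic identities are recorded that are
used: `g * K` is skew and compatible with `J`, and `K` anticommutes with `I`. -/
structure GKJet (g I J K : Matrix (Fin N) (Fin N) ℝ)
    (dg dI dJ dK : Fin N → Matrix (Fin N) (Fin N) ℝ) : Prop where
  hermI : HermJet g I dg dI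
  hermJ : HermJet g J dg dJ
  torsion : ∀ i j k, jetTorsion g I dg dI i j k = -jetTorsion g J dg dJ i j k
  mul_inv : (I * J - J * I) * K = 1
  dmul_inv : ∀ i, (dI i * J + I * dJ i - (dJ i * I + J * dI i)) * K + (I * J - J * I) * dK i = 0
  dskew : ∀ i, (dg i * K + g * dK i)ᵀ = -(dg i * K + g * dK i)
  dcompat : ∀ i, (dJ i)ᵀ * (g * K) + Jᵀ * (dg i * K + g * dK i)
    = (dg i * K + g * dK i) * J + g * K * dJ i
  danti : ∀ i, dI i * K + I * dK i = -(dK i * I + K * dI i)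

namespace GKJet

variable {g I J K : Matrix (Fin N) (Fin N) ℝ} {dg dI dJ dK : Fin N → Matrix (Fin N) (Fin N) ℝ}

theorem inv_mul (h : GKJet g I J K dg dI dJ dK) : K * (I * J - J * I) = 1 :=
  mul_eq_one_comm.mp h.mul_inv

theorem anti_comm_left (hI : I * I = -1) : I * (I * J - J * I) = -((I * J - J * I) * I) := by
  have : I * (I * J - J * I) + (I * J - J * I) * I = (I * I) * J - J * (I * I) := by
    noncomm_ring
  rw [eq_neg_iff_add_eq_zero, this, hI]
  simp

theorem anti_comm_right (hJ : J * J = -1) : J * (I * J - J * I) = -((I * J - J * I) * J) := by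
  have := anti_comm_left (J := I) hJ
  rw [← neg_sub (I * J), Matrix.mul_neg, Matrix.neg_mul] at this
  exact neg_injective this

theorem anti_comm_inv {A Q : Matrix (Fin N) (Fin N) ℝ} (hQ : Q * K = 1) (hQ' : K * Q = 1)
    (h : A * Q = -(Q * A)) : A * K = -(K * A) := by
  have := congrArg (fun B => K * B * K) h
  simp only [Matrix.mul_neg, Matrix.neg_mul, Matrix.mul_assoc, hQ, Matrix.mul_one] at this
  rw [← Matrix.mul_assoc K Q, hQ', Matrix.one_mul] at this
  rw [this, neg_neg]

theorem anti_left (h : GKJet g I J K dg dI dJ dK) : I * K = -(K * I) :=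
  anti_comm_inv h.mul_inv h.inv_mul (anti_comm_left h.hermI.sq)

theorem anti_right (h : GKJet g I J K dg dI dJ dK) : J * K = -(K * J) :=
  anti_comm_inv h.mul_inv h.inv_mul (anti_comm_right h.hermJ.sq)

theorem torsion_eq_neg (h : GKJet g I J K dg dI dJ dK) :
    jetTorsion g J dg dJ = fun i j k => -jetTorsion g I dg dI i j k := by
  funext i j k
  rw [h.torsion, neg_neg]

theorem torsion_typeJ (h : GKJet g I J K dg dI dJ dK) (X Y Z : Fin N → ℝ) :
    tri (tens (jetTorsion g I dg dI)) X Y Z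
      = tri (tens (jetTorsion g I dg dI)) (J *ᵥ X) (J *ᵥ Y) Z
        + tri (tens (jetTorsion g I dg dI)) (J *ᵥ X) Y (J *ᵥ Z)
        + tri (tens (jetTorsion g I dg dI)) X (J *ᵥ Y) (J *ᵥ Z) := by
  have := h.hermJ.tri_torsion_type X Y Z
  have e : ∀ X Y Z, tri (tens (jetTorsion g J dg dJ)) X Y Z
      = -tri (tens (jetTorsion g I dg dI)) X Y Z := fun X Y Z => by
    rw [← tri_neg, h.torsion_eq_neg]
    rfl
  simp only [e] at this
  linarith

/-- `J` is preserved by the connection with the opposite torsion, which is `∇^B + H`. -/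
theorem connJ (h : GKJet g I J K dg dI dJ dK) (i : Fin N) :
    dJ i = J * (jetConn g dg (jetTorsion g I dg dI) i
        + torsionEnd g (jetTorsion g I dg dI) (Pi.single i 1))
      - (jetConn g dg (jetTorsion g I dg dI) i
        + torsionEnd g (jetTorsion g I dg dI) (Pi.single i 1)) * J := by
  have e : jetConn g dg (jetTorsion g J dg dJ) i = jetConn g dg (jetTorsion g I dg dI) i
        + torsionEnd g (jetTorsion g I dg dI) (Pi.single i 1) := by
    rw [torsionEnd_single, jetConn, jetConn, ← Matrix.mul_add, h.torsion_eq_neg]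
    congr 1
    ext l j
    simp only [tens, Matrix.of_apply, Matrix.add_apply, Matrix.transpose_apply]
    ring
  rw [← e]
  exact h.hermJ.conn i

theorem trace_left (h : GKJet g I J K dg dI dJ dK) {A : Matrix (Fin N) (Fin N) ℝ}
    (hA : I * A = -(A * I)) (X : Fin N → ℝ) :
    (torsionEnd g (jetTorsion g I dg dI) X * (I * A)).trace
      = -(torsionEnd g (jetTorsion g I dg dI) (I *ᵥ X) * A).trace := by
  rw [trace_torsionEnd_mul h.hermI.g_unit h.hermI.sq h.hermI.skew h.hermI.tri_torsion_type hA
    (I *ᵥ X), h.hermI.mulVec_mulVec_neg, map_neg, Matrix.neg_mul, Matrix.trace_neg, neg_neg]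

theorem trace_right (h : GKJet g I J K dg dI dJ dK) {A : Matrix (Fin N) (Fin N) ℝ}
    (hA : J * A = -(A * J)) (X : Fin N → ℝ) :
    (torsionEnd g (jetTorsion g I dg dI) X * (J * A)).trace
      = -(torsionEnd g (jetTorsion g I dg dI) (J *ᵥ X) * A).trace := by
  rw [trace_torsionEnd_mul h.hermI.g_unit h.hermJ.sq h.hermJ.skew h.torsion_typeJ hA
    (J *ᵥ X), h.hermJ.mulVec_mulVec_neg, map_neg, Matrix.neg_mul, Matrix.trace_neg, neg_neg]

/-- The partial derivatives of the Ricci potential, in terms of the torsion. -/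
theorem potential_deriv (h : GKJet g I J K dg dI dJ dK) (i : Fin N) :
    (I * K * dI i).trace - (J * K * dJ i).trace
      = -2 * (torsionEnd g (jetTorsion g I dg dI) (Pi.single i 1) * K).trace := by
  have key : ∀ A G : Matrix (Fin N) (Fin N) ℝ, A * A = -1 → A * K = -(K * A) →
      (A * K * (A * G - G * A)).trace = 2 * (G * K).trace := fun A G hA hK => by
    have e1 : A * K * A = K := by
      rw [hK, Matrix.neg_mul, Matrix.mul_assoc, hA]; simp
    rw [Matrix.mul_sub, Matrix.trace_sub, ← Matrix.mul_assoc, e1, ← Matrix.mul_assoc,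
      Matrix.trace_mul_comm _ A, ← Matrix.mul_assoc, ← Matrix.mul_assoc, hA, Matrix.trace_mul_comm]
    rw [Matrix.neg_mul, Matrix.neg_mul, Matrix.one_mul, Matrix.trace_neg, Matrix.trace_mul_comm K]
    ring
  have e1 := key I (jetConn g dg (jetTorsion g I dg dI) i) h.hermI.sq h.anti_left
  rw [← h.hermI.conn] at e1
  have e2 := key J (jetConn g dg (jetTorsion g I dg dI) i
    + torsionEnd g (jetTorsion g I dg dI) (Pi.single i 1)) h.hermJ.sq h.anti_right
  rw [← h.connJ i] at e2
  rw [e1, e2, Matrix.add_mul, Matrix.trace_add]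
  ring

/-- `h(JX, J) + h(IX, I) = -2 h([I, J] X, K)` with `h(X, A) = tr (H_X A)`: this is what makes the
difference of the Lee forms Hamiltonian. -/
theorem trace_lee (h : GKJet g I J K dg dI dJ dK) (X : Fin N → ℝ) :
    (torsionEnd g (jetTorsion g I dg dI) (J *ᵥ X) * J).trace
      + (torsionEnd g (jetTorsion g I dg dI) (I *ᵥ X) * I).trace
      = -2 * (torsionEnd g (jetTorsion g I dg dI) ((I * J - J * I) *ᵥ X) * K).trace := by
  -- `I J + J I` commutes with `I` and `J`, so that `(I J + J I) K` anticommutes with both; this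
  -- allows the rules `trace_left` and `trace_right` to be applied after expanding `J` and `I`.
  set p := I * J + J * I with hp
  have hIp : I * p = p * I := by
    simp only [hp, Matrix.mul_add, Matrix.add_mul, Matrix.mul_assoc, h.hermI.sq]
    rw [← Matrix.mul_assoc I I, h.hermI.sq]
    simp [add_comm]
  have hJp : J * p = p * J := by
    simp only [hp, Matrix.mul_add, Matrix.add_mul, Matrix.mul_assoc, h.hermJ.sq]
    rw [← Matrix.mul_assoc J J, h.hermJ.sq]
    simp [add_comm]
  have hJ : J = (2 : ℝ) • (I * K) + J * (p * K) := by
    have : J * (I * J - J * I) = (2 : ℝ) • I + J * p := by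
      have e : J * (I * J - J * I) = -(J * J * I + J * J * I) + J * p := by
        rw [hp]; noncomm_ring
      rw [e, h.hermJ.sq, two_smul]
      simp
    have e2 := congrArg (· * K) this
    simp only [Matrix.mul_assoc, h.mul_inv, Matrix.add_mul, Matrix.mul_one,
      Matrix.smul_mul] at e2
    exact e2
  have hI : I = -(2 : ℝ) • (J * K) - I * (p * K) := by
    have : I * (I * J - J * I) = -(2 : ℝ) • J - I * p := by
      have e : I * (I * J - J * I) = (I * I * J + I * I * J) - I * p := by
        rw [hp]; noncomm_ring
      rw [e, h.hermI.sq, neg_smul, two_smul]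
      simp
    have e2 := congrArg (· * K) this
    simp only [Matrix.mul_assoc, h.mul_inv, Matrix.sub_mul, Matrix.mul_one,
      Matrix.smul_mul] at e2
    exact e2
  have hpK1 : I * (p * K) = -(p * K * I) := by
    rw [← Matrix.mul_assoc, hIp, Matrix.mul_assoc, h.anti_left, Matrix.mul_neg, Matrix.mul_assoc]
  have hpK2 : J * (p * K) = -(p * K * J) := by
    rw [← Matrix.mul_assoc, hJp, Matrix.mul_assoc, h.anti_right, Matrix.mul_neg, Matrix.mul_assoc]
  have e1 : (torsionEnd g (jetTorsion g I dg dI) (J *ᵥ X) * J).trace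
      = (torsionEnd g (jetTorsion g I dg dI) (J *ᵥ X)
        * ((2 : ℝ) • (I * K) + J * (p * K))).trace := by
    rw [← hJ]
  have e2 : (torsionEnd g (jetTorsion g I dg dI) (I *ᵥ X) * I).trace
      = (torsionEnd g (jetTorsion g I dg dI) (I *ᵥ X)
        * (-(2 : ℝ) • (J * K) - I * (p * K))).trace := by
    rw [← hI]
  rw [e1, e2, Matrix.mul_add, Matrix.mul_sub, Matrix.mul_smul, Matrix.mul_smul, Matrix.trace_add,
    Matrix.trace_sub, Matrix.trace_smul, Matrix.trace_smul, h.trace_left h.anti_left,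
    h.trace_left hpK1, h.trace_right h.anti_right, h.trace_right hpK2,
    h.hermI.mulVec_mulVec_neg, h.hermJ.mulVec_mulVec_neg, Matrix.sub_mulVec,
    ← Matrix.mulVec_mulVec, ← Matrix.mulVec_mulVec, map_sub, Matrix.sub_mul, Matrix.trace_sub]
  simp only [smul_eq_mul]
  ring

end GKJet
end GKJet

/-! ### Lee forms and the canonical connection -/

section

variable {N : ℕ}

theorem formInner_kahler {g I : Matrix (Fin N) (Fin N) ℝ} (hg : gᵀ = g) (hu : IsUnit g.det)
    (β : Matrix (Fin N) (Fin N) ℝ) :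
    formInner g β (Iᵀ * g) = (1 / 2) * (βᵀ * (g⁻¹ * Iᵀ)).trace := by
  have hgi : (g⁻¹)ᵀ = g⁻¹ := by rw [Matrix.transpose_nonsing_inv, hg]
  have hcomp : g⁻¹ * Iᵀ = g⁻¹ * (Iᵀ * g) * (g⁻¹)ᵀ := by
    rw [hgi, Matrix.mul_assoc, Matrix.mul_nonsing_inv_cancel_right _ _ hu]
  rw [hcomp, formInner, Matrix.trace]
  congr 1
  simp only [Matrix.diag_apply, Matrix.mul_apply, Matrix.transpose_apply, Finset.mul_sum,
    Finset.sum_mul]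
  rw [Finset.sum_comm]
  refine Finset.sum_congr rfl fun j _ => Finset.sum_congr rfl fun i _ => ?_
  rw [Finset.sum_comm]
  refine Finset.sum_congr rfl fun a _ => Finset.sum_congr rfl fun b _ =>
    Finset.sum_congr rfl fun c _ => by ring

namespace HermJet

variable {g I : Matrix (Fin N) (Fin N) ℝ} {dg dI : Fin N → Matrix (Fin N) (Fin N) ℝ}

/-- The Lee form in terms of the torsion: `θ(X) = -½ tr (H_{IX} I)`. -/
theorem lee (h : HermJet g I dg dI) (k : Fin N) :
    formInner g (Matrix.of fun i j => jetExt (jetKahler g I dg dI) i j k) (Iᵀ * g)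
      = -(1 / 2) * (torsionEnd g (jetTorsion g I dg dI) (I *ᵥ Pi.single k 1) * I).trace := by
  rw [formInner_kahler h.g_symm h.g_unit]
  set B := torsionEnd g (jetTorsion g I dg dI) (I *ᵥ Pi.single k 1) with hB
  have hβ : (Matrix.of fun i j => jetExt (jetKahler g I dg dI) i j k)ᵀ = Iᵀ * (g * B) * I := by
    refine matrix_ext_dotProduct fun Y Z => ?_
    have e1 : Z ⬝ᵥ (Matrix.of fun i j => jetExt (jetKahler g I dg dI) i j k)ᵀ *ᵥ Y
        = tri (tens (jetExt (jetKahler g I dg dI))) Y Z (Pi.single k 1) := by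
      rw [tri_apply_eq_sum]
      simp only [tens, Matrix.of_apply, dotProduct, Matrix.mulVec, Matrix.transpose_apply,
        Finset.mul_sum]
      rw [Finset.sum_comm]
      refine Finset.sum_congr rfl fun i _ => Finset.sum_congr rfl fun j _ => ?_
      rw [Finset.sum_eq_single k]
      · simp; ring
      · intro b _ hb; simp [hb]
      · simp
    have e2 : tri (tens (jetExt (jetKahler g I dg dI))) Y Z (Pi.single k 1)
        = tri (tens (jetTorsion g I dg dI)) (I *ᵥ Y) (I *ᵥ Z) (I *ᵥ Pi.single k 1) := by
      rw [tri_torsion]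
      simp only [h.mulVec_mulVec_neg, map_neg, LinearMap.neg_apply, neg_neg]
    have hT : ∀ (A : Matrix (Fin N) (Fin N) ℝ), Z ⬝ᵥ (Iᵀ * A) *ᵥ Y = (I *ᵥ Z) ⬝ᵥ A *ᵥ Y := fun A => by
      rw [← Matrix.mulVec_mulVec, Matrix.dotProduct_mulVec Z, Matrix.vecMul_transpose]
    rw [e1, e2, Matrix.mul_assoc, hT, ← Matrix.mulVec_mulVec Y _ I,
      dotProduct_torsionEnd h.g_unit, h.tri_torsion_swap_right, h.tri_torsion_swap_left,
      neg_neg]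
  have e3 : I * (g⁻¹ * Iᵀ) = g⁻¹ := by
    rw [h.inv_skew, Matrix.mul_neg, ← Matrix.mul_assoc, h.sq]; simp
  rw [hβ, Matrix.mul_assoc, e3, Matrix.trace_mul_comm, ← Matrix.mul_assoc, ← Matrix.mul_assoc,
    h.inv_skew, Matrix.neg_mul, Matrix.neg_mul, Matrix.mul_assoc I,
    Matrix.nonsing_inv_mul _ h.g_unit, Matrix.mul_one, Matrix.trace_neg, Matrix.trace_mul_comm]
  ring

end HermJet

namespace GKJet
variable {g I J K : Matrix (Fin N) (Fin N) ℝ} {dg dI dJ dK : Fin N → Matrix (Fin N) (Fin N) ℝ}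

/-- The partial derivatives `tr (I K ∂_i I) - tr (J K ∂_i J)` of the Ricci potential. -/
def potentialDeriv (I J K : Matrix (Fin N) (Fin N) ℝ) (dI dJ : Fin N → Matrix (Fin N) (Fin N) ℝ)
    (i : Fin N) : ℝ := (I * K * dI i).trace - (J * K * dJ i).trace

/-- `dΦ(X) = -2 tr (H_X K)`. -/
theorem trace_torsionEnd_inv (h : GKJet g I J K dg dI dJ dK) (X : Fin N → ℝ) :
    (torsionEnd g (jetTorsion g I dg dI) X * K).trace
      = -(1 / 2) * (potentialDeriv I J K dI dJ ⬝ᵥ X) := by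
  have e : ∀ i, potentialDeriv I J K dI dJ i
      = -2 * (torsionEnd g (jetTorsion g I dg dI) (Pi.single i 1) * K).trace :=
    h.potential_deriv
  have h2 : torsionEnd g (jetTorsion g I dg dI) X
      = ∑ i, X i • torsionEnd g (jetTorsion g I dg dI) (Pi.single i 1) := by
    rw [torsionEnd_apply]
    exact Finset.sum_congr rfl fun i _ => by rw [torsionEnd_single]
  rw [h2, Finset.sum_mul, Matrix.trace_sum, dotProduct, Finset.mul_sum]
  refine Finset.sum_congr rfl fun i _ => ?_
  rw [e, Matrix.smul_mul, Matrix.trace_smul, smul_eq_mul]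
  ring

/-- `θ_J - θ_I = ½ dΦ ∘ [I, J]`. -/
theorem lee_sub (h : GKJet g I J K dg dI dJ dK) (k : Fin N) :
    formInner g (Matrix.of fun i j => jetExt (jetKahler g J dg dJ) i j k) (Jᵀ * g)
      - formInner g (Matrix.of fun i j => jetExt (jetKahler g I dg dI) i j k) (Iᵀ * g)
      = (1 / 2) * (((I * J - J * I)ᵀ *ᵥ potentialDeriv I J K dI dJ) k) := by
  rw [h.hermJ.lee, h.hermI.lee, h.torsion_eq_neg, torsionEnd_neg, Matrix.neg_mul, Matrix.trace_neg]
  have h1 := h.trace_lee (Pi.single k 1)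
  rw [h.trace_torsionEnd_inv, Matrix.dotProduct_mulVec, dotProduct_single,
    ← Matrix.mulVec_transpose] at h1
  linarith

theorem comm_skew (h : GKJet g I J K dg dI dJ dK) :
    (I * J - J * I)ᵀ * g = -(g * (I * J - J * I)) :=
  transpose_mul_commutator h.hermI.skew h.hermJ.skew

theorem inv_comm_skew (h : GKJet g I J K dg dI dJ dK) : Kᵀ * g = -(g * K) :=
  transpose_mul_of_right_inv h.comm_skew h.mul_inv

/-- The vector field `θ_J^♯ - θ_I^♯` is Hamiltonian for the symplectic form `g K`. -/
theorem symplectic_mulVec_leeDiff (h : GKJet g I J K dg dI dJ dK) (X : Fin N → ℝ)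
    (hX : ∀ i, X i = ∑ j, g⁻¹ i j
      * (formInner g (Matrix.of fun a b => jetExt (jetKahler g J dg dJ) a b j) (Jᵀ * g)
        - formInner g (Matrix.of fun a b => jetExt (jetKahler g I dg dI) a b j) (Iᵀ * g))) :
    (g * K) *ᵥ X = -(1 / 2 : ℝ) • potentialDeriv I J K dI dJ := by
  have e : X = (1 / 2 : ℝ) • ((g⁻¹ * (I * J - J * I)ᵀ) *ᵥ potentialDeriv I J K dI dJ) := by
    funext i
    rw [hX, ← Matrix.mulVec_mulVec, Pi.smul_apply, Matrix.mulVec, dotProduct, smul_eq_mul,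
      Finset.mul_sum]
    refine Finset.sum_congr rfl fun j _ => ?_
    rw [h.lee_sub]
    ring
  have e2 : g * K * (g⁻¹ * (I * J - J * I)ᵀ) = -1 := by
    rw [← neg_eq_iff_eq_neg.mpr h.inv_comm_skew, Matrix.neg_mul, Matrix.mul_assoc,
      Matrix.mul_nonsing_inv_cancel_left _ _ h.hermI.g_unit, ← Matrix.transpose_mul, h.mul_inv,
      Matrix.transpose_one]
  rw [e, Matrix.mulVec_smul, Matrix.mulVec_mulVec, e2, Matrix.neg_mulVec, Matrix.one_mulVec]
  simp

/-- The connection form which the Bismut connection induces on the canonical bundle of `I`,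
trivialized by the top power of the holomorphic symplectic form with real part `g K`, is `dΦ ∘ J` up
to a constant factor. -/
theorem canonical_conn (h : GKJet g I J K dg dI dJ dK) (i : Fin N) :
    (I * ((I * J - J * I) * dK i)).trace
      - 2 * (I * jetConn g dg (jetTorsion g I dg dI) i).trace
      = -2 * (Jᵀ *ᵥ potentialDeriv I J K dI dJ) i := by
  set G := jetConn g dg (jetTorsion g I dg dI) i with hG
  set H := torsionEnd g (jetTorsion g I dg dI) (Pi.single i 1) with hH
  set Q := I * J - J * I with hQ
  have hQK : Q * K = 1 := h.mul_inv
  have hKQ : K * Q = 1 := h.inv_mul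
  have h1 : dI i = I * G - G * I := h.hermI.conn i
  have h2 : dJ i = J * (G + H) - (G + H) * J := h.connJ i
  -- the derivative of `K = Q⁻¹`, with `∂_i I` and `∂_i J` expressed by the connection
  have h3 : Q * dK i = -((Q * G - G * Q + (I * (J * H - H * J) - (J * H - H * J) * I)) * K) := by
    rw [eq_neg_iff_add_eq_zero, add_comm, ← h.dmul_inv i, h1, h2, hQ]
    congr 2
    noncomm_ring
  clear_value Q G H
  have e1 : (I * (Q * G * K)).trace = -(I * G).trace := by
    have : K * (I * Q) = -I := by
      rw [← Matrix.mul_assoc, ← neg_eq_iff_eq_neg.mpr h.anti_left, Matrix.neg_mul, Matrix.mul_assoc,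
        hKQ, Matrix.mul_one]
    rw [← Matrix.mul_assoc, Matrix.trace_mul_comm, ← Matrix.mul_assoc I, ← Matrix.mul_assoc, this,
      Matrix.neg_mul, Matrix.trace_neg]
  have e2 : (I * (G * Q * K)).trace = (I * G).trace := by
    rw [Matrix.mul_assoc, hQK, Matrix.mul_one]
  have e3 : (I * (I * (J * H - H * J) * K)).trace = -(H * (K * J - J * K)).trace := by
    rw [Matrix.mul_assoc, ← Matrix.mul_assoc I I, h.hermI.sq, Matrix.neg_mul, Matrix.one_mul,
      Matrix.trace_neg, Matrix.sub_mul, Matrix.trace_sub, Matrix.mul_sub, Matrix.trace_sub,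
      Matrix.mul_assoc, Matrix.trace_mul_comm, Matrix.mul_assoc, Matrix.mul_assoc]
  have e4 : (I * ((J * H - H * J) * I * K)).trace = (H * (K * J - J * K)).trace := by
    have : I * K * I = K := by
      rw [h.anti_left, Matrix.neg_mul, Matrix.mul_assoc, h.hermI.sq]; simp
    rw [Matrix.mul_assoc, Matrix.trace_mul_comm, Matrix.mul_assoc, this, Matrix.sub_mul,
      Matrix.mul_sub, Matrix.trace_sub, Matrix.trace_sub, Matrix.mul_assoc, Matrix.trace_mul_comm,
      Matrix.mul_assoc, Matrix.mul_assoc]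
  have e5 : (H * (K * J - J * K)).trace = -2 * (H * (J * K)).trace := by
    rw [h.anti_right, sub_neg_eq_add, Matrix.mul_add, Matrix.trace_add, Matrix.mul_neg,
      Matrix.trace_neg]
    ring
  have e6 : (Jᵀ *ᵥ potentialDeriv I J K dI dJ) i
      = potentialDeriv I J K dI dJ ⬝ᵥ (J *ᵥ Pi.single i 1) := by
    rw [Matrix.dotProduct_mulVec, dotProduct_single, mul_one, Matrix.mulVec_transpose]
  have e7 := h.trace_torsionEnd_inv (J *ᵥ Pi.single i 1)
  rw [h3, Matrix.mul_neg, Matrix.trace_neg, Matrix.add_mul, Matrix.sub_mul, Matrix.sub_mul,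
    Matrix.mul_add, Matrix.mul_sub, Matrix.mul_sub, Matrix.trace_add, Matrix.trace_sub,
    Matrix.trace_sub, e1, e2, e3, e4, e5, hH, h.trace_right h.anti_right, e7, e6]
  ring

end GKJet
end

/-! ### Curvature and the holomorphic symplectic form -/

section
variable {N : ℕ}

theorem trace_commutator_cycle (I A B : Matrix (Fin N) (Fin N) ℝ) (hA : I * A = A * I) :
    (I * (A * B - B * A)).trace = 0 := by
  rw [Matrix.mul_sub, Matrix.trace_sub, ← Matrix.mul_assoc, hA, Matrix.trace_mul_comm (A * I),
    ← Matrix.mul_assoc, ← Matrix.mul_assoc, Matrix.trace_mul_comm (B * A), ← Matrix.mul_assoc,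
    sub_self]

/-- The curvature of the connection induced on the canonical bundle. Here `a_i` is
`tr (I Q ∂_i K) - 2 tr (I Γ_i)`, with `Γ` preserving the complex structure `I`, and `K = Q⁻¹`
anticommuting with `I`; its partial derivatives are written out with the product rule. -/
theorem trace_curvature {I Q K : Matrix (Fin N) (Fin N) ℝ}
    {dI dQ dK Γ : Fin N → Matrix (Fin N) (Fin N) ℝ}
    {ddK dΓ : Fin N → Fin N → Matrix (Fin N) (Fin N) ℝ}
    (hQK : Q * K = 1) (hIK : I * K = -(K * I))
    (hdQ : ∀ i, dQ i * K + Q * dK i = 0) (hdI : ∀ i, dI i = I * Γ i - Γ i * I)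
    (hanti : ∀ i, dI i * K + I * dK i = -(dK i * I + K * dI i))
    (hdd : ∀ i j, ddK i j = ddK j i) (i j : Fin N) :
    ((dI i * (Q * dK j) + I * (dQ i * dK j + Q * ddK i j)).trace
        - 2 * (dI i * Γ j + I * dΓ i j).trace)
      - ((dI j * (Q * dK i) + I * (dQ j * dK i + Q * ddK j i)).trace
        - 2 * (dI j * Γ i + I * dΓ j i).trace)
      = -2 * ((dΓ i j - dΓ j i + Γ i * Γ j - Γ j * Γ i) * I).trace := by
  have hKQ : K * Q = 1 := mul_eq_one_comm.mp hQK
  have hIQ : I * Q = -(Q * I) := GKJet.anti_comm_inv hKQ hQK hIK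
  -- the covariant derivative of `K` anticommutes with `I`
  set A : Fin N → Matrix (Fin N) (Fin N) ℝ := fun i => Q * dK i + Q * Γ i * K - Γ i
  have hA : ∀ i, A i = Q * dK i + Q * Γ i * K - Γ i := fun i => rfl
  clear_value A
  have hAcomm : ∀ i, I * A i = A i * I := by
    intro i
    have e := hanti i
    rw [hdI] at e
    have e1 : I * (dK i + Γ i * K - K * Γ i) + (dK i + Γ i * K - K * Γ i) * I = 0 := by
      have : I * (dK i + Γ i * K - K * Γ i) + (dK i + Γ i * K - K * Γ i) * I
          = ((I * Γ i - Γ i * I) * K + I * dK i + (dK i * I + K * (I * Γ i - Γ i * I)))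
            + Γ i * (I * K + K * I) - (I * K + K * I) * Γ i := by noncomm_ring
      rw [this, e, hIK]
      simp
    have e2 : A i = Q * (dK i + Γ i * K - K * Γ i) := by
      rw [hA, Matrix.mul_sub, Matrix.mul_add, ← Matrix.mul_assoc Q K, hQK, Matrix.one_mul,
        Matrix.mul_assoc]
    rw [e2, ← Matrix.mul_assoc, hIQ, Matrix.neg_mul, Matrix.mul_assoc,
      eq_neg_of_add_eq_zero_left e1, Matrix.mul_neg, neg_neg, Matrix.mul_assoc]
  have hM : ∀ i, Q * dK i = A i - Q * Γ i * K + Γ i := fun i => by rw [hA]; abel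
  have hdQ' : ∀ i j, dQ i * dK j = -(Q * dK i * (Q * dK j)) := fun i j => by
    have := congrArg (· * Q) (eq_neg_of_add_eq_zero_left (hdQ i))
    simp only [Matrix.mul_assoc, hKQ, Matrix.mul_one, Matrix.neg_mul] at this
    rw [this, Matrix.neg_mul]
    simp only [Matrix.mul_assoc]
  have hconj : (I * (Q * Γ i * K * (Q * Γ j * K) - Q * Γ j * K * (Q * Γ i * K))).trace
      = -(I * (Γ i * Γ j - Γ j * Γ i)).trace := by
    have e1 : ∀ B C : Matrix (Fin N) (Fin N) ℝ, Q * B * K * (Q * C * K) = Q * (B * C) * K :=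
      fun B C => by
        simp only [Matrix.mul_assoc]
        rw [← Matrix.mul_assoc K Q, hKQ, Matrix.one_mul]
    have e2 : ∀ B : Matrix (Fin N) (Fin N) ℝ, (I * (Q * B * K)).trace = -(I * B).trace := fun B => by
      have : K * I * Q = -I := by
        rw [Matrix.mul_assoc, hIQ, Matrix.mul_neg, ← Matrix.mul_assoc, hKQ, Matrix.one_mul]
      rw [← Matrix.mul_assoc, Matrix.trace_mul_comm]
      simp only [← Matrix.mul_assoc]
      rw [this, Matrix.neg_mul, Matrix.trace_neg]
    rw [e1, e1, ← Matrix.sub_mul, ← Matrix.mul_sub, e2]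
  have hA0 : ∀ i, ∀ B : Matrix (Fin N) (Fin N) ℝ, (I * (A i * B - B * A i)).trace = 0 :=
    fun i B => trace_commutator_cycle I (A i) B (hAcomm i)
  have hc : ∀ i j, (dI i * (Q * dK j)).trace
      = (I * (Γ i * (Q * dK j) - (Q * dK j) * Γ i)).trace := fun i j => by
    rw [hdI, Matrix.sub_mul, Matrix.mul_sub, Matrix.trace_sub, Matrix.trace_sub, Matrix.mul_assoc,
      Matrix.mul_assoc, Matrix.trace_mul_comm (Γ i), Matrix.mul_assoc I (Q * dK j)]
  have hc' : ∀ i j, (dI i * Γ j).trace = (I * (Γ i * Γ j - Γ j * Γ i)).trace := fun i j => by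
    rw [hdI, Matrix.sub_mul, Matrix.mul_sub, Matrix.trace_sub, Matrix.trace_sub, Matrix.mul_assoc,
      Matrix.mul_assoc, Matrix.trace_mul_comm (Γ i), Matrix.mul_assoc I (Γ j)]
  have a1 := hA0 i (A j)
  have a2 := hA0 i (Q * Γ j * K)
  have a3 := hA0 j (Q * Γ i * K)
  rw [Matrix.trace_mul_comm _ I, hdd j i, Matrix.mul_add I, Matrix.mul_add I, Matrix.trace_add,
    Matrix.trace_add, Matrix.trace_add, Matrix.trace_add, Matrix.trace_add, Matrix.trace_add,
    hc, hc, hc', hc', hdQ', hdQ', hM, hM]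
  simp only [Matrix.mul_add, Matrix.mul_sub, Matrix.add_mul, Matrix.sub_mul, Matrix.trace_add,
    Matrix.trace_sub, Matrix.mul_neg, Matrix.trace_neg] at *
  linarith

namespace GKJet
variable {g I J K : Matrix (Fin N) (Fin N) ℝ} {dg dI dJ dK : Fin N → Matrix (Fin N) (Fin N) ℝ}

/-- The Bismut connection is metric, as its torsion is skew. -/
theorem metric_conn (h : GKJet g I J K dg dI dJ dK) (i : Fin N) :
    dg i = (jetConn g dg (jetTorsion g I dg dI) i)ᵀ * g
      + g * jetConn g dg (jetTorsion g I dg dI) i := by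
  have e : g * jetConn g dg (jetTorsion g I dg dI) i
      = ((jetConn g dg (jetTorsion g I dg dI) i)ᵀ * g)ᵀ := by
    rw [Matrix.transpose_mul, Matrix.transpose_transpose, h.hermI.g_symm]
  rw [e, h.hermI.jetConn_transpose_mul]
  ext a b
  simp only [Matrix.add_apply, Matrix.transpose_apply, Matrix.of_apply]
  rw [h.hermI.torsion_swap_right i a b, h.hermI.dg_apply_comm i b a, h.hermI.dg_apply_comm a i b,
    h.hermI.dg_apply_comm b i a]
  ring

/-- The torsion 3-form of the Bismut connection is `-H`. -/
theorem tri_conn_sub (h : GKJet g I J K dg dI dJ dK) (X Y Z : Fin N → ℝ) :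
    tri (fun i => (jetConn g dg (jetTorsion g I dg dI) i)ᵀ * g) X Y Z
      - tri (fun i => (jetConn g dg (jetTorsion g I dg dI) i)ᵀ * g) Y X Z
      = -tri (tens (jetTorsion g I dg dI)) X Y Z := by
  have hswap : ∀ (T : Fin N → Matrix (Fin N) (Fin N) ℝ),
      tri T Y X Z = tri (tens fun i j k => T j i k) X Y Z := fun T =>
    (tri_tens_swap (fun i j k => T i j k) X Y Z).symm
  rw [hswap, ← tri_sub, ← tri_neg]
  refine tri_congr (fun a => ?_) _ _ _
  ext b c
  simp only [h.hermI.jetConn_transpose_mul, tens, Matrix.sub_apply, Matrix.of_apply,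
    Matrix.neg_apply]
  rw [h.hermI.dg_apply_comm c b a, h.hermI.torsion_swap_left b a c]
  ring

/-- The partial derivatives of the symplectic form `g K`. -/
def symplecticDeriv (g K : Matrix (Fin N) (Fin N) ℝ) (dg dK : Fin N → Matrix (Fin N) (Fin N) ℝ) :
    Fin N → Matrix (Fin N) (Fin N) ℝ := fun i => dg i * K + g * dK i

/-- The form `g K` is closed. -/
theorem tri_symplectic_closed (h : GKJet g I J K dg dI dJ dK) (X Y Z : Fin N → ℝ) :
    tri (symplecticDeriv g K dg dK) X Y Z + tri (symplecticDeriv g K dg dK) Y Z X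
      + tri (symplecticDeriv g K dg dK) Z X Y = 0 := by
  set t := jetTorsion g I dg dI with ht
  set G := jetConn g dg t with hG
  set H : Fin N → Matrix (Fin N) (Fin N) ℝ := fun i => torsionEnd g t (Pi.single i 1) with hH
  set C : Trilin (Fin N → ℝ) := tri (fun i => (G i)ᵀ * g) with hC
  have hgI : ∀ A : Matrix (Fin N) (Fin N) ℝ, g * (I * A) = -(Iᵀ * (g * A)) := fun A => by
    rw [← Matrix.mul_assoc, ← neg_eq_iff_eq_neg.mpr h.hermI.skew, Matrix.neg_mul, Matrix.mul_assoc]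
  have hgJ : ∀ A : Matrix (Fin N) (Fin N) ℝ, g * (J * A) = -(Jᵀ * (g * A)) := fun A => by
    rw [← Matrix.mul_assoc, ← neg_eq_iff_eq_neg.mpr h.hermJ.skew, Matrix.neg_mul, Matrix.mul_assoc]
  have hHt : ∀ i, (tens t i)ᵀ = g * H i := fun i => by
    rw [hH]
    simp only
    rw [torsionEnd_single, Matrix.mul_nonsing_inv_cancel_left _ _ h.hermI.g_unit]
  have hHtri : ∀ X Y Z, tri (fun i => g * H i) X Y Z = tri (tens t) X Z Y := fun X Y Z => by
    rw [← tri_transpose (tens t)]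
    exact tri_congr (fun i => (hHt i).symm) _ _ _
  -- conjugation by `[I, J]` clears the inverse `K` from the derivative of `g K`
  have hW : ∀ X Y Z, tri (symplecticDeriv g K dg dK) X ((I * J - J * I) *ᵥ Y) ((I * J - J * I) *ᵥ Z)
      = C X ((I * J - J * I) *ᵥ Y) Z - C X ((I * J - J * I) *ᵥ Z) Y
        + tri (tens t) X (J *ᵥ Z) (I *ᵥ Y) + tri (tens t) X Z (J *ᵥ I *ᵥ Y)
        + tri (tens t) X (J *ᵥ I *ᵥ Z) Y + tri (tens t) X (I *ᵥ Z) (J *ᵥ Y) := by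
    intro X Y Z
    have e : ∀ i, (I * J - J * I)ᵀ * (symplecticDeriv g K dg dK i * (I * J - J * I))
        = (I * J - J * I)ᵀ * ((G i)ᵀ * g) - ((G i)ᵀ * g)ᵀ * (I * J - J * I)
          + Iᵀ * (g * H i * J) + (J * I)ᵀ * (g * H i) + (g * H i) * (J * I)
          + Jᵀ * (g * H i * I) := by
      intro i
      have e1 : dK i * (I * J - J * I) = -(K * (dI i * J + I * dJ i - (dJ i * I + J * dI i))) := by
        have e0 := eq_neg_of_add_eq_zero_right (h.dmul_inv i)
        have e0' := congrArg (fun B => K * B * (I * J - J * I)) e0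
        beta_reduce at e0'
        rw [← Matrix.mul_assoc K, h.inv_mul, Matrix.one_mul, Matrix.mul_neg, Matrix.neg_mul,
          ← Matrix.mul_assoc K, Matrix.mul_assoc _ K, h.inv_mul, Matrix.mul_one] at e0'
        exact e0'
      have e2 : symplecticDeriv g K dg dK i * (I * J - J * I)
          = dg i - g * (K * (dI i * J + I * dJ i - (dJ i * I + J * dI i))) := by
        rw [symplecticDeriv, Matrix.add_mul, Matrix.mul_assoc, h.inv_mul, Matrix.mul_one,
          Matrix.mul_assoc, e1, Matrix.mul_neg]
        exact (sub_eq_add_neg _ _).symm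
      have e3 : (I * J - J * I)ᵀ * (g * (K * (dI i * J + I * dJ i - (dJ i * I + J * dI i))))
          = -(g * (dI i * J + I * dJ i - (dJ i * I + J * dI i))) := by
        rw [← Matrix.mul_assoc, h.comm_skew, Matrix.neg_mul, Matrix.mul_assoc,
          ← Matrix.mul_assoc _ K, h.mul_inv, Matrix.one_mul]
      have e4 : dI i * J + I * dJ i - (dJ i * I + J * dI i)
          = (I * J - J * I) * G i - G i * (I * J - J * I)
            + (I * (J * H i) - I * (H i * J) - J * (H i * I) + H i * (J * I)) := by
        rw [h.connJ i, h.hermI.conn i]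
        noncomm_ring
      have e5 : g * ((I * J - J * I) * G i) = -((I * J - J * I)ᵀ * (g * G i)) := by
        rw [← Matrix.mul_assoc, ← neg_eq_iff_eq_neg.mpr h.comm_skew, Matrix.neg_mul,
          Matrix.mul_assoc]
      rw [e2, Matrix.mul_sub, e3, e4, h.metric_conn i, Matrix.mul_add g, Matrix.mul_sub g, e5,
        Matrix.mul_add g, Matrix.mul_sub g, Matrix.mul_sub g, hgI, hgI, hgJ, hgJ]
      simp only [Matrix.transpose_mul, Matrix.transpose_transpose, h.hermI.g_symm, Matrix.mul_add,
        Matrix.mul_neg, Matrix.mul_assoc, ← ht, ← hG]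
      abel
    rw [tri_mulVec_right, tri_mulVec_mid, tri_congr e, tri_add, tri_add, tri_add, tri_add, tri_sub,
      ← tri_mulVec_mid (fun i => (G i)ᵀ * g), ← tri_mulVec_mid (fun i => g * H i * J),
      ← tri_mulVec_mid (fun i => g * H i), ← tri_mulVec_mid (fun i => g * H i * I),
      ← tri_mulVec_right (fun i => ((G i)ᵀ * g)ᵀ), ← tri_mulVec_right (fun i => g * H i),
      ← tri_mulVec_right (fun i => g * H i), ← tri_mulVec_right (fun i => g * H i),
      tri_transpose (fun i => (G i)ᵀ * g), hHtri, hHtri,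
      hHtri, hHtri, ← Matrix.mulVec_mulVec, ← Matrix.mulVec_mulVec]
  have hQ : ∀ X : Fin N → ℝ, (I * J - J * I) *ᵥ K *ᵥ X = X := fun X => by
    rw [Matrix.mulVec_mulVec, h.mul_inv, Matrix.one_mulVec]
  have hQ' : ∀ X : Fin N → ℝ, (I * J - J * I) *ᵥ X = I *ᵥ J *ᵥ X - J *ᵥ I *ᵥ X := fun X => by
    rw [Matrix.sub_mulVec, Matrix.mulVec_mulVec, Matrix.mulVec_mulVec]
  -- In the cyclic sum the connection terms combine to torsion, by `tri_conn_sub`.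
  have key := trilin_closed_of_type (tri (tens t)) (Matrix.mulVecLin I) (Matrix.mulVecLin J)
    h.hermI.tri_torsion_swap_left h.hermI.tri_torsion_swap_right h.hermI.tri_torsion_type
    h.torsion_typeJ _ (fun x y z => rfl) (K *ᵥ X) (K *ᵥ Y) (K *ᵥ Z)
  simp only [Matrix.mulVecLin_apply, ← hQ', hQ] at key
  have w1 := hW X (K *ᵥ Y) (K *ᵥ Z)
  have w2 := hW Y (K *ᵥ Z) (K *ᵥ X)
  have w3 := hW Z (K *ᵥ X) (K *ᵥ Y)
  rw [hQ, hQ] at w1 w2 w3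
  have c1 := h.tri_conn_sub X Y (K *ᵥ Z)
  have c2 := h.tri_conn_sub Y Z (K *ᵥ X)
  have c3 := h.tri_conn_sub Z X (K *ᵥ Y)
  rw [w1, w2, w3]
  linarith

end GKJet
end

/-! ### The Chern Laplacian and Hamiltonian vector fields -/

section
variable {N : ℕ}

theorem dotProduct_transpose_mul (A B : Matrix (Fin N) (Fin N) ℝ) (Y Z : Fin N → ℝ) :
    Y ⬝ᵥ (Aᵀ * B) *ᵥ Z = (A *ᵥ Y) ⬝ᵥ (B *ᵥ Z) := by
  rw [← Matrix.mulVec_mulVec, Matrix.dotProduct_mulVec Y, Matrix.vecMul_transpose]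

theorem dotProduct_mulVec_symm {B C : Matrix (Fin N) (Fin N) ℝ} (h : Bᵀ = C) (Y Z : Fin N → ℝ) :
    Y ⬝ᵥ B *ᵥ Z = Z ⬝ᵥ C *ᵥ Y := by
  rw [← h, Matrix.mulVec_transpose, dotProduct_comm Z, Matrix.dotProduct_mulVec]

/-- The partial derivatives `∂_i (Iᵀ α)_j` of the 1-form `α ∘ I`, where `A i m = ∂_i α_m`. -/
def compDeriv (I : Matrix (Fin N) (Fin N) ℝ) (dI : Fin N → Matrix (Fin N) (Fin N) ℝ)
    (α : Fin N → ℝ) (A : Matrix (Fin N) (Fin N) ℝ) : Matrix (Fin N) (Fin N) ℝ :=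
  A * I + Matrix.of fun i => (dI i)ᵀ *ᵥ α

theorem dotProduct_compDeriv (I : Matrix (Fin N) (Fin N) ℝ)
    (dI : Fin N → Matrix (Fin N) (Fin N) ℝ) (α : Fin N → ℝ) (A : Matrix (Fin N) (Fin N) ℝ)
    (Y Z : Fin N → ℝ) :
    Z ⬝ᵥ compDeriv I dI α A *ᵥ Y = Z ⬝ᵥ A *ᵥ (I *ᵥ Y) + ∑ i, Z i * (α ⬝ᵥ dI i *ᵥ Y) := by
  rw [compDeriv, Matrix.add_mulVec, dotProduct_add, Matrix.mulVec_mulVec]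
  congr 1
  rw [dotProduct]
  refine Finset.sum_congr rfl fun i _ => ?_
  change Z i * (((dI i)ᵀ *ᵥ α) ⬝ᵥ Y) = _
  rw [Matrix.mulVec_transpose, Matrix.dotProduct_mulVec]

namespace HermJet
variable {g I : Matrix (Fin N) (Fin N) ℝ} {dg dI : Fin N → Matrix (Fin N) (Fin N) ℝ}

/-- The Chern Laplacian is the trace of the Hessian plus first order terms. Here `α = df`, and `A`
is the matrix of second derivatives of `f`. -/
theorem chern_formula (h : HermJet g I dg dI) (α : Fin N → ℝ) (A : Matrix (Fin N) (Fin N) ℝ) :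
    formInner g (-(compDeriv I dI α A - (compDeriv I dI α A)ᵀ)) (Iᵀ * g)
      = (g⁻¹ * A).trace - ((Matrix.of fun i => (dI i)ᵀ *ᵥ α) * (I * g⁻¹)).trace := by
  rw [formInner_kahler h.g_symm h.g_unit]
  set F := compDeriv I dI α A with hF
  have e1 : (F * (I * g⁻¹)).trace = -(F * (g⁻¹ * Iᵀ)).trace := by
    rw [h.inv_skew, Matrix.mul_neg, Matrix.trace_neg, neg_neg]
  have e2 : (Fᵀ * (g⁻¹ * Iᵀ)).trace = (F * (I * g⁻¹)).trace := by
    rw [← Matrix.trace_transpose, Matrix.transpose_mul, Matrix.transpose_mul, h.inv_symm,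
      Matrix.transpose_transpose, Matrix.transpose_transpose, Matrix.trace_mul_comm]
  have e3 : (F * (I * g⁻¹)).trace = -(g⁻¹ * A).trace
      + ((Matrix.of fun i => (dI i)ᵀ *ᵥ α) * (I * g⁻¹)).trace := by
    rw [hF, compDeriv, Matrix.add_mul, Matrix.trace_add, Matrix.mul_assoc, ← Matrix.mul_assoc I,
      h.sq, Matrix.neg_mul, Matrix.one_mul, Matrix.mul_neg, Matrix.trace_neg,
      Matrix.trace_mul_comm A]
  rw [Matrix.transpose_neg, Matrix.transpose_sub, Matrix.transpose_transpose, Matrix.neg_mul,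
    Matrix.sub_mul, Matrix.trace_neg, Matrix.trace_sub, e2]
  linarith

/-- The first order part of the Chern Laplacian, in terms of the metric and the Lee form. -/
theorem chern_first_order (h : HermJet g I dg dI) (u : Fin N → ℝ) :
    ((Matrix.of fun i => (dI i)ᵀ *ᵥ g *ᵥ u) * (I * g⁻¹)).trace
      = (1 / 2) * ((Matrix.of fun i j => ∑ l, (dg i j l + dg j i l - dg l i j) * u l) * g⁻¹).trace
        - (1 / 2) * (torsionEnd g (jetTorsion g I dg dI) (I *ᵥ u) * I).trace := by
  set t := jetTorsion g I dg dI with ht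
  set Γ := jetConn g dg t with hΓ
  set c : (Fin N → ℝ) → Matrix (Fin N) (Fin N) ℝ := fun v => Matrix.of fun i => ((Γ i)ᵀ * g) *ᵥ v
    with hc
  have hp : (Matrix.of fun i => (dI i)ᵀ *ᵥ g *ᵥ u) = -(c (I *ᵥ u) + c u * I) := by
    ext i j
    have e : (dI i)ᵀ * g = -((Γ i)ᵀ * g * I + Iᵀ * ((Γ i)ᵀ * g)) := by
      rw [h.conn i, Matrix.transpose_sub, Matrix.transpose_mul, Matrix.transpose_mul,
        Matrix.sub_mul, Matrix.mul_assoc, h.skew]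
      simp only [Matrix.mul_neg, Matrix.mul_assoc, ← ht, ← hΓ]
      abel
    have e2 : (c u * I) i j = (Iᵀ *ᵥ ((Γ i)ᵀ * g) *ᵥ u) j := by
      simp only [hc, Matrix.mul_apply, Matrix.of_apply, Matrix.mulVec, dotProduct,
        Matrix.transpose_apply]
      exact Finset.sum_congr rfl fun _ _ => mul_comm _ _
    rw [Matrix.neg_apply, Matrix.add_apply, e2, Matrix.of_apply, Matrix.mulVec_mulVec, e,
      Matrix.neg_mulVec, Matrix.add_mulVec, ← Matrix.mulVec_mulVec, ← Matrix.mulVec_mulVec,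
      ← Matrix.mulVec_mulVec]
    simp [hc, Matrix.mulVec_mulVec, Matrix.mul_assoc]
  have hce : ∀ v i j, c v i j = ∑ l, ((1 / 2) * (dg i j l + dg j i l - dg l i j)
      - (1 / 2) * t i j l) * v l := fun v i j => by
    simp only [hc, hΓ, Matrix.of_apply, h.jetConn_transpose_mul, Matrix.mulVec, dotProduct]
  -- the symmetric part of `c` comes from the Levi-Civita connection, the skew part from the torsion
  have hsym : ∀ v, c v + (c v)ᵀ = Matrix.of fun i j => ∑ l, (dg i j l + dg j i l - dg l i j) * v l := by
    intro v
    ext i j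
    rw [Matrix.add_apply, Matrix.transpose_apply, hce, hce, Matrix.of_apply,
      ← Finset.sum_add_distrib]
    refine Finset.sum_congr rfl fun l _ => ?_
    rw [ht, h.torsion_swap_left j i l, h.dg_apply_comm l j i]
    ring
  have hanti : ∀ v, c v - (c v)ᵀ = -(g * torsionEnd g t v)ᵀ := by
    intro v
    ext i j
    have e : g * torsionEnd g t v = ∑ a, v a • (tens t a)ᵀ := by
      rw [torsionEnd_apply, Finset.mul_sum]
      refine Finset.sum_congr rfl fun a _ => ?_
      rw [Matrix.mul_smul, Matrix.mul_nonsing_inv_cancel_left _ _ h.g_unit]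
    rw [e, Matrix.sub_apply, Matrix.transpose_apply, hce, hce, ← Finset.sum_sub_distrib,
      Matrix.neg_apply, Matrix.transpose_apply, Matrix.sum_apply, ← Finset.sum_neg_distrib]
    refine Finset.sum_congr rfl fun l _ => ?_
    simp only [Matrix.smul_apply, Matrix.transpose_apply, tens, Matrix.of_apply, smul_eq_mul]
    rw [ht, h.torsion_swap_left l i j, h.torsion_swap_right i l j, h.torsion_swap_left j i l,
      h.dg_apply_comm l j i]
    ring
  have t1 : ((c u)ᵀ * g⁻¹).trace = (c u * g⁻¹).trace := by
    rw [← Matrix.trace_transpose, Matrix.transpose_mul, h.inv_symm, Matrix.transpose_transpose,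
      Matrix.trace_mul_comm]
  have t2 : ((c (I *ᵥ u))ᵀ * (I * g⁻¹)).trace = -(c (I *ᵥ u) * (I * g⁻¹)).trace := by
    rw [← Matrix.trace_transpose, Matrix.transpose_mul, Matrix.transpose_mul, h.inv_symm,
      Matrix.transpose_transpose, h.inv_skew, Matrix.trace_mul_comm, Matrix.mul_neg,
      Matrix.trace_neg]
  have t3 : ((g * torsionEnd g t (I *ᵥ u))ᵀ * (I * g⁻¹)).trace
      = -(torsionEnd g t (I *ᵥ u) * I).trace := by
    rw [← Matrix.trace_transpose, Matrix.transpose_mul, Matrix.transpose_transpose,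
      Matrix.transpose_mul, h.inv_symm, h.inv_skew, Matrix.neg_mul, Matrix.trace_neg,
      Matrix.mul_assoc, Matrix.nonsing_inv_mul_cancel_left _ _ h.g_unit, Matrix.trace_mul_comm]
  have t4 := congrArg (fun B => (B * (I * g⁻¹)).trace) (hanti (I *ᵥ u))
  simp only [Matrix.sub_mul, Matrix.neg_mul, Matrix.trace_sub, Matrix.trace_neg] at t4
  have t5 : (c u * I * (I * g⁻¹)).trace = -(c u * g⁻¹).trace := by
    rw [Matrix.mul_assoc, ← Matrix.mul_assoc I, h.sq, Matrix.neg_mul, Matrix.one_mul,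
      Matrix.mul_neg, Matrix.trace_neg]
  rw [hp, ← hsym, Matrix.neg_mul, Matrix.trace_neg, Matrix.add_mul, Matrix.add_mul,
    Matrix.trace_add, Matrix.trace_add, t1, t5]
  rw [t2, t3] at t4
  linarith

end HermJet

namespace GKJet
variable {g I J K : Matrix (Fin N) (Fin N) ℝ} {dg dI dJ dK : Fin N → Matrix (Fin N) (Fin N) ℝ}

theorem symplectic_compat (h : GKJet g I J K dg dI dJ dK) : Jᵀ * (g * K) = g * K * J := by
  rw [← Matrix.mul_assoc, h.hermJ.skew, Matrix.neg_mul, Matrix.mul_assoc, h.anti_right,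
    Matrix.mul_neg, neg_neg, Matrix.mul_assoc]

theorem symplectic_skew (h : GKJet g I J K dg dI dJ dK) : (g * K)ᵀ = -(g * K) := by
  rw [Matrix.transpose_mul, h.hermI.g_symm, h.inv_comm_skew]

theorem tri_symplectic_skew (h : GKJet g I J K dg dI dJ dK) (X Y Z : Fin N → ℝ) :
    tri (symplecticDeriv g K dg dK) X Y Z = -tri (symplecticDeriv g K dg dK) X Z Y := by
  have e := tri_transpose (symplecticDeriv g K dg dK) X Z Y
  rw [← e, ← tri_neg]
  exact tri_congr h.dskew _ _ _

/-- The derivative of `Ω(J·, ·) = Ω(·, J·)` for `Ω = g K`. -/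
theorem tri_symplectic_compat (h : GKJet g I J K dg dI dJ dK) (X Y Z : Fin N → ℝ) :
    tri (symplecticDeriv g K dg dK) X (J *ᵥ Y) Z + tri (fun i => (dJ i)ᵀ * (g * K)) X Y Z
      = tri (symplecticDeriv g K dg dK) X Y (J *ᵥ Z) - tri (fun i => (dJ i)ᵀ * (g * K)) X Z Y := by
  rw [← tri_transpose (fun i => (dJ i)ᵀ * (g * K)) X Y Z, tri_mulVec_mid, tri_mulVec_right,
    ← tri_sub, ← tri_add]
  refine tri_congr (fun i => ?_) _ _ _
  rw [add_comm]
  refine (h.dcompat i).trans ?_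
  rw [Matrix.transpose_mul, Matrix.transpose_transpose, h.symplectic_skew, Matrix.neg_mul,
    sub_neg_eq_add]
  rfl

/-- The form `g K J` is closed. -/
theorem tri_symplectic_comp_closed (h : GKJet g I J K dg dI dJ dK) (X Y Z : Fin N → ℝ) :
    tri (symplecticDeriv g K dg dK) X (J *ᵥ Y) Z + tri (fun i => (dJ i)ᵀ * (g * K)) X Y Z
      + (tri (symplecticDeriv g K dg dK) Y (J *ᵥ Z) X + tri (fun i => (dJ i)ᵀ * (g * K)) Y Z X)
      + (tri (symplecticDeriv g K dg dK) Z (J *ᵥ X) Y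
        + tri (fun i => (dJ i)ᵀ * (g * K)) Z X Y) = 0 := by
  have hP : ∀ X Y Z, tri (fun i => (dJ i)ᵀ * (g * K)) X Y Z
      = tri (fun i => (dJ i)ᵀ * g) X Y (K *ᵥ Z) := fun X Y Z => by
    rw [tri_mulVec_right]
    exact tri_congr (fun i => (Matrix.mul_assoc _ _ _).symm) _ _ _
  have hJK : ∀ Z : Fin N → ℝ, K *ᵥ J *ᵥ Z = -(J *ᵥ K *ᵥ Z) := fun Z => by
    rw [Matrix.mulVec_mulVec, Matrix.mulVec_mulVec, ← Matrix.neg_mulVec, h.anti_right, neg_neg]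
  refine trilin_closed_comp (tri (symplecticDeriv g K dg dK)) (tri fun i => (dJ i)ᵀ * (g * K))
    (Matrix.mulVecLin J) h.hermJ.mulVec_mulVec_neg h.tri_symplectic_skew h.tri_symplectic_compat
    (fun x y z => ?_) (fun x y z => ?_) h.tri_symplectic_closed X Y Z
  · simp only [Matrix.mulVecLin_apply]
    rw [hP, hP, hJK, map_neg, neg_neg, h.hermJ.tri_sq]
  · simp only [Matrix.mulVecLin_apply]
    rw [hP, hP, hP, hP, hJK, map_neg, map_neg]
    have := h.hermJ.tri_nij x y (K *ᵥ z)
    linarith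

/-- Let `X` satisfy `g K X = -½ α`, where `α` is a closed 1-form with partial derivatives `A`. As
`g K` and `g K J` are closed, Cartan's formula gives `g K (L_X J) = ½ d(α ∘ J)`. -/
theorem symplectic_mul_lie (h : GKJet g I J K dg dI dJ dK) {X α : Fin N → ℝ}
    {DX A : Matrix (Fin N) (Fin N) ℝ} (hA : Aᵀ = A)
    (hX : (g * K) *ᵥ X = -(1 / 2 : ℝ) • α)
    (hDX : ∀ i, symplecticDeriv g K dg dK i *ᵥ X + (g * K) *ᵥ (fun m => DX m i)
      = -(1 / 2 : ℝ) • A i) :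
    g * K * (∑ k, X k • dJ k - DX * J + J * DX)
      = (1 / 2 : ℝ) • (compDeriv J dJ α A - (compDeriv J dJ α A)ᵀ) := by
  refine matrix_ext_dotProduct fun Y Z => ?_
  set W := tri (symplecticDeriv g K dg dK) with hW
  set R := tri (fun i => (dJ i)ᵀ * (g * K)) with hR
  have hRe : ∀ X Y Z : Fin N → ℝ, Z ⬝ᵥ (g * K) *ᵥ ((∑ k, X k • dJ k) *ᵥ Y) = -R X Y Z := by
    intro X Y Z
    rw [hR, tri_apply, Matrix.sum_mulVec, Matrix.mulVec_sum, dotProduct_sum,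
      ← Finset.sum_neg_distrib]
    refine Finset.sum_congr rfl fun k _ => ?_
    rw [Matrix.smul_mulVec, Matrix.mulVec_smul, dotProduct_smul, smul_eq_mul, ← mul_neg,
      dotProduct_transpose_mul, dotProduct_mulVec_symm h.symplectic_skew, Matrix.neg_mulVec,
      dotProduct_neg]
  have hD : ∀ V Z : Fin N → ℝ, Z ⬝ᵥ (g * K) *ᵥ (DX *ᵥ V)
      = -(1 / 2) * (Z ⬝ᵥ A *ᵥ V) - W V Z X := by
    intro V Z
    have e : DX *ᵥ V = ∑ i, V i • (fun m => DX m i) := by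
      funext m
      simp [Matrix.mulVec, dotProduct, mul_comm]
    have e2 : A *ᵥ V = ∑ i, V i • A i := by
      funext m
      have hAs : ∀ i, A i m = A m i := fun i => congrFun (congrFun hA m) i
      simp [Matrix.mulVec, dotProduct, mul_comm, hAs]
    rw [e, e2, Matrix.mulVec_sum, dotProduct_sum, hW, tri_apply, dotProduct_sum, Finset.mul_sum,
      ← Finset.sum_sub_distrib]
    refine Finset.sum_congr rfl fun i _ => ?_
    rw [Matrix.mulVec_smul, eq_sub_of_add_eq' (hDX i), dotProduct_smul, dotProduct_sub,
      dotProduct_smul, dotProduct_smul]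
    simp only [smul_eq_mul]
    ring
  have hα : ∀ Y Z : Fin N → ℝ, ∑ i, Z i * (α ⬝ᵥ dJ i *ᵥ Y) = -2 * R Z Y X := by
    intro Y Z
    have e : α = -(2 : ℝ) • ((g * K) *ᵥ X) := by rw [hX, smul_smul]; norm_num
    rw [hR, tri_apply, Finset.mul_sum]
    refine Finset.sum_congr rfl fun i _ => ?_
    rw [e, smul_dotProduct, dotProduct_transpose_mul, dotProduct_comm, smul_eq_mul]
    ring
  have hsymm : ∀ Y Z : Fin N → ℝ, Y ⬝ᵥ A *ᵥ Z = Z ⬝ᵥ A *ᵥ Y := fun Y Z =>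
    dotProduct_mulVec_symm hA Y Z
  have hT : Z ⬝ᵥ (compDeriv J dJ α A)ᵀ *ᵥ Y = Y ⬝ᵥ compDeriv J dJ α A *ᵥ Z :=
    dotProduct_mulVec_symm (Matrix.transpose_transpose _) _ _
  have hJ : Z ⬝ᵥ (g * K * (J * DX)) *ᵥ Y = (J *ᵥ Z) ⬝ᵥ (g * K) *ᵥ (DX *ᵥ Y) := by
    rw [← Matrix.mul_assoc, ← h.symplectic_compat, Matrix.mul_assoc, dotProduct_transpose_mul,
      Matrix.mulVec_mulVec]
  rw [Matrix.mul_add, Matrix.mul_sub, Matrix.add_mulVec, Matrix.sub_mulVec, dotProduct_add,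
    dotProduct_sub, hJ, ← Matrix.mulVec_mulVec Y, ← Matrix.mulVec_mulVec Y,
    ← Matrix.mulVec_mulVec Y, hRe, hD, hD,
    Matrix.smul_mulVec, dotProduct_smul, Matrix.sub_mulVec, dotProduct_sub, hT,
    dotProduct_compDeriv, dotProduct_compDeriv, hα, hα, smul_eq_mul]
  have c1 := h.tri_symplectic_comp_closed X Y Z
  have c2 := h.tri_symplectic_compat Z X Y
  have c3 := h.tri_symplectic_closed (J *ᵥ Y) Z X
  have c4 := hsymm (J *ᵥ Z) Y
  have c5 := hsymm (J *ᵥ Y) Z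
  linarith

/-- The Chern Laplacians of `(g, I)` and `(g, J)` agree on the Ricci potential: they differ by the
derivative in the direction of `θ_J^♯ - θ_I^♯`, a Hamiltonian vector field of the potential. -/
theorem chern_eq (h : GKJet g I J K dg dI dJ dK) (A : Matrix (Fin N) (Fin N) ℝ)
    {α : Fin N → ℝ} (hα : α = potentialDeriv I J K dI dJ) :
    formInner g (-(compDeriv J dJ α A - (compDeriv J dJ α A)ᵀ)) (Jᵀ * g)
      = formInner g (-(compDeriv I dI α A - (compDeriv I dI α A)ᵀ)) (Iᵀ * g) := by
  have hu : α = g *ᵥ (g⁻¹ *ᵥ α) := by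
    rw [Matrix.mulVec_mulVec, Matrix.mul_nonsing_inv _ h.hermI.g_unit, Matrix.one_mulVec]
  set u := g⁻¹ *ᵥ α with hu'
  rw [h.hermI.chern_formula α A, h.hermJ.chern_formula α A]
  have e1 := h.hermI.chern_first_order u
  have e2 := h.hermJ.chern_first_order u
  rw [h.torsion_eq_neg, torsionEnd_neg, Matrix.neg_mul, Matrix.trace_neg] at e2
  rw [← hu] at e1 e2
  have e3 := h.trace_lee u
  rw [h.trace_torsionEnd_inv, ← hα] at e3
  -- `[I, J] g⁻¹` is skew
  have e4 : α ⬝ᵥ (I * J - J * I) *ᵥ u = 0 := by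
    have e5 : α ⬝ᵥ (I * J - J * I) *ᵥ u = -(α ⬝ᵥ (I * J - J * I) *ᵥ u) := by
      conv_lhs => rw [hu]
      rw [Matrix.dotProduct_mulVec, ← Matrix.mulVec_transpose, Matrix.mulVec_mulVec, h.comm_skew,
        Matrix.neg_mulVec, neg_dotProduct, ← Matrix.mulVec_mulVec, dotProduct_comm,
        Matrix.dotProduct_mulVec, ← Matrix.mulVec_transpose, h.hermI.g_symm, ← hu]
    linarith
  rw [e4] at e3
  linarith

/-- The variation `-tr (J K L)` of the Ricci potential under `∂_t J = L`, when
`g K L = ½ d(α ∘ J)`. -/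
theorem potential_variation (h : GKJet g I J K dg dI dJ dK) {L E : Matrix (Fin N) (Fin N) ℝ}
    (hE : Eᵀ = -E) (hL : g * K * L = (1 / 2 : ℝ) • E) :
    -(J * K * L).trace = formInner g (-E) (Jᵀ * g) := by
  rw [formInner_kahler h.hermI.g_symm h.hermI.g_unit, Matrix.transpose_neg, hE, neg_neg,
    h.hermJ.inv_skew]
  have e : J * K * L = J * g⁻¹ * ((1 / 2 : ℝ) • E) := by
    rw [← hL, Matrix.mul_assoc, Matrix.mul_assoc, Matrix.mul_assoc,
      Matrix.nonsing_inv_mul_cancel_left _ _ h.hermI.g_unit]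
  rw [e, Matrix.mul_smul, Matrix.trace_smul, Matrix.mul_neg, Matrix.trace_neg,
    Matrix.trace_mul_comm E, smul_eq_mul]
  ring

/-- The form `g K` is preserved to first order by `∂_t J = L` and `∂_t g = V`, when
`Iᵀ V = -2 D^{1,1}` and `D = g K L`. -/
theorem symplectic_variation (h : GKJet g I J K dg dI dJ dK) {L V D : Matrix (Fin N) (Fin N) ℝ}
    (hD : g * K * L = D) (hV : Iᵀ * V = -(2 : ℝ) • oneOnePart I D) :
    V = g * K * (I * L - L * I) := by
  have hI2 : Iᵀ * Iᵀ = -1 := by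
    rw [← Matrix.transpose_mul, h.hermI.sq, Matrix.transpose_neg, Matrix.transpose_one]
  have e := congrArg (Iᵀ * ·) hV
  simp only [← Matrix.mul_assoc, hI2, oneOnePart, smul_smul, Matrix.mul_smul, Matrix.mul_add,
    Matrix.neg_mul, Matrix.one_mul] at e
  have e2 : g * K * I = Iᵀ * (g * K) := by
    rw [← Matrix.mul_assoc, h.hermI.skew, Matrix.neg_mul, Matrix.mul_assoc g I, h.anti_left,
      Matrix.mul_neg, neg_neg, Matrix.mul_assoc]
  rw [Matrix.mul_sub, ← Matrix.mul_assoc, e2, Matrix.mul_assoc, hD, ← Matrix.mul_assoc, hD]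
  rw [← neg_neg V, e]
  norm_num
  abel

end GKJet
end

/-! ### Calculus of matrix fields -/

section Smooth

variable {N : ℕ} {F : Type*} [NormedAddCommGroup F] [NormedSpace ℝ F]

/-- Smoothness of a matrix-valued function, entry by entry. -/
def SmoothMatOn (A : F → Matrix (Fin N) (Fin N) ℝ) (s : Set F) : Prop :=
  ∀ i j, ContDiffOn ℝ ∞ (fun y => A y i j) s

namespace SmoothMatOn

variable {A B : F → Matrix (Fin N) (Fin N) ℝ} {s : Set F}

theorem mono {s' : Set F} (hA : SmoothMatOn A s) (h : s' ⊆ s) : SmoothMatOn A s' :=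
  fun i j => (hA i j).mono h

theorem congr (hA : SmoothMatOn A s) (h : ∀ y ∈ s, B y = A y) : SmoothMatOn B s :=
  fun i j => (hA i j).congr fun y hy => by rw [h y hy]

theorem mul (hA : SmoothMatOn A s) (hB : SmoothMatOn B s) :
    SmoothMatOn (fun y => A y * B y) s := fun i j => by
  simp only [Matrix.mul_apply]
  exact ContDiffOn.sum fun k _ => (hA i k).mul (hB k j)

theorem add (hA : SmoothMatOn A s) (hB : SmoothMatOn B s) :
    SmoothMatOn (fun y => A y + B y) s := fun i j => (hA i j).add (hB i j)

theorem sub (hA : SmoothMatOn A s) (hB : SmoothMatOn B s) :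
    SmoothMatOn (fun y => A y - B y) s := fun i j => (hA i j).sub (hB i j)

theorem neg (hA : SmoothMatOn A s) : SmoothMatOn (fun y => -A y) s := fun i j => (hA i j).neg

theorem transpose (hA : SmoothMatOn A s) : SmoothMatOn (fun y => (A y)ᵀ) s := fun i j => hA j i

theorem det (hA : SmoothMatOn A s) : ContDiffOn ℝ ∞ (fun y => (A y).det) s := by
  simp only [Matrix.det_apply']
  exact ContDiffOn.sum fun σ _ => contDiffOn_const.mul (contDiffOn_prod fun i _ => hA _ _)

theorem trace (hA : SmoothMatOn A s) : ContDiffOn ℝ ∞ (fun y => (A y).trace) s := by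
  simp only [Matrix.trace, Matrix.diag_apply]
  exact ContDiffOn.sum fun i _ => hA _ _

theorem inv (hA : SmoothMatOn A s) (h : ∀ y ∈ s, (A y).det ≠ 0) :
    SmoothMatOn (fun y => (A y)⁻¹) s := by
  intro i j
  have e : ∀ y, (A y)⁻¹ i j = ((A y).det)⁻¹ * ((A y).updateRow j (Pi.single i 1)).det := by
    intro y
    rw [Matrix.inv_def, Ring.inverse_eq_inv', Matrix.smul_apply, Matrix.adjugate_apply, smul_eq_mul]
  simp only [e]
  refine (hA.det.inv h).mul (det fun a b => ?_)
  by_cases ha : a = j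
  · subst ha
    simp only [Matrix.updateRow_self]
    exact contDiffOn_const
  · simp only [Matrix.updateRow_ne ha]
    exact hA a b

theorem mulVec (hA : SmoothMatOn A s) {v : F → Fin N → ℝ}
    (hv : ∀ i, ContDiffOn ℝ ∞ (fun y => v y i) s) (i : Fin N) :
    ContDiffOn ℝ ∞ (fun y => (A y *ᵥ v y) i) s := by
  simp only [Matrix.mulVec, dotProduct]
  exact ContDiffOn.sum fun j _ => (hA i j).mul (hv j)

end SmoothMatOn

end Smooth

section Det

variable {N : ℕ}

theorem contDiff_det_of :
    ContDiff ℝ ∞ (fun A : Fin N → Fin N → ℝ => (Matrix.of A).det) := by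
  simp only [Matrix.det_apply']
  refine ContDiff.sum fun σ _ => contDiff_const.mul (contDiff_prod fun i _ => ?_)
  exact contDiff_apply_apply ℝ ℝ _ _

/-- Jacobi's formula for the derivative of the determinant. -/
theorem hasDerivAt_det_add_smul (A B : Matrix (Fin N) (Fin N) ℝ) (hA : A.det ≠ 0) :
    HasDerivAt (fun t : ℝ => (A + t • B).det) (A.det * (A⁻¹ * B).trace) 0 := by
  have hu : IsUnit A.det := isUnit_iff_ne_zero.mpr hA
  have e : ∀ t : ℝ, (A + t • B).det = A.det * (1 + (A⁻¹ * B).trace * t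
      + (Matrix.det (1 + (Polynomial.X : Polynomial ℝ) • (A⁻¹ * B).map Polynomial.C)).divX.divX.eval t
        * t ^ 2) := by
    intro t
    rw [← Matrix.det_one_add_smul, ← Matrix.det_mul, Matrix.mul_add, Matrix.mul_one,
      Matrix.mul_smul, Matrix.mul_nonsing_inv_cancel_left _ _ hu]
  simp only [e]
  set p := (Matrix.det (1 + (Polynomial.X : Polynomial ℝ) • (A⁻¹ * B).map Polynomial.C)).divX.divX
  have h1 : HasDerivAt (fun t : ℝ => p.eval t * t ^ 2) 0 0 := by
    have := (p.hasDerivAt 0).fun_mul (hasDerivAt_pow 2 (0 : ℝ))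
    simpa using this
  have h2 : HasDerivAt (fun t : ℝ => (1 + (A⁻¹ * B).trace * t)) (A⁻¹ * B).trace 0 := by
    simpa using ((hasDerivAt_id (0 : ℝ)).const_mul (A⁻¹ * B).trace).const_add 1
  simpa using (h2.add h1).const_mul A.det

theorem fderiv_det_of (A B : Matrix (Fin N) (Fin N) ℝ) (hA : A.det ≠ 0) :
    fderiv ℝ (fun A : Fin N → Fin N → ℝ => (Matrix.of A).det) (fun i j => A i j) (fun i j => B i j)
      = A.det * (A⁻¹ * B).trace := by
  have hd : DifferentiableAt ℝ (fun A : Fin N → Fin N → ℝ => (Matrix.of A).det)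
      (fun i j => A i j) := contDiff_det_of.differentiable (by simp) _
  have h1 := hd.hasFDerivAt.hasLineDerivAt (fun i j => B i j)
  exact HasDerivAt.unique h1 (hasDerivAt_det_add_smul A B hA)

theorem hasDerivWithinAt_log_det {A : ℝ → Matrix (Fin N) (Fin N) ℝ}
    {A' : Matrix (Fin N) (Fin N) ℝ} {s : Set ℝ} {t : ℝ}
    (h : ∀ i j, HasDerivWithinAt (fun r => A r i j) (A' i j) s t) (hA : (A t).det ≠ 0) :
    HasDerivWithinAt (fun r => Real.log (A r).det) ((A t)⁻¹ * A').trace s t := by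
  have hd : DifferentiableAt ℝ (fun A : Fin N → Fin N → ℝ => (Matrix.of A).det)
      (fun i j => A t i j) := contDiff_det_of.differentiable (by simp) _
  have h1 : HasDerivWithinAt (fun r => (fun i j => A r i j : Fin N → Fin N → ℝ))
      (fun i j => A' i j) s t :=
    hasDerivWithinAt_pi.mpr fun i => hasDerivWithinAt_pi.mpr fun j => h i j
  have h2 := hd.hasFDerivAt.comp_hasDerivWithinAt t h1
  rw [fderiv_det_of _ _ hA] at h2
  have h3 := h2.log hA
  have e : (A t).det * ((A t)⁻¹ * A').trace / (A t).det = ((A t)⁻¹ * A').trace := by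
    field_simp
  rw [← e]
  exact h3

end Det

section Partial

variable {N : ℕ}

local notation "𝔼" => EuclideanSpace ℝ (Fin N)

/-- Differentiability of a matrix field at a point, entry by entry. -/
def DiffMatAt (A : MatField N) (x : EuclideanSpace ℝ (Fin N)) : Prop :=
  ∀ i j, DifferentiableAt ℝ (fun y => A y i j) x

theorem ContDiffOn.differentiableAt_of_isOpen {f : 𝔼 → ℝ} {U : Set 𝔼} (hf : ContDiffOn ℝ ∞ f U)
    (hU : IsOpen U) {x : 𝔼} (hx : x ∈ U) : DifferentiableAt ℝ f x :=
  (hf.contDiffAt (hU.mem_nhds hx)).differentiableAt (by simp)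

theorem SmoothMatOn.diffMatAt {A : MatField N} {U : Set 𝔼} (hA : SmoothMatOn A U) (hU : IsOpen U)
    {x : 𝔼} (hx : x ∈ U) : DiffMatAt A x :=
  fun i j => ContDiffOn.differentiableAt_of_isOpen (hA i j) hU hx

theorem pd_congr {f f' : 𝔼 → ℝ} {U : Set 𝔼} (hU : IsOpen U) (h : ∀ y ∈ U, f y = f' y) (i : Fin N)
    {x : 𝔼} (hx : x ∈ U) : pd i f x = pd i f' x := by
  rw [pd, pd, Filter.EventuallyEq.fderiv_eq]
  exact Filter.eventually_of_mem (hU.mem_nhds hx) h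

theorem pd_add {f f' : 𝔼 → ℝ} {x : 𝔼} (hf : DifferentiableAt ℝ f x) (hf' : DifferentiableAt ℝ f' x)
    (i : Fin N) : pd i (fun y => f y + f' y) x = pd i f x + pd i f' x := by
  rw [pd, fderiv_fun_add hf hf']
  rfl

theorem pd_sub {f f' : 𝔼 → ℝ} {x : 𝔼} (hf : DifferentiableAt ℝ f x) (hf' : DifferentiableAt ℝ f' x)
    (i : Fin N) : pd i (fun y => f y - f' y) x = pd i f x - pd i f' x := by
  rw [pd, fderiv_fun_sub hf hf']
  rfl

theorem pd_neg (f : 𝔼 → ℝ) (x : 𝔼) (i : Fin N) : pd i (fun y => -f y) x = -pd i f x := by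
  rw [pd, fderiv_fun_neg]
  rfl

theorem pd_const (c : ℝ) (x : 𝔼) (i : Fin N) : pd i (fun _ => c) x = 0 := by
  rw [pd, fderiv_const_apply]
  rfl

theorem pd_mul {f f' : 𝔼 → ℝ} {x : 𝔼} (hf : DifferentiableAt ℝ f x) (hf' : DifferentiableAt ℝ f' x)
    (i : Fin N) : pd i (fun y => f y * f' y) x = pd i f x * f' x + f x * pd i f' x := by
  rw [pd, fderiv_fun_mul hf hf', add_comm]
  simp [pd, mul_comm]

theorem pd_const_mul {f : 𝔼 → ℝ} {x : 𝔼} (c : ℝ) (hf : DifferentiableAt ℝ f x) (i : Fin N) :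
    pd i (fun y => c * f y) x = c * pd i f x := by
  rw [pd_mul (differentiableAt_const c) hf, pd_const]
  ring

theorem pd_sum {ι : Type*} {s : Finset ι} {f : ι → 𝔼 → ℝ} {x : 𝔼}
    (hf : ∀ a ∈ s, DifferentiableAt ℝ (f a) x) (i : Fin N) :
    pd i (fun y => ∑ a ∈ s, f a y) x = ∑ a ∈ s, pd i (f a) x := by
  rw [pd, fderiv_fun_sum hf]
  simp [pd]

theorem ContDiffOn.pd_of_isOpen {f : 𝔼 → ℝ} {U : Set 𝔼} (hf : ContDiffOn ℝ ∞ f U) (hU : IsOpen U)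
    (i : Fin N) : ContDiffOn ℝ ∞ (fun y => pd i f y) U :=
  (hf.fderiv_of_isOpen hU (by simp)).clm_apply contDiffOn_const

theorem pd_comm {f : 𝔼 → ℝ} {U : Set 𝔼} (hf : ContDiffOn ℝ ∞ f U) (hU : IsOpen U) {x : 𝔼}
    (hx : x ∈ U) (i j : Fin N) : pd i (fun y => pd j f y) x = pd j (fun y => pd i f y) x := by
  have hs : IsSymmSndFDerivAt ℝ f x := (hf.contDiffAt (hU.mem_nhds hx)).isSymmSndFDerivAt
    (by simpa using WithTop.coe_le_coe.mpr (le_top : (2 : ℕ∞) ≤ ⊤))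
  have hd : DifferentiableAt ℝ (fderiv ℝ f) x :=
    ((hf.fderiv_of_isOpen hU (m := ∞) (by simp)).contDiffAt (hU.mem_nhds hx)).differentiableAt
      (by simp)
  have e : ∀ i j : Fin N, pd i (fun y => pd j f y) x
      = fderiv ℝ (fderiv ℝ f) x (EuclideanSpace.single i 1) (EuclideanSpace.single j 1) := by
    intro i j
    simp only [pd]
    rw [fderiv_clm_apply hd (differentiableAt_const _)]
    simp
  rw [e, e]
  exact hs _ _

theorem pdMat_congr {A B : MatField N} {U : Set 𝔼} (hU : IsOpen U) (h : ∀ y ∈ U, A y = B y)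
    (i : Fin N) {x : 𝔼} (hx : x ∈ U) : pdMat i A x = pdMat i B x := by
  ext k l
  exact pd_congr hU (fun y hy => by rw [h y hy]) i hx

theorem pdMat_transpose (A : MatField N) (i : Fin N) (x : 𝔼) :
    pdMat i (fun y => (A y)ᵀ) x = (pdMat i A x)ᵀ := rfl

theorem pdMat_const (C : Matrix (Fin N) (Fin N) ℝ) (i : Fin N) (x : 𝔼) :
    pdMat i (fun _ => C) x = 0 := by
  ext k l
  exact pd_const _ _ _

theorem pdMat_add {A B : MatField N} {x : 𝔼} (hA : DiffMatAt A x) (hB : DiffMatAt B x)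
    (i : Fin N) : pdMat i (fun y => A y + B y) x = pdMat i A x + pdMat i B x := by
  ext k l
  exact pd_add (hA k l) (hB k l) i

theorem pdMat_sub {A B : MatField N} {x : 𝔼} (hA : DiffMatAt A x) (hB : DiffMatAt B x)
    (i : Fin N) : pdMat i (fun y => A y - B y) x = pdMat i A x - pdMat i B x := by
  ext k l
  exact pd_sub (hA k l) (hB k l) i

theorem pdMat_neg (A : MatField N) (x : 𝔼) (i : Fin N) :
    pdMat i (fun y => -A y) x = -pdMat i A x := by
  ext k l
  exact pd_neg _ x i

theorem pdMat_mul {A B : MatField N} {x : 𝔼} (hA : DiffMatAt A x) (hB : DiffMatAt B x)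
    (i : Fin N) :
    pdMat i (fun y => A y * B y) x = pdMat i A x * B x + A x * pdMat i B x := by
  ext k l
  simp only [pdMat, Matrix.of_apply, Matrix.add_apply, Matrix.mul_apply]
  rw [pd_sum (f := fun a y => A y k a * B y a l) fun a _ => (hA k a).fun_mul (hB a l),
    ← Finset.sum_add_distrib]
  exact Finset.sum_congr rfl fun a _ => pd_mul (hA k a) (hB a l) i

theorem DiffMatAt.mul {A B : MatField N} {x : 𝔼} (hA : DiffMatAt A x) (hB : DiffMatAt B x) :
    DiffMatAt (fun y => A y * B y) x := fun i j => by
  simp only [Matrix.mul_apply]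
  exact DifferentiableAt.fun_sum fun k _ => (hA i k).mul (hB k j)

theorem DiffMatAt.transpose {A : MatField N} {x : 𝔼} (hA : DiffMatAt A x) :
    DiffMatAt (fun y => (A y)ᵀ) x := fun i j => hA j i

theorem DiffMatAt.sub {A B : MatField N} {x : 𝔼} (hA : DiffMatAt A x) (hB : DiffMatAt B x) :
    DiffMatAt (fun y => A y - B y) x := fun i j => (hA i j).sub (hB i j)

theorem pd_trace {A : MatField N} {x : 𝔼} (hA : DiffMatAt A x) (i : Fin N) :
    pd i (fun y => (A y).trace) x = (pdMat i A x).trace := by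
  simp only [Matrix.trace, Matrix.diag_apply]
  rw [pd_sum fun a _ => hA a a]
  rfl

theorem SmoothMatOn.pdMat {A : MatField N} {U : Set 𝔼} (hA : SmoothMatOn A U) (hU : IsOpen U)
    (i : Fin N) : SmoothMatOn (fun y => pdMat i A y) U :=
  fun k l => ContDiffOn.pd_of_isOpen (hA k l) hU i

theorem pdMat_comm {A : MatField N} {U : Set 𝔼} (hA : SmoothMatOn A U) (hU : IsOpen U) {x : 𝔼}
    (hx : x ∈ U) (i j : Fin N) :
    pdMat i (fun y => pdMat j A y) x = pdMat j (fun y => pdMat i A y) x := by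
  ext k l
  exact pd_comm (hA k l) hU hx i j

theorem pd_log_det {A : MatField N} {x : 𝔼} (hA : DiffMatAt A x) (h : (A x).det ≠ 0)
    (i : Fin N) : pd i (fun y => Real.log (A y).det) x = ((A x)⁻¹ * pdMat i A x).trace := by
  have hd : DifferentiableAt ℝ (fun A : Fin N → Fin N → ℝ => (Matrix.of A).det)
      (fun i j => A x i j) := contDiff_det_of.differentiable (by simp) _
  have h1 : HasFDerivAt (fun y => (fun i j => A y i j : Fin N → Fin N → ℝ))
      (ContinuousLinearMap.pi fun i => ContinuousLinearMap.pi fun j =>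
        fderiv ℝ (fun y => A y i j) x) x :=
    hasFDerivAt_pi.mpr fun i => hasFDerivAt_pi.mpr fun j => (hA i j).hasFDerivAt
  have h2 := (hd.hasFDerivAt.comp x h1).log h
  rw [pd]
  erw [h2.fderiv]
  have e := fderiv_det_of (A x) (pdMat i A x) h
  have e2 : ((A x).det)⁻¹ * ((A x).det * ((A x)⁻¹ * pdMat i A x).trace)
      = ((A x)⁻¹ * pdMat i A x).trace := by field_simp
  rw [← e2, ← e]
  rfl

end Partial

/-! ### Generalized Kähler structures on open subsets of Euclidean space -/

section Local

variable {N : ℕ}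

local notation "𝔼" => EuclideanSpace ℝ (Fin N)

/-- A Hermitian structure on an open subset `U` of `ℝ^N`. -/
structure LocalHerm (g I : MatField N) (U : Set (EuclideanSpace ℝ (Fin N))) : Prop where
  isOpen : IsOpen U
  smooth_g : SmoothMatOn g U
  smooth_I : SmoothMatOn I U
  symm : ∀ y ∈ U, (g y)ᵀ = g y
  det_ne : ∀ y ∈ U, (g y).det ≠ 0
  sq : ∀ y ∈ U, I y * I y = -1
  herm : ∀ y ∈ U, (I y)ᵀ * g y * I y = g y
  nij : ∀ y ∈ U, ∀ i j k, nijenhuis I i j k y = 0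

namespace LocalHerm

variable {g I : MatField N} {U : Set (EuclideanSpace ℝ (Fin N))}

theorem mono {V : Set 𝔼} (h : LocalHerm g I U) (hV : IsOpen V) (hVU : V ⊆ U) :
    LocalHerm g I V where
  isOpen := hV
  smooth_g := h.smooth_g.mono hVU
  smooth_I := h.smooth_I.mono hVU
  symm y hy := h.symm y (hVU hy)
  det_ne y hy := h.det_ne y (hVU hy)
  sq y hy := h.sq y (hVU hy)
  herm y hy := h.herm y (hVU hy)
  nij y hy := h.nij y (hVU hy)

/-- The 1-jet of a Hermitian structure at a point. -/
theorem hermJet (h : LocalHerm g I U) {y : 𝔼} (hy : y ∈ U) :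
    HermJet (g y) (I y) (fun i => pdMat i g y) (fun i => pdMat i I y) := by
  have dg := h.smooth_g.diffMatAt h.isOpen hy
  have dI := h.smooth_I.diffMatAt h.isOpen hy
  refine ⟨h.symm y hy, isUnit_iff_ne_zero.mpr (h.det_ne y hy), h.sq y hy, h.herm y hy,
    fun i => ?_, fun i => ?_, fun i => ?_, fun i j k => h.nij y hy i j k⟩
  · exact pdMat_congr h.isOpen h.symm i hy
  · rw [← pdMat_mul dI dI, pdMat_congr h.isOpen h.sq i hy, pdMat_const]
  · have e := pdMat_congr h.isOpen h.herm i hy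
    rwa [pdMat_mul (dI.transpose.mul dg) dI, pdMat_mul dI.transpose dg, pdMat_transpose,
      Matrix.add_mul] at e

theorem extDerivTwo_kahlerForm (h : LocalHerm g I U) {y : 𝔼} (hy : y ∈ U) (i j k : Fin N) :
    extDerivTwo (kahlerForm g I) i j k y
      = jetExt (jetKahler (g y) (I y) (fun i => pdMat i g y) (fun i => pdMat i I y)) i j k := by
  have dg := h.smooth_g.diffMatAt h.isOpen hy
  have dI := h.smooth_I.diffMatAt h.isOpen hy
  have e : ∀ i, pdMat i (kahlerForm g I) y
      = jetKahler (g y) (I y) (fun i => pdMat i g y) (fun i => pdMat i I y) i := fun i => by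
    unfold kahlerForm
    rw [pdMat_mul dI.transpose dg]
    rfl
  rw [jetExt, ← e, ← e, ← e]
  rfl

theorem dcKahler_eq (h : LocalHerm g I U) {y : 𝔼} (hy : y ∈ U) :
    (fun i j k => dcKahler g I i j k y)
      = jetTorsion (g y) (I y) (fun i => pdMat i g y) (fun i => pdMat i I y) := by
  funext i j k
  simp only [dcKahler, jetTorsion, h.extDerivTwo_kahlerForm hy]

theorem bismutConn_eq (h : LocalHerm g I U) {y : 𝔼} (hy : y ∈ U) (i : Fin N) :
    bismutConn g I i y = jetConn (g y) (fun i => pdMat i g y)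
      (jetTorsion (g y) (I y) (fun i => pdMat i g y) (fun i => pdMat i I y)) i := by
  rw [← h.dcKahler_eq hy]
  rfl

theorem leeForm_eq (h : LocalHerm g I U) {y : 𝔼} (hy : y ∈ U) (k : Fin N) :
    leeForm g I k y = formInner (g y) (Matrix.of fun i j =>
      jetExt (jetKahler (g y) (I y) (fun i => pdMat i g y) (fun i => pdMat i I y)) i j k)
      ((I y)ᵀ * g y) := by
  simp only [leeForm, h.extDerivTwo_kahlerForm hy]
  rfl

theorem smooth_inv (h : LocalHerm g I U) : SmoothMatOn (fun y => (g y)⁻¹) U :=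
  h.smooth_g.inv h.det_ne

theorem smooth_bismutConn (h : LocalHerm g I U) (i : Fin N) :
    SmoothMatOn (bismutConn g I i) U := by
  have hω : SmoothMatOn (kahlerForm g I) U := h.smooth_I.transpose.mul h.smooth_g
  have hE : ∀ a b c, ContDiffOn ℝ ∞ (extDerivTwo (kahlerForm g I) a b c) U := fun a b c =>
    ((ContDiffOn.pd_of_isOpen (hω b c) h.isOpen a).add
      (ContDiffOn.pd_of_isOpen (hω c a) h.isOpen b)).add
      (ContDiffOn.pd_of_isOpen (hω a b) h.isOpen c)
  have hT : ∀ a b c, ContDiffOn ℝ ∞ (dcKahler g I a b c) U := fun a b c =>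
    (ContDiffOn.sum fun a' _ => ContDiffOn.sum fun b' _ => ContDiffOn.sum fun c' _ =>
      (((h.smooth_I a' a).mul (h.smooth_I b' b)).mul (h.smooth_I c' c)).mul (hE a' b' c')).neg
  intro k j
  simp only [bismutConn, Matrix.of_apply]
  refine ContDiffOn.sum fun l _ => (h.smooth_inv k l).mul ?_
  refine (contDiffOn_const.mul (((ContDiffOn.pd_of_isOpen (h.smooth_g j l) h.isOpen i).add
    (ContDiffOn.pd_of_isOpen (h.smooth_g i l) h.isOpen j)).sub
    (ContDiffOn.pd_of_isOpen (h.smooth_g i j) h.isOpen l))).sub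
    (contDiffOn_const.mul (hT i j l))

end LocalHerm

/-- The partial derivatives of the 1-form `df ∘ A`. -/
theorem pd_sum_pd_mul {A : MatField N} {f : 𝔼 → ℝ} {U : Set 𝔼} (hU : IsOpen U)
    (hA : SmoothMatOn A U) (hf : ContDiffOn ℝ ∞ f U) {y : 𝔼} (hy : y ∈ U) (i j : Fin N) :
    pd i (fun y => ∑ k, pd k f y * A y k j) y
      = compDeriv (A y) (fun i => pdMat i A y) (fun k => pd k f y)
          (Matrix.of fun i k => pd i (fun z => pd k f z) y) i j := by
  have d1 : ∀ k, DifferentiableAt ℝ (fun z => pd k f z) y := fun k =>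
    ContDiffOn.differentiableAt_of_isOpen (ContDiffOn.pd_of_isOpen hf hU k) hU hy
  have d2 := hA.diffMatAt hU hy
  rw [pd_sum (f := fun k y => pd k f y * A y k j) fun k _ => (d1 k).fun_mul (d2 k j)]
  simp only [compDeriv, Matrix.add_apply, Matrix.mul_apply, Matrix.of_apply, Matrix.mulVec,
    dotProduct, Matrix.transpose_apply]
  rw [← Finset.sum_add_distrib]
  refine Finset.sum_congr rfl fun k _ => ?_
  rw [pd_mul (d1 k) (d2 k j)]
  simp only [pdMat, Matrix.of_apply]
  ring

theorem chernLaplacianCoord_eq {g A : MatField N} {f : 𝔼 → ℝ} {U : Set 𝔼} (hU : IsOpen U)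
    (hA : SmoothMatOn A U) (hf : ContDiffOn ℝ ∞ f U) {y : 𝔼} (hy : y ∈ U) :
    chernLaplacianCoord g A f y
      = formInner (g y) (-(compDeriv (A y) (fun i => pdMat i A y) (fun k => pd k f y)
          (Matrix.of fun i k => pd i (fun z => pd k f z) y)
        - (compDeriv (A y) (fun i => pdMat i A y) (fun k => pd k f y)
          (Matrix.of fun i k => pd i (fun z => pd k f z) y))ᵀ)) ((A y)ᵀ * g y) := by
  have e : ∀ i j, pd i (dcFun A f j) y = -compDeriv (A y) (fun i => pdMat i A y)
      (fun k => pd k f y) (Matrix.of fun i k => pd i (fun z => pd k f z) y) i j := fun i j => by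
    rw [← pd_sum_pd_mul hU hA hf hy, ← pd_neg]
    rfl
  rw [chernLaplacianCoord]
  congr 1
  ext i j
  simp only [extDerivOne, Matrix.of_apply, e, Matrix.neg_apply, Matrix.sub_apply,
    Matrix.transpose_apply]
  ring

/-- A nondegenerate generalized Kähler structure on an open subset `U` of `ℝ^N`. -/
structure LocalGK (g I J : MatField N) (U : Set (EuclideanSpace ℝ (Fin N))) : Prop where
  hermI : LocalHerm g I U
  hermJ : LocalHerm g J U
  torsion : ∀ y ∈ U, ∀ i j k, dcKahler g I i j k y = -dcKahler g J i j k y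
  nondeg : ∀ y ∈ U, (I y * J y - J y * I y).det ≠ 0

/-- The inverse of the commutator `[I, J]`. -/
def commInv (I J : MatField N) : MatField N := fun y => (I y * J y - J y * I y)⁻¹

/-- The Ricci potential in coordinates: `½ log (det (I - J) / det (I + J))`. -/
def coordPotential (I J : MatField N) (y : EuclideanSpace ℝ (Fin N)) : ℝ :=
  (1 / 2) * (Real.log (I y - J y).det - Real.log (I y + J y).det)

theorem sub_mul_add_of_sq {I J : Matrix (Fin N) (Fin N) ℝ} (hI : I * I = -1) (hJ : J * J = -1) :
    (I - J) * (I + J) = I * J - J * I := by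
  rw [Matrix.sub_mul, Matrix.mul_add, Matrix.mul_add, hI, hJ]
  abel

theorem det_sub_ne_zero {I J : Matrix (Fin N) (Fin N) ℝ} (hI : I * I = -1) (hJ : J * J = -1)
    (h : (I * J - J * I).det ≠ 0) : (I - J).det ≠ 0 := by
  rw [← sub_mul_add_of_sq hI hJ, Matrix.det_mul] at h
  exact left_ne_zero_of_mul h

theorem det_add_ne_zero {I J : Matrix (Fin N) (Fin N) ℝ} (hI : I * I = -1) (hJ : J * J = -1)
    (h : (I * J - J * I).det ≠ 0) : (I + J).det ≠ 0 := by
  rw [← sub_mul_add_of_sq hI hJ, Matrix.det_mul] at h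
  exact right_ne_zero_of_mul h

/-- The first variation of the Ricci potential under variations `dI`, `dJ` of the complex
structures. -/
theorem trace_inv_sub_add {I J K dI dJ : Matrix (Fin N) (Fin N) ℝ} (hI : I * I = -1)
    (hJ : J * J = -1) (hK : (I * J - J * I) * K = 1) :
    (1 / 2) * (((I - J)⁻¹ * (dI - dJ)).trace - ((I + J)⁻¹ * (dI + dJ)).trace)
      = (I * K * dI).trace - (J * K * dJ).trace := by
  have hK' : K * (I * J - J * I) = 1 := mul_eq_one_comm.mp hK
  have aI : I * K = -(K * I) := GKJet.anti_comm_inv hK hK' (GKJet.anti_comm_left hI)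
  have aJ : J * K = -(K * J) := GKJet.anti_comm_inv hK hK' (GKJet.anti_comm_right hJ)
  have e1 : (I - J)⁻¹ = (I + J) * K := by
    refine Matrix.inv_eq_right_inv ?_
    rw [← Matrix.mul_assoc, sub_mul_add_of_sq hI hJ, hK]
  have e2 : (I + J)⁻¹ = -((I - J) * K) := by
    have : -((I - J) * K) = K * (I - J) := by
      rw [Matrix.sub_mul, Matrix.mul_sub, aI, aJ]
      abel
    rw [this]
    refine Matrix.inv_eq_left_inv ?_
    rw [Matrix.mul_assoc, sub_mul_add_of_sq hI hJ, hK']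
  rw [e1, e2]
  simp only [Matrix.add_mul, Matrix.sub_mul, Matrix.mul_add, Matrix.mul_sub, Matrix.neg_mul,
    Matrix.trace_add, Matrix.trace_sub, Matrix.trace_neg]
  ring

namespace LocalGK

variable {g I J : MatField N} {U : Set (EuclideanSpace ℝ (Fin N))}

theorem isOpen (h : LocalGK g I J U) : IsOpen U := h.hermI.isOpen

theorem smooth_comm (h : LocalGK g I J U) : SmoothMatOn (fun y => I y * J y - J y * I y) U :=
  (h.hermI.smooth_I.mul h.hermJ.smooth_I).sub (h.hermJ.smooth_I.mul h.hermI.smooth_I)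

theorem smooth_inv (h : LocalGK g I J U) : SmoothMatOn (commInv I J) U :=
  h.smooth_comm.inv h.nondeg

theorem mul_inv (h : LocalGK g I J U) {y : 𝔼} (hy : y ∈ U) :
    (I y * J y - J y * I y) * commInv I J y = 1 :=
  Matrix.mul_nonsing_inv _ (isUnit_iff_ne_zero.mpr (h.nondeg y hy))

/-- The 1-jet of a nondegenerate generalized Kähler structure at a point. -/
theorem gkJet (h : LocalGK g I J U) {y : 𝔼} (hy : y ∈ U) :
    GKJet (g y) (I y) (J y) (commInv I J y) (fun i => pdMat i g y) (fun i => pdMat i I y)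
      (fun i => pdMat i J y) (fun i => pdMat i (commInv I J) y) := by
  have dg := h.hermI.smooth_g.diffMatAt h.isOpen hy
  have dI := h.hermI.smooth_I.diffMatAt h.isOpen hy
  have dJ := h.hermJ.smooth_I.diffMatAt h.isOpen hy
  have dK := h.smooth_inv.diffMatAt h.isOpen hy
  have hQ' : ∀ z ∈ U, commInv I J z * (I z * J z - J z * I z) = 1 :=
    fun z hz => mul_eq_one_comm.mp (h.mul_inv hz)
  have aI : ∀ z ∈ U, I z * commInv I J z = -(commInv I J z * I z) := fun z hz =>
    GKJet.anti_comm_inv (h.mul_inv hz) (hQ' z hz) (GKJet.anti_comm_left (h.hermI.sq z hz))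
  have aJ : ∀ z ∈ U, J z * commInv I J z = -(commInv I J z * J z) := fun z hz =>
    GKJet.anti_comm_inv (h.mul_inv hz) (hQ' z hz) (GKJet.anti_comm_right (h.hermJ.sq z hz))
  have sJ : ∀ z ∈ U, (J z)ᵀ * g z = -(g z * J z) := fun z hz =>
    transpose_mul_of_invariant (h.hermJ.sq z hz) (h.hermJ.herm z hz)
  have sK : ∀ z ∈ U, (g z * commInv I J z)ᵀ = -(g z * commInv I J z) := fun z hz => by
    rw [Matrix.transpose_mul, h.hermI.symm z hz]
    exact transpose_mul_of_right_inv (transpose_mul_commutator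
      (transpose_mul_of_invariant (h.hermI.sq z hz) (h.hermI.herm z hz)) (sJ z hz)) (h.mul_inv hz)
  have cJ : ∀ z ∈ U, (J z)ᵀ * (g z * commInv I J z) = g z * commInv I J z * J z := by
    intro z hz
    rw [← Matrix.mul_assoc, sJ z hz, Matrix.neg_mul, Matrix.mul_assoc, aJ z hz, Matrix.mul_neg,
      neg_neg, Matrix.mul_assoc]
  have dgK := dg.mul dK
  refine ⟨h.hermI.hermJet hy, h.hermJ.hermJet hy, fun i j k => ?_, h.mul_inv hy, fun i => ?_,
    fun i => ?_, fun i => ?_, fun i => ?_⟩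
  · rw [← h.hermI.dcKahler_eq hy, ← h.hermJ.dcKahler_eq hy]
    exact h.torsion y hy i j k
  · have e := pdMat_congr h.isOpen (B := fun _ => 1) (fun z hz => h.mul_inv hz) i hy
    rwa [pdMat_mul ((dI.mul dJ).sub (dJ.mul dI)) dK, pdMat_sub (dI.mul dJ) (dJ.mul dI),
      pdMat_mul dI dJ, pdMat_mul dJ dI, pdMat_const] at e
  · have e := pdMat_congr h.isOpen sK i hy
    rwa [pdMat_neg, pdMat_transpose, pdMat_mul dg dK] at e
  · have e := pdMat_congr h.isOpen cJ i hy
    rwa [pdMat_mul dJ.transpose dgK, pdMat_mul dgK dJ, pdMat_transpose, pdMat_mul dg dK] at e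
  · have e := pdMat_congr h.isOpen aI i hy
    rwa [pdMat_neg, pdMat_mul dI dK, pdMat_mul dK dI] at e

theorem smooth_potential (h : LocalGK g I J U) : ContDiffOn ℝ ∞ (coordPotential I J) U := by
  have hI := h.hermI
  have hJ := h.hermJ
  refine contDiffOn_const.mul (ContDiffOn.sub ?_ ?_)
  · exact (hI.smooth_I.sub hJ.smooth_I).det.log fun y hy =>
      det_sub_ne_zero (hI.sq y hy) (hJ.sq y hy) (h.nondeg y hy)
  · exact (hI.smooth_I.add hJ.smooth_I).det.log fun y hy =>
      det_add_ne_zero (hI.sq y hy) (hJ.sq y hy) (h.nondeg y hy)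

/-- The gradient of the Ricci potential is the one that `GKJet` computes with. -/
theorem pd_potential (h : LocalGK g I J U) {y : 𝔼} (hy : y ∈ U) :
    (fun i => pd i (coordPotential I J) y)
      = GKJet.potentialDeriv (I y) (J y) (commInv I J y) (fun i => pdMat i I y)
          (fun i => pdMat i J y) := by
  funext i
  have dI := h.hermI.smooth_I.diffMatAt h.isOpen hy
  have dJ := h.hermJ.smooth_I.diffMatAt h.isOpen hy
  have dS := (h.hermI.smooth_I.sub h.hermJ.smooth_I).diffMatAt h.isOpen hy
  have dA := (h.hermI.smooth_I.add h.hermJ.smooth_I).diffMatAt h.isOpen hy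
  have nS := det_sub_ne_zero (h.hermI.sq y hy) (h.hermJ.sq y hy) (h.nondeg y hy)
  have nA := det_add_ne_zero (h.hermI.sq y hy) (h.hermJ.sq y hy) (h.nondeg y hy)
  have lS : DifferentiableAt ℝ (fun y => Real.log (I y - J y).det) y :=
    (ContDiffOn.differentiableAt_of_isOpen (h.hermI.smooth_I.sub h.hermJ.smooth_I).det h.isOpen
      hy).log nS
  have lA : DifferentiableAt ℝ (fun y => Real.log (I y + J y).det) y :=
    (ContDiffOn.differentiableAt_of_isOpen (h.hermI.smooth_I.add h.hermJ.smooth_I).det h.isOpen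
      hy).log nA
  unfold coordPotential
  rw [pd_const_mul _ (lS.fun_sub lA), pd_sub lS lA, pd_log_det dS nS, pd_log_det dA nA,
    pdMat_sub dI dJ, pdMat_add dI dJ,
    trace_inv_sub_add (h.hermI.sq y hy) (h.hermJ.sq y hy) (h.mul_inv hy)]
  rfl

/-- The matrix of partial derivatives of the 1-form `dΦ ∘ J`. -/
def potentialComp (I J : MatField N) (y : EuclideanSpace ℝ (Fin N)) : Matrix (Fin N) (Fin N) ℝ :=
  compDeriv (J y) (fun i => pdMat i J y) (fun k => pd k (coordPotential I J) y)
    (Matrix.of fun i k => pd i (fun z => pd k (coordPotential I J) z) y)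

/-- The Bismut-Ricci form of `(g, I)` is `½ d(dΦ ∘ J)`: the exterior derivative of
`GKJet.canonical_conn`, whose left-hand side is evaluated by `trace_curvature`. -/
theorem bismutRicci_eq (h : LocalGK g I J U) {y : 𝔼} (hy : y ∈ U) :
    bismutRicci g I y = (1 / 2 : ℝ) • (potentialComp I J y - (potentialComp I J y)ᵀ) := by
  set Q : MatField N := fun y => I y * J y - J y * I y with hQ
  have dI := h.hermI.smooth_I.diffMatAt h.isOpen hy
  have dQ := h.smooth_comm.diffMatAt h.isOpen hy
  have sK := h.smooth_inv
  have dK : ∀ i, DiffMatAt (pdMat i (commInv I J)) y := fun i =>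
    (sK.pdMat h.isOpen i).diffMatAt h.isOpen hy
  have dΓ : ∀ i, DiffMatAt (bismutConn g I i) y := fun i =>
    (h.hermI.smooth_bismutConn i).diffMatAt h.isOpen hy
  have hj := h.gkJet hy
  have key : ∀ i j, (pdMat i I y * (Q y * pdMat j (commInv I J) y)
      + I y * (pdMat i Q y * pdMat j (commInv I J) y
        + Q y * pdMat i (pdMat j (commInv I J)) y)).trace
      - 2 * (pdMat i I y * bismutConn g I j y + I y * pdMat i (bismutConn g I j) y).trace
      = -2 * potentialComp I J y i j := by
    intro i j
    have e : ∀ z ∈ U, (I z * (Q z * pdMat j (commInv I J) z)).trace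
        - 2 * (I z * bismutConn g I j z).trace
        = -2 * ∑ k, pd k (coordPotential I J) z * J z k j := by
      intro z hz
      have := (h.gkJet hz).canonical_conn j
      rw [← h.hermI.bismutConn_eq hz, ← h.pd_potential hz] at this
      rw [this]
      simp [Matrix.mulVec, dotProduct, mul_comm]
    have e' := pd_congr h.isOpen e i hy
    have d1 : DiffMatAt (fun z => I z * (Q z * pdMat j (commInv I J) z)) y :=
      dI.mul (dQ.mul (dK j))
    have d2 : DiffMatAt (fun z => I z * bismutConn g I j z) y := dI.mul (dΓ j)
    have t1 : DifferentiableAt ℝ (fun z => (I z * (Q z * pdMat j (commInv I J) z)).trace) y :=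
      DifferentiableAt.fun_sum fun a _ => d1 a a
    have t2 : DifferentiableAt ℝ (fun z => (I z * bismutConn g I j z).trace) y :=
      DifferentiableAt.fun_sum fun a _ => d2 a a
    have t3 : DifferentiableAt ℝ (fun z => ∑ k, pd k (coordPotential I J) z * J z k j) y :=
      DifferentiableAt.fun_sum fun k _ => (ContDiffOn.differentiableAt_of_isOpen
        (ContDiffOn.pd_of_isOpen h.smooth_potential h.isOpen k) h.isOpen hy).fun_mul
        (h.hermJ.smooth_I.diffMatAt h.isOpen hy k j)
    rw [pd_sub t1 (t2.const_mul 2), pd_const_mul _ t2, pd_const_mul _ t3, pd_trace d1, pd_trace d2,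
      pdMat_mul dI (dQ.mul (dK j)), pdMat_mul dQ (dK j), pdMat_mul dI (dΓ j),
      pd_sum_pd_mul h.isOpen h.hermJ.smooth_I h.smooth_potential hy] at e'
    exact e'
  ext i j
  have hdQ : ∀ i, pdMat i Q y * commInv I J y + Q y * pdMat i (commInv I J) y = 0 := fun i => by
    rw [← pdMat_mul dQ (sK.diffMatAt h.isOpen hy),
      pdMat_congr h.isOpen (B := fun _ => 1) (fun z hz => h.mul_inv hz) i hy, pdMat_const]
  have tc := trace_curvature (I := I y) (Q := Q y) (K := commInv I J y)
    (dI := fun i => pdMat i I y) (dQ := fun i => pdMat i Q y)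
    (dK := fun i => pdMat i (commInv I J) y) (Γ := fun i => bismutConn g I i y)
    (ddK := fun i j => pdMat i (pdMat j (commInv I J)) y)
    (dΓ := fun i j => pdMat i (bismutConn g I j) y) hj.mul_inv hj.anti_left hdQ
    (fun i => by rw [h.hermI.bismutConn_eq hy]; exact hj.hermI.conn i) hj.danti
    (fun i j => pdMat_comm sK h.isOpen hy i j) i j
  rw [key i j, key j i] at tc
  simp only [bismutRicci, bismutCurv, Matrix.of_apply, Matrix.smul_apply, Matrix.sub_apply,
    Matrix.transpose_apply, smul_eq_mul]
  linarith

theorem lieDerivEnd_eq (X : Fin N → 𝔼 → ℝ) (A : MatField N) (y : 𝔼) :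
    lieDerivEnd X A y = ∑ k, X k y • pdMat k A y
      - (Matrix.of fun i k => pd k (X i) y) * A y + A y * (Matrix.of fun i k => pd k (X i) y) := by
  ext i j
  simp only [lieDerivEnd, Matrix.of_apply, Matrix.add_apply, Matrix.sub_apply, Matrix.sum_apply,
    Matrix.smul_apply, smul_eq_mul, Matrix.mul_apply, pdMat, ← Finset.sum_sub_distrib,
    ← Finset.sum_add_distrib]
  exact Finset.sum_congr rfl fun k _ => by ring

/-- The identity `g [I, J]⁻¹ (L_X J) = ½ d(dΦ ∘ J)` for `X = θ_J^♯ - θ_I^♯`. -/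
theorem symplectic_mul_lieDerivEnd (h : LocalGK g I J U) {y : 𝔼} (hy : y ∈ U) :
    g y * commInv I J y * lieDerivEnd (leeDiff g I J) J y
      = (1 / 2 : ℝ) • (potentialComp I J y - (potentialComp I J y)ᵀ) := by
  have hX : ∀ z ∈ U, (g z * commInv I J z) *ᵥ (fun i => leeDiff g I J i z)
      = -(1 / 2 : ℝ) • fun i => pd i (coordPotential I J) z := fun z hz => by
    rw [h.pd_potential hz]
    refine (h.gkJet hz).symplectic_mulVec_leeDiff _ fun i => ?_
    rw [leeDiff]
    exact Finset.sum_congr rfl fun j _ => by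
      rw [h.hermI.leeForm_eq hz, h.hermJ.leeForm_eq hz]
  have hα : ∀ i, ContDiffOn ℝ ∞ (fun z => pd i (coordPotential I J) z) U := fun i =>
    ContDiffOn.pd_of_isOpen h.smooth_potential h.isOpen i
  have sX : ∀ i, ContDiffOn ℝ ∞ (leeDiff g I J i) U := by
    intro i
    have s := (h.smooth_comm.mul h.hermI.smooth_inv).mulVec
      (fun i => (contDiffOn_const (c := -(1 / 2 : ℝ))).mul (hα i)) i
    refine s.congr fun z hz => ?_
    have e := hX z hz
    have e2 : (I z * J z - J z * I z) * (g z)⁻¹ * (g z * commInv I J z) = 1 := by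
      rw [Matrix.mul_assoc, Matrix.nonsing_inv_mul_cancel_left _ _
        (isUnit_iff_ne_zero.mpr (h.hermI.det_ne z hz)), h.mul_inv hz]
    have e3 := congrArg (((I z * J z - J z * I z) * (g z)⁻¹) *ᵥ ·) e
    simp only [Matrix.mulVec_mulVec, e2, Matrix.one_mulVec] at e3
    exact congrFun e3 i
  rw [lieDerivEnd_eq]
  refine (h.gkJet hy).symplectic_mul_lie (α := fun k => pd k (coordPotential I J) y) ?_ (hX y hy)
    fun i => ?_
  · ext i j
    exact pd_comm h.smooth_potential h.isOpen hy j i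
  · have dg := h.hermI.smooth_g.diffMatAt h.isOpen hy
    have dK := h.smooth_inv.diffMatAt h.isOpen hy
    have dgK := dg.mul dK
    funext m
    have e := pd_congr h.isOpen (fun z hz => congrFun (hX z hz) m) i hy
    simp only [Matrix.mulVec, dotProduct, Pi.smul_apply, smul_eq_mul] at e
    have dX : ∀ i, DifferentiableAt ℝ (leeDiff g I J i) y := fun i =>
      ContDiffOn.differentiableAt_of_isOpen (sX i) h.isOpen hy
    rw [pd_sum (f := fun a z => (g z * commInv I J z) m a * leeDiff g I J a z)
      fun a _ => (dgK m a).fun_mul (dX a), pd_const_mul _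
      (ContDiffOn.differentiableAt_of_isOpen (hα m) h.isOpen hy)] at e
    simp only [Pi.add_apply, Pi.smul_apply, smul_eq_mul, Matrix.mulVec, dotProduct, Matrix.of_apply]
    rw [← Finset.sum_add_distrib, ← e]
    refine Finset.sum_congr rfl fun a _ => ?_
    have es : GKJet.symplecticDeriv (g y) (commInv I J y) (fun i => pdMat i g y)
        (fun i => pdMat i (commInv I J) y) i = pdMat i (fun z => g z * commInv I J z) y :=
      (pdMat_mul dg dK i).symm
    rw [pd_mul (dgK m a) (dX a), es]
    rfl

/-- Along the flow `∂_t J = L_X J` with `X = θ_J^♯ - θ_I^♯`, the Ricci potential moves by its Chern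
Laplacian. -/
theorem neg_trace_eq_chernLaplacian (h : LocalGK g I J U) {y : 𝔼} (hy : y ∈ U) :
    -(J y * commInv I J y * lieDerivEnd (leeDiff g I J) J y).trace
      = chernLaplacianCoord g I (coordPotential I J) y := by
  rw [chernLaplacianCoord_eq h.isOpen h.hermI.smooth_I h.smooth_potential hy,
    ← (h.gkJet hy).chern_eq _ (h.pd_potential hy),
    (h.gkJet hy).potential_variation ?_ (h.symplectic_mul_lieDerivEnd hy)]
  · rfl
  · rw [Matrix.transpose_sub, Matrix.transpose_transpose, neg_sub]

/-- The evolution equations preserve `g [I, J]⁻¹` to first order. -/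
theorem symplectic_variation (h : LocalGK g I J U) {y : 𝔼} (hy : y ∈ U)
    {V : Matrix (Fin N) (Fin N) ℝ}
    (hV : (I y)ᵀ * V = -(2 : ℝ) • oneOnePart (I y) (bismutRicci g I y)) :
    V = g y * commInv I J y * (I y * lieDerivEnd (leeDiff g I J) J y
      - lieDerivEnd (leeDiff g I J) J y * I y) := by
  refine (h.gkJet hy).symplectic_variation rfl ?_
  rw [hV, h.bismutRicci_eq hy, h.symplectic_mul_lieDerivEnd hy]

end LocalGK

end Local

/-! ### Top powers of 2-forms -/

section TopForm

variable {n : ℕ}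

/-- The value on the standard basis of the `2n`-fold wedge power of the 2-form with matrix `F`. -/
def topForm (F : Matrix (Fin (4 * n)) (Fin (4 * n)) ℝ) : ℝ :=
  topPower (fun i j => F i j) id

/-- The multilinear map `v ↦ ∏ F(v_{2i}, v_{2i+1})`. -/
def pairProd (F : Matrix (Fin (4 * n)) (Fin (4 * n)) ℝ) :
    MultilinearMap ℝ (fun _ : Fin (4 * n) => Fin (4 * n) → ℝ) ℝ :=
  have key : ∀ (v : Fin (4 * n) → Fin (4 * n) → ℝ) (j : Fin (4 * n)),
      ∃ L : (Fin (4 * n) → ℝ) →ₗ[ℝ] ℝ, ∀ x, (∏ i : Fin (2 * n),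
        Function.update v j x ⟨2 * i, by omega⟩
          ⬝ᵥ F *ᵥ Function.update v j x ⟨2 * i + 1, by omega⟩) = L x := by
    intro v j
    set i₀ : Fin (2 * n) := ⟨j / 2, by omega⟩ with hi₀
    have hne : ∀ x, ∀ i ∈ Finset.univ.erase i₀, Function.update v j x ⟨2 * i, by omega⟩
          ⬝ᵥ F *ᵥ Function.update v j x ⟨2 * i + 1, by omega⟩
        = v ⟨2 * i, by omega⟩ ⬝ᵥ F *ᵥ v ⟨2 * i + 1, by omega⟩ := by
      intro x i hi
      have hi' : (i : ℕ) ≠ j / 2 := fun h => (Finset.ne_of_mem_erase hi) (Fin.ext h)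
      rw [Function.update_of_ne, Function.update_of_ne] <;>
      · intro h
        have := congrArg Fin.val h
        simp only at this
        omega
    have hj := Nat.div_add_mod j 2
    rcases Nat.mod_two_eq_zero_or_one j with h | h
    · refine ⟨(∏ i ∈ Finset.univ.erase i₀, v ⟨2 * i, by omega⟩ ⬝ᵥ F *ᵥ v ⟨2 * i + 1, by omega⟩) •
        (dotProductBilin ℝ ℝ).flip (F *ᵥ v ⟨2 * i₀ + 1, by omega⟩), fun x => ?_⟩
      rw [← Finset.mul_prod_erase _ _ (Finset.mem_univ i₀), Finset.prod_congr rfl (hne x),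
        Function.update_of_ne (a := (⟨2 * i₀ + 1, _⟩ : Fin (4 * n)))]
      · have : (⟨2 * i₀, by omega⟩ : Fin (4 * n)) = j := Fin.ext (by simp only [hi₀]; omega)
        rw [this, Function.update_self]
        simp [mul_comm]
      · intro h
        have := congrArg Fin.val h
        simp only [hi₀] at this
        omega
    · refine ⟨(∏ i ∈ Finset.univ.erase i₀, v ⟨2 * i, by omega⟩ ⬝ᵥ F *ᵥ v ⟨2 * i + 1, by omega⟩) •
        (dotProductBilin ℝ ℝ (v ⟨2 * i₀, by omega⟩)) ∘ₗ F.mulVecLin, fun x => ?_⟩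
      rw [← Finset.mul_prod_erase _ _ (Finset.mem_univ i₀), Finset.prod_congr rfl (hne x),
        Function.update_of_ne (a := (⟨2 * i₀, _⟩ : Fin (4 * n)))]
      · have : (⟨2 * i₀ + 1, by omega⟩ : Fin (4 * n)) = j := Fin.ext (by simp only [hi₀]; omega)
        rw [this, Function.update_self]
        simp [mul_comm]
      · intro h
        have := congrArg Fin.val h
        simp only [hi₀] at this
        omega
  { toFun := fun v => ∏ i : Fin (2 * n), v ⟨2 * i, by omega⟩ ⬝ᵥ F *ᵥ v ⟨2 * i + 1, by omega⟩
    map_update_add' := fun {inst} v j x y => by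
      rw [Subsingleton.elim inst (instDecidableEqFin _)]
      obtain ⟨L, hL⟩ := key v j
      rw [hL, hL, hL, map_add]
    map_update_smul' := fun {inst} v j c x => by
      rw [Subsingleton.elim inst (instDecidableEqFin _)]
      obtain ⟨L, hL⟩ := key v j
      rw [hL, hL, map_smul] }

/-- The top power of a 2-form is a form of top degree: a change of basis multiplies it by the
determinant. -/
theorem topForm_transpose_mul_mul (F B : Matrix (Fin (4 * n)) (Fin (4 * n)) ℝ) :
    topForm (Bᵀ * F * B) = B.det * topForm F := by
  have key : ∀ v : Fin (4 * n) → Fin (4 * n) → ℝ, topForm (Matrix.of v * F * (Matrix.of v)ᵀ)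
      = (1 / 2 ^ (2 * n)) * MultilinearMap.alternatization (pairProd F) v := by
    intro v
    have e := MultilinearMap.alternatization_apply (pairProd F) v
    rw [topForm, topPower, e]
    congr 1
    refine Finset.sum_congr rfl fun σ _ => ?_
    rw [Units.smul_def, zsmul_eq_mul]
    congr 1
    refine Finset.prod_congr rfl fun i _ => ?_
    simp only [id]
    rw [Matrix.mul_assoc, Matrix.mul_apply]
    rfl
  have hdet : ∀ v : Fin (4 * n) → Fin (4 * n) → ℝ,
      MultilinearMap.alternatization (pairProd F) v
        = MultilinearMap.alternatization (pairProd F) (Pi.basisFun ℝ (Fin (4 * n)))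
          * (Matrix.of v).det := by
    intro v
    have e := congrArg (fun f => f v) (AlternatingMap.eq_smul_basis_det
      (Pi.basisFun ℝ (Fin (4 * n))) (MultilinearMap.alternatization (pairProd F)))
    rw [Pi.basisFun_det] at e
    exact e
  have e1 : Bᵀ = Matrix.of fun i j => B j i := rfl
  have e2 : topForm F = topForm (Matrix.of (1 : Matrix (Fin (4 * n)) (Fin (4 * n)) ℝ) * F
      * (Matrix.of (1 : Matrix (Fin (4 * n)) (Fin (4 * n)) ℝ))ᵀ) := by
    have : Matrix.of (1 : Matrix (Fin (4 * n)) (Fin (4 * n)) ℝ) = 1 := rfl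
    rw [this, Matrix.transpose_one, Matrix.one_mul, Matrix.mul_one]
  have e3 : Bᵀ * F * B = Matrix.of (fun i j => B j i) * F * (Matrix.of fun i j => B j i)ᵀ := rfl
  have h2 := key (1 : Matrix (Fin (4 * n)) (Fin (4 * n)) ℝ)
  have h3 := hdet (1 : Matrix (Fin (4 * n)) (Fin (4 * n)) ℝ)
  rw [← e2] at h2
  have : Matrix.of (1 : Matrix (Fin (4 * n)) (Fin (4 * n)) ℝ) = 1 := rfl
  rw [this, Matrix.det_one] at h3
  rw [e3, key, hdet, ← e1, Matrix.det_transpose, h2, h3]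
  ring

/-- The standard symplectic form on `ℝ²`. -/
def area (a b : Fin 2) : ℝ := (b : ℕ) - (a : ℕ)

theorem area_perm (ρ : Equiv.Perm (Fin 2)) :
    area (ρ 0) (ρ 1) = ((Equiv.Perm.sign ρ : ℤ) : ℝ) := by
  have h : ∀ ρ : Equiv.Perm (Fin 2),
      (((ρ 1 : Fin 2) : ℕ) : ℤ) - ((ρ 0 : Fin 2) : ℕ) = (Equiv.Perm.sign ρ : ℤ) := by decide
  rw [← h ρ, area]
  push_cast
  rfl

/-- Only permutations of the factors and flips within the factors contribute to the top power of the
standard symplectic form, and all these contribute the value `1`. -/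
theorem sign_mul_prod_area {m : ℕ} (σ : Equiv.Perm (Fin m × Fin 2)) :
    ((Equiv.Perm.sign σ : ℤ) : ℝ) * ∏ i, (if (σ (i, 0)).1 = (σ (i, 1)).1 then
      area (σ (i, 0)).2 (σ (i, 1)).2 else 0) =
      if ∀ i, (σ (i, 0)).1 = (σ (i, 1)).1 then 1 else 0 := by
  split_ifs with h
  · have hσ : ∀ i a, (σ (i, a)).1 = (σ (i, 0)).1 := by
      intro i a
      rcases Fin.exists_fin_two.mp ⟨a, rfl⟩ with rfl | rfl
      · rfl
      · exact (h i).symm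
    have hsurj : Function.Surjective fun i => (σ (i, 0)).1 := by
      intro k
      refine ⟨(σ.symm (k, 0)).1, ?_⟩
      have := hσ (σ.symm (k, 0)).1 (σ.symm (k, 0)).2
      simp only [Prod.mk.eta, Equiv.apply_symm_apply] at this
      exact this.symm
    set π : Equiv.Perm (Fin m) :=
      Equiv.ofBijective _ ⟨Finite.injective_iff_surjective.mpr hsurj, hsurj⟩ with hπ
    have hinj : ∀ i, Function.Injective fun a => (σ (i, a)).2 := by
      intro i a b hab
      have : σ (i, a) = σ (i, b) := Prod.ext ((hσ i a).trans (hσ i b).symm) hab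
      simpa using σ.injective this
    set ρ : Fin m → Equiv.Perm (Fin 2) := fun i =>
      Equiv.ofBijective _ ⟨hinj i, Finite.injective_iff_surjective.mp (hinj i)⟩ with hρ
    have e : σ = (Equiv.prodCongrLeft fun _ : Fin 2 => π) * (Equiv.prodCongrRight ρ) := by
      refine Equiv.ext fun p => Prod.ext ?_ rfl
      exact hσ p.1 p.2
    have es : Equiv.Perm.sign σ = ∏ i, Equiv.Perm.sign (ρ i) := by
      rw [e, map_mul, Equiv.Perm.sign_prodCongrLeft, Equiv.Perm.sign_prodCongrRight]
      simp only [Finset.prod_const, Finset.card_univ, Fintype.card_fin, Int.units_sq, one_mul]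
    have ep : ∀ i, (if (σ (i, 0)).1 = (σ (i, 1)).1 then area (σ (i, 0)).2 (σ (i, 1)).2 else 0)
        = ((Equiv.Perm.sign (ρ i) : ℤ) : ℝ) := fun i => by
      rw [if_pos (h i), ← area_perm]
      rfl
    rw [Finset.prod_congr rfl fun i _ => ep i, es]
    push_cast
    rw [← Finset.prod_mul_distrib]
    refine Finset.prod_eq_one fun i _ => ?_
    rcases Int.units_eq_one_or (Equiv.Perm.sign (ρ i)) with h | h <;> simp [h]
  · push Not at h
    obtain ⟨i, hi⟩ := h
    rw [Finset.prod_eq_zero (Finset.mem_univ i) (if_neg hi), mul_zero]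

/-- The bijection `(i, a) ↦ 2 i + a`. -/
def pairIndex (n : ℕ) : Fin (2 * n) × Fin 2 ≃ Fin (4 * n) :=
  finProdFinEquiv.trans (finCongr (by ring))

theorem pairIndex_val (i : Fin (2 * n)) (a : Fin 2) : (pairIndex n (i, a) : ℕ) = a + 2 * i := by
  simp [pairIndex]

/-- The standard symplectic form on `ℝ^{4n}`. -/
def stdSymplectic (n : ℕ) : Matrix (Fin (4 * n)) (Fin (4 * n)) ℝ :=
  Matrix.of fun j k => if ((pairIndex n).symm j).1 = ((pairIndex n).symm k).1 then
    area ((pairIndex n).symm j).2 ((pairIndex n).symm k).2 else 0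

theorem topForm_stdSymplectic_pos : 0 < topForm (stdSymplectic n) := by
  rw [topForm, topPower]
  refine mul_pos (by positivity) ?_
  have e0 : ∀ i : Fin (2 * n), (⟨2 * i, by omega⟩ : Fin (4 * n)) = pairIndex n (i, 0) := fun i =>
    Fin.ext (by rw [pairIndex_val]; simp)
  have e1 : ∀ i : Fin (2 * n), (⟨2 * i + 1, by omega⟩ : Fin (4 * n)) = pairIndex n (i, 1) :=
    fun i => Fin.ext (by rw [pairIndex_val]; simp [add_comm])
  have e : ∀ σ : Equiv.Perm (Fin (4 * n)), ((Equiv.Perm.sign σ : ℤ) : ℝ) * ∏ i : Fin (2 * n),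
      stdSymplectic n (id (σ ⟨2 * i, by omega⟩)) (id (σ ⟨2 * i + 1, by omega⟩))
      = if ∀ i, ((pairIndex n).permCongr.symm σ (i, 0)).1 = ((pairIndex n).permCongr.symm σ (i, 1)).1
        then 1 else 0 := by
    intro σ
    rw [← sign_mul_prod_area]
    congr 1
    · rw [Equiv.permCongr_symm, Equiv.Perm.sign_permCongr]
    · refine Finset.prod_congr rfl fun i _ => ?_
      rw [e0, e1]
      rfl
  rw [Finset.sum_congr rfl fun σ _ => e σ]
  refine Finset.sum_pos' (fun σ _ => by split_ifs <;> norm_num) ⟨1, Finset.mem_univ _, ?_⟩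
  rw [if_pos]
  · norm_num
  · intro i
    simp [Equiv.permCongr_symm]

/-- A skew nondegenerate form has symplectic families of every size up to half the dimension. -/
theorem exists_symplectic_family {N : ℕ} {F : Matrix (Fin N) (Fin N) ℝ} (hF : Fᵀ = -F)
    (hd : F.det ≠ 0) (m : ℕ) (hm : 2 * m ≤ N) :
    ∃ u v : Fin m → Fin N → ℝ, (∀ i j, u i ⬝ᵥ F *ᵥ u j = 0) ∧ (∀ i j, v i ⬝ᵥ F *ᵥ v j = 0) ∧
      ∀ i j, u i ⬝ᵥ F *ᵥ v j = if i = j then 1 else 0 := by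
  have skew : ∀ x y : Fin N → ℝ, x ⬝ᵥ F *ᵥ y = -(y ⬝ᵥ F *ᵥ x) := fun x y => by
    rw [Matrix.dotProduct_mulVec, ← Matrix.mulVec_transpose, hF, Matrix.neg_mulVec, neg_dotProduct,
      dotProduct_comm]
  induction m with
  | zero => exact ⟨fun _ => 0, fun _ => 0, fun i => i.elim0, fun i => i.elim0, fun i => i.elim0⟩
  | succ m ih =>
    obtain ⟨u, v, huu, hvv, huv⟩ := ih (by omega)
    have hvu : ∀ i j, v i ⬝ᵥ F *ᵥ u j = if i = j then -1 else 0 := fun i j => by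
      rw [skew, huv]
      by_cases h : i = j <;> simp [h, eq_comm]
    -- a vector orthogonal to the given family
    obtain ⟨x, hx0, hx⟩ : ∃ x : Fin N → ℝ, x ≠ 0 ∧
        ∀ p : Fin m ⊕ Fin m, (Sum.elim u v p) ⬝ᵥ F *ᵥ x = 0 := by
      set L : (Fin N → ℝ) →ₗ[ℝ] (Fin m ⊕ Fin m → ℝ) :=
        LinearMap.pi fun p => (dotProductBilin ℝ ℝ (Sum.elim u v p)) ∘ₗ F.mulVecLin with hL
      have hker : LinearMap.ker L ≠ ⊥ := by
        refine LinearMap.ker_ne_bot_of_finrank_lt ?_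
        simp
        omega
      obtain ⟨x, hx, hx0⟩ := Submodule.exists_mem_ne_zero_of_ne_bot hker
      exact ⟨x, hx0, fun p => congrFun (LinearMap.mem_ker.mp hx) p⟩
    obtain ⟨w, hw⟩ : ∃ w : Fin N → ℝ, x ⬝ᵥ F *ᵥ w = 1 := by
      have hxx : x ⬝ᵥ x ≠ 0 := fun h => hx0 (dotProduct_self_eq_zero.mp h)
      refine ⟨F⁻¹ *ᵥ ((x ⬝ᵥ x)⁻¹ • x), ?_⟩
      rw [Matrix.mulVec_mulVec, Matrix.mul_nonsing_inv _ (isUnit_iff_ne_zero.mpr hd),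
        Matrix.one_mulVec, dotProduct_smul, smul_eq_mul, inv_mul_cancel₀ hxx]
    have hxu : ∀ i, u i ⬝ᵥ F *ᵥ x = 0 := fun i => hx (Sum.inl i)
    have hxv : ∀ i, v i ⬝ᵥ F *ᵥ x = 0 := fun i => hx (Sum.inr i)
    -- the projection of `w` to the orthogonal complement of the given family
    set w' := w - ∑ i, (u i ⬝ᵥ F *ᵥ w) • v i + ∑ i, (v i ⬝ᵥ F *ᵥ w) • u i with hw'
    have hFw : ∀ z, z ⬝ᵥ F *ᵥ w' = z ⬝ᵥ F *ᵥ w - ∑ i, (u i ⬝ᵥ F *ᵥ w) * (z ⬝ᵥ F *ᵥ v i)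
        + ∑ i, (v i ⬝ᵥ F *ᵥ w) * (z ⬝ᵥ F *ᵥ u i) := fun z => by
      rw [hw', Matrix.mulVec_add, Matrix.mulVec_sub, dotProduct_add, dotProduct_sub,
        Matrix.mulVec_sum, Matrix.mulVec_sum, dotProduct_sum, dotProduct_sum]
      simp only [Matrix.mulVec_smul, dotProduct_smul, smul_eq_mul]
    have h1 : x ⬝ᵥ F *ᵥ w' = 1 := by
      rw [hFw, hw]
      simp [skew x, hxu, hxv]
    have h2 : ∀ i, u i ⬝ᵥ F *ᵥ w' = 0 := fun i => by
      rw [hFw]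
      simp [huu, huv]
    have h3 : ∀ i, v i ⬝ᵥ F *ᵥ w' = 0 := fun i => by
      rw [hFw]
      simp [hvv, hvu]
    have self : ∀ y, y ⬝ᵥ F *ᵥ y = 0 := fun y => by linarith [skew y y]
    refine ⟨Fin.cons x u, Fin.cons w' v, fun i j => ?_, fun i j => ?_, fun i j => ?_⟩
    · refine Fin.cases ?_ (fun i => ?_) i <;> refine Fin.cases ?_ (fun j => ?_) j
      · simpa using self x
      · simpa [skew x] using hxu j
      · simpa using hxu i
      · simpa using huu i j
    · refine Fin.cases ?_ (fun i => ?_) i <;> refine Fin.cases ?_ (fun j => ?_) j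
      · simpa using self w'
      · simpa [skew w'] using h3 j
      · simpa using h3 i
      · simpa using hvv i j
    · refine Fin.cases ?_ (fun i => ?_) i <;> refine Fin.cases ?_ (fun j => ?_) j
      · simpa using h1
      · simpa [skew x, Fin.succ_ne_zero, eq_comm] using hxv j
      · simpa [Fin.succ_ne_zero] using h2 i
      · simpa using huv i j

/-- A skew nondegenerate form is congruent to the standard symplectic form. -/
theorem exists_congruent_stdSymplectic {F : Matrix (Fin (4 * n)) (Fin (4 * n)) ℝ} (hF : Fᵀ = -F)
    (hd : F.det ≠ 0) : ∃ B : Matrix (Fin (4 * n)) (Fin (4 * n)) ℝ, Bᵀ * F * B = stdSymplectic n := by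
  obtain ⟨u, v, huu, hvv, huv⟩ := exists_symplectic_family hF hd (2 * n) (by omega)
  set b : Fin (2 * n) × Fin 2 → Fin (4 * n) → ℝ := fun p => if p.2 = 0 then u p.1 else v p.1 with hb
  refine ⟨Matrix.of fun k j => b ((pairIndex n).symm j) k, ?_⟩
  have hvu : ∀ i j, v i ⬝ᵥ F *ᵥ u j = if i = j then -1 else 0 := fun i j => by
    rw [Matrix.dotProduct_mulVec, ← Matrix.mulVec_transpose, hF, Matrix.neg_mulVec, neg_dotProduct,
      dotProduct_comm, huv]
    by_cases h : i = j <;> simp [h, eq_comm]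
  have key : ∀ p q, b p ⬝ᵥ F *ᵥ b q = if p.1 = q.1 then area p.2 q.2 else 0 := by
    rintro ⟨i, a⟩ ⟨j, c⟩
    rcases Fin.exists_fin_two.mp ⟨a, rfl⟩ with rfl | rfl <;>
      rcases Fin.exists_fin_two.mp ⟨c, rfl⟩ with rfl | rfl
    · simp [hb, huu, area]
    · simp [hb, huv, area]
    · simp [hb, hvu, area]
    · simp [hb, hvv, area]
  ext j k
  rw [stdSymplectic, Matrix.of_apply, ← key, Matrix.mul_assoc, Matrix.mul_apply, dotProduct]
  rfl

/-- The square of the top power of a nondegenerate form is its determinant, up to a universal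
factor. -/
theorem topForm_sq (n : ℕ) : ∃ c : ℝ, c ≠ 0 ∧ ∀ F : Matrix (Fin (4 * n)) (Fin (4 * n)) ℝ,
    Fᵀ = -F → F.det ≠ 0 → topForm F ^ 2 = c * F.det := by
  have hsq : stdSymplectic n * stdSymplectic n = -1 := by
    ext j k
    rw [Matrix.mul_apply, ← (pairIndex n).sum_comp, Fintype.sum_prod_type]
    simp only [stdSymplectic, Matrix.of_apply, Equiv.symm_apply_apply, Fin.sum_univ_two, area]
    obtain ⟨⟨i, a⟩, rfl⟩ := (pairIndex n).surjective j
    obtain ⟨⟨l, c⟩, rfl⟩ := (pairIndex n).surjective k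
    simp only [Equiv.symm_apply_apply, Matrix.neg_apply, Matrix.one_apply,
      EmbeddingLike.apply_eq_iff_eq, Prod.mk.injEq]
    rw [Finset.sum_eq_single i]
    · rcases Fin.exists_fin_two.mp ⟨a, rfl⟩ with rfl | rfl <;>
        rcases Fin.exists_fin_two.mp ⟨c, rfl⟩ with rfl | rfl <;> by_cases h : i = l <;> simp [h]
    · intro b _ hb
      simp [Ne.symm hb]
    · simp
  have hdet : (stdSymplectic n).det ≠ 0 := fun h => by
    have := congrArg Matrix.det hsq
    rw [Matrix.det_mul, h, Matrix.det_neg, Matrix.det_one, mul_one, mul_zero] at this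
    exact pow_ne_zero _ (by norm_num) this.symm
  have hτ := topForm_stdSymplectic_pos (n := n)
  refine ⟨topForm (stdSymplectic n) ^ 2 / (stdSymplectic n).det,
    div_ne_zero (pow_ne_zero 2 hτ.ne') hdet, fun F hF hd => ?_⟩
  obtain ⟨B, hB⟩ := exists_congruent_stdSymplectic hF hd
  have h1 := topForm_transpose_mul_mul F B
  have h2 := congrArg Matrix.det hB
  rw [hB] at h1
  rw [Matrix.det_mul, Matrix.det_mul, Matrix.det_transpose] at h2
  have hB0 : B.det ≠ 0 := fun h => by rw [h] at h2; simp at h2; exact hdet h2.symm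
  rw [h1, ← h2]
  field_simp

theorem continuous_topForm {A : ℝ → Matrix (Fin (4 * n)) (Fin (4 * n)) ℝ} (hA : Continuous A) :
    Continuous fun s => topForm (A s) := by
  unfold topForm topPower
  refine continuous_const.mul (continuous_finsetSum _ fun σ _ => continuous_const.mul
    (continuous_finsetProd _ fun i _ => ?_))
  exact (continuous_apply _).comp ((continuous_apply _).comp hA)

theorem mul_pos_of_continuous {f : ℝ → ℝ} (hfc : Continuous f)
    (hfne : ∀ s ∈ Set.Icc (-1 : ℝ) 1, f s ≠ 0) : 0 < f 1 * f (-1) := by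
  have m1 : (1 : ℝ) ∈ Set.Icc (-1 : ℝ) 1 := by norm_num
  have m2 : (-1 : ℝ) ∈ Set.Icc (-1 : ℝ) 1 := by norm_num
  by_contra hneg
  have h0 : (0 : ℝ) ∈ Set.uIcc (f (-1)) (f 1) := by
    rw [Set.mem_uIcc]
    rcases le_total 0 (f 1) with h | h <;> rcases le_total 0 (f (-1)) with h' | h'
    · exact absurd (mul_pos (lt_of_le_of_ne h (hfne 1 m1).symm)
        (lt_of_le_of_ne h' (hfne _ m2).symm)) hneg
    · exact Or.inl ⟨h', h⟩
    · exact Or.inr ⟨h, h'⟩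
    · exact absurd (mul_pos_of_neg_of_neg (lt_of_le_of_ne h (hfne 1 m1))
        (lt_of_le_of_ne h' (hfne _ m2))) hneg
  obtain ⟨s, hs, hs0⟩ := intermediate_value_uIcc hfc.continuousOn h0
  rw [Set.uIcc_of_le (by norm_num)] at hs
  exact hfne s hs hs0

section Ratio

variable {g I J : Matrix (Fin (4 * n)) (Fin (4 * n)) ℝ}

/-- If `I`, `J` are complex structures compatible with the scalar product `g` and `[I, J]` is
invertible, then `I + s J` is invertible for all `s ∈ [-1, 1]`: for `|s| < 1` because `I` and `J` are
isometries. -/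
theorem det_add_smul_ne_zero (hpos : ∀ x : Fin (4 * n) → ℝ, x ≠ 0 → 0 < x ⬝ᵥ g *ᵥ x)
    (hI : I * I = -1) (hJ : J * J = -1) (hgI : Iᵀ * g * I = g) (hgJ : Jᵀ * g * J = g)
    (hQ : (I * J - J * I).det ≠ 0) {s : ℝ} (hs : s ∈ Set.Icc (-1 : ℝ) 1) :
    (I + s • J).det ≠ 0 := by
  rcases eq_or_ne s 1 with rfl | h1
  · rw [one_smul]
    exact det_add_ne_zero hI hJ hQ
  rcases eq_or_ne s (-1) with rfl | h2
  · rw [neg_smul, one_smul, ← sub_eq_add_neg]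
    exact det_sub_ne_zero hI hJ hQ
  intro h0
  obtain ⟨v, hv, hv0⟩ := Matrix.exists_mulVec_eq_zero_iff.mpr h0
  have iso : ∀ A : Matrix (Fin (4 * n)) (Fin (4 * n)) ℝ, Aᵀ * g * A = g →
      (A *ᵥ v) ⬝ᵥ g *ᵥ (A *ᵥ v) = v ⬝ᵥ g *ᵥ v := fun A hA => by
    conv_rhs => rw [← hA]
    rw [← Matrix.mulVec_mulVec, ← Matrix.mulVec_mulVec, Matrix.dotProduct_mulVec v,
      Matrix.vecMul_transpose]
  have e : I *ᵥ v = -(s • J *ᵥ v) := by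
    rw [Matrix.add_mulVec, Matrix.smul_mulVec] at hv0
    exact eq_neg_of_add_eq_zero_left hv0
  have e2 := iso I hgI
  rw [e, Matrix.mulVec_neg, neg_dotProduct_neg, Matrix.mulVec_smul, smul_dotProduct,
    dotProduct_smul, iso J hgJ, smul_eq_mul, smul_eq_mul] at e2
  have e3 := hpos v hv
  have e4 : s * s = 1 := by
    have : (s * s - 1) * (v ⬝ᵥ g *ᵥ v) = 0 := by linarith
    rcases mul_eq_zero.mp this with h | h
    · linarith
    · exact absurd h e3.ne'
  rcases mul_self_eq_one_iff.mp e4 with h | h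
  · exact h1 h
  · exact h2 h

/-- The ratio of the top powers of `F_±` is positive, and its square is the quotient of the
determinants of `I ∓ J`. For `A = I + s J` and `F = -2 g A⁻¹` the form `Aᵀ F A = -2 g A` is linear
in `s`; the top powers of both differ by the factor `det A`. -/
theorem topForm_ratio (hpos : ∀ x : Fin (4 * n) → ℝ, x ≠ 0 → 0 < x ⬝ᵥ g *ᵥ x) (hg : gᵀ = g)
    (hI : I * I = -1) (hJ : J * J = -1) (hgI : Iᵀ * g * I = g) (hgJ : Jᵀ * g * J = g)
    (hQ : (I * J - J * I).det ≠ 0) :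
    0 < topForm (-(2 : ℝ) • (((I + J)⁻¹)ᵀ * g)) / topForm (-(2 : ℝ) • (((I - J)⁻¹)ᵀ * g)) ∧
    (topForm (-(2 : ℝ) • (((I + J)⁻¹)ᵀ * g)) / topForm (-(2 : ℝ) • (((I - J)⁻¹)ᵀ * g))) ^ 2
      = (I - J).det / (I + J).det := by
  obtain ⟨c, hc, hsq⟩ := topForm_sq n
  have hgd : g.det ≠ 0 := fun h => by
    obtain ⟨v, hv, hv0⟩ := Matrix.exists_mulVec_eq_zero_iff.mpr h
    have := hpos v hv
    rw [hv0, dotProduct_zero] at this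
    exact this.ne rfl
  set A : ℝ → Matrix (Fin (4 * n)) (Fin (4 * n)) ℝ := fun s => I + s • J with hA
  have hAd : ∀ s ∈ Set.Icc (-1 : ℝ) 1, (A s).det ≠ 0 := fun s hs =>
    det_add_smul_ne_zero hpos hI hJ hgI hgJ hQ hs
  have hskew : ∀ s, (A s)ᵀ * g = -(g * A s) := fun s => by
    simp only [hA]
    rw [Matrix.transpose_add, Matrix.transpose_smul, Matrix.add_mul, Matrix.smul_mul,
      transpose_mul_of_invariant hI hgI,
      transpose_mul_of_invariant hJ hgJ, Matrix.mul_add, Matrix.mul_smul]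
    simp only [smul_neg]
    abel
  set F : ℝ → Matrix (Fin (4 * n)) (Fin (4 * n)) ℝ := fun s => -(2 : ℝ) • (((A s)⁻¹)ᵀ * g) with hF
  have hAF : ∀ s ∈ Set.Icc (-1 : ℝ) 1, (A s)ᵀ * F s * A s = -(2 : ℝ) • (g * A s) := fun s hs => by
    simp only [hF]
    rw [Matrix.mul_smul, Matrix.smul_mul, ← Matrix.mul_assoc, ← Matrix.transpose_mul,
      Matrix.nonsing_inv_mul _ (isUnit_iff_ne_zero.mpr (hAd s hs)), Matrix.transpose_one,
      Matrix.one_mul]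
  have hTF : ∀ s ∈ Set.Icc (-1 : ℝ) 1,
      topForm (-(2 : ℝ) • (g * A s)) = (A s).det * topForm (F s) := fun s hs => by
    rw [← hAF s hs, topForm_transpose_mul_mul]
  have hTsq : ∀ s ∈ Set.Icc (-1 : ℝ) 1,
      topForm (-(2 : ℝ) • (g * A s)) ^ 2 = c * ((-2) ^ (4 * n) * (g.det * (A s).det)) := by
    intro s hs
    have hd : (-(2 : ℝ) • (g * A s)).det = (-2) ^ (4 * n) * (g.det * (A s).det) := by
      rw [Matrix.det_smul, Matrix.det_mul, Fintype.card_fin]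
    rw [hsq, hd]
    · rw [Matrix.transpose_smul, Matrix.transpose_mul, hg, hskew, smul_neg]
    · rw [hd]
      exact mul_ne_zero (pow_ne_zero _ (by norm_num)) (mul_ne_zero hgd (hAd s hs))
  have hTne : ∀ s ∈ Set.Icc (-1 : ℝ) 1, topForm (-(2 : ℝ) • (g * A s)) ≠ 0 := fun s hs h => by
    have e := hTsq s hs
    rw [h, zero_pow two_ne_zero] at e
    have h2 : (-2 : ℝ) ^ (4 * n) ≠ 0 := pow_ne_zero _ (by norm_num)
    exact mul_ne_zero hc (mul_ne_zero h2 (mul_ne_zero hgd (hAd s hs))) e.symm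
  have m1 : (1 : ℝ) ∈ Set.Icc (-1 : ℝ) 1 := by norm_num
  have m2 : (-1 : ℝ) ∈ Set.Icc (-1 : ℝ) 1 := by norm_num
  have a1 : A 1 = I + J := by simp [hA]
  have a2 : A (-1) = I - J := by simp [hA, sub_eq_add_neg]
  have f1 : -(2 : ℝ) • (((I + J)⁻¹)ᵀ * g) = F 1 := by rw [← a1]
  have f2 : -(2 : ℝ) • (((I - J)⁻¹)ᵀ * g) = F (-1) := by rw [← a2]
  rw [f1, f2, ← a1, ← a2]
  have hAc : Continuous A := continuous_const.add (continuous_id.smul continuous_const)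
  -- `s ↦ topForm (F s)` has constant sign on `[-1, 1]`
  have hsign : 0 < topForm (F 1) * topForm (F (-1)) := by
    set f : ℝ → ℝ := fun s => topForm (-(2 : ℝ) • (g * A s)) * (A s).det with hf
    have hc1 : Continuous fun s => g * A s := continuous_const.matrix_mul hAc
    have hc2 : Continuous fun s => -(2 : ℝ) • (g * A s) := hc1.const_smul (-(2 : ℝ))
    have hc3 : Continuous fun s => topForm (-(2 : ℝ) • (g * A s)) := continuous_topForm hc2
    have hc4 : Continuous fun s => (A s).det := hAc.matrix_det
    have hfc : Continuous f := hc3.mul hc4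
    have hfne : ∀ s ∈ Set.Icc (-1 : ℝ) 1, f s ≠ 0 := fun s hs => mul_ne_zero (hTne s hs) (hAd s hs)
    have hfpos : 0 < f 1 * f (-1) :=
      mul_pos_of_continuous hfc hfne
    have e : f 1 * f (-1)
        = topForm (F 1) * topForm (F (-1)) * ((A 1).det * (A (-1)).det) ^ 2 := by
      simp only [hf]
      rw [hTF 1 m1, hTF (-1) m2]
      ring
    rw [e] at hfpos
    exact pos_of_mul_pos_left hfpos (sq_nonneg _)
  have n1 : topForm (F 1) ≠ 0 := fun h => by simp [h] at hsign
  have n2 : topForm (F (-1)) ≠ 0 := fun h => by simp [h] at hsign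
  refine ⟨?_, ?_⟩
  · rw [div_eq_mul_inv]
    have : topForm (F 1) * (topForm (F (-1)))⁻¹
        = topForm (F 1) * topForm (F (-1)) * ((topForm (F (-1)))⁻¹) ^ 2 := by
      field_simp
    rw [this]
    positivity
  · have d1 := hAd 1 m1
    have d2 := hAd (-1) m2
    have s1 := hTsq 1 m1
    have s2 := hTsq (-1) m2
    rw [hTF 1 m1, mul_pow] at s1
    rw [hTF (-1) m2, mul_pow] at s2
    set k := c * ((-2) ^ (4 * n) * g.det)
    have s1' : (A 1).det * topForm (F 1) ^ 2 = k := by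
      refine mul_left_cancel₀ d1 ?_
      rw [← mul_assoc, ← sq, s1]
      ring
    have s2' : (A (-1)).det * topForm (F (-1)) ^ 2 = k := by
      refine mul_left_cancel₀ d2 ?_
      rw [← mul_assoc, ← sq, s2]
      ring
    rw [div_pow, div_eq_div_iff (pow_ne_zero 2 n2) d1, mul_comm, s1', ← s2']

end Ratio

end TopForm

/-! ### Components in a chart -/

section FiniteDimensional

variable {V : Type*} [AddCommGroup V] [Module ℝ V] [TopologicalSpace V] [IsTopologicalAddGroup V]
  [ContinuousSMul ℝ V] [T2Space V] [FiniteDimensional ℝ V]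

theorem isInvertible_of_det_ne_zero {A : V →L[ℝ] V} (h : LinearMap.det (A : V →ₗ[ℝ] V) ≠ 0) :
    A.IsInvertible :=
  ⟨A.toContinuousLinearEquivOfDetNeZero h, rfl⟩

theorem isInvertible_of_pos {B : V →L[ℝ] V →L[ℝ] ℝ} (h : ∀ v, v ≠ 0 → 0 < B v v) :
    B.IsInvertible := by
  have hinj : Function.Injective (LinearMap.toContinuousLinearMap.symm.toLinearMap ∘ₗ
      (B : V →ₗ[ℝ] V →L[ℝ] ℝ)) := by
    refine LinearMap.toContinuousLinearMap.symm.injective.comp ?_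
    rw [injective_iff_map_eq_zero]
    intro v hv
    by_contra h0
    have := h v h0
    have e : B v = 0 := hv
    rw [e] at this
    simp at this
  set L := (LinearMap.linearEquivOfInjective _ hinj Subspace.dual_finrank_eq.symm).trans
    LinearMap.toContinuousLinearMap
  have hL : ∀ v, L v = B v := fun v => by
    ext w
    rfl
  refine ⟨⟨L, ?_, ?_⟩, ?_⟩
  · have : ⇑L = B := funext hL
    change Continuous L
    rw [this]
    exact B.continuous
  · have : FiniteDimensional ℝ (V →L[ℝ] ℝ) :=
      Module.Finite.equiv (LinearMap.toContinuousLinearMap (𝕜 := ℝ) (E := V) (F' := ℝ))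
    exact LinearMap.continuous_of_finiteDimensional (L.symm : (V →L[ℝ] ℝ) →ₗ[ℝ] V)
  · ext v w
    exact congrArg (fun f => f w) (hL v)

end FiniteDimensional

section Manifold

variable {N : ℕ} {M : Type*} [TopologicalSpace M] [ChartedSpace (EuclideanSpace ℝ (Fin N)) M]

-- The tangent spaces do not unfold to the model space in instance search.
instance (x : M) : T2Space (TangentSpace (𝓡 N) x) :=
  inferInstanceAs (T2Space (EuclideanSpace ℝ (Fin N)))

instance (x : M) : FiniteDimensional ℝ (TangentSpace (𝓡 N) x) :=
  inferInstanceAs (FiniteDimensional ℝ (EuclideanSpace ℝ (Fin N)))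

theorem mdifferentiable_of_mem_charts {e : OpenPartialHomeomorph M (EuclideanSpace ℝ (Fin N))}
    (he : e ∈ charts N M) : e.MDifferentiable (𝓡 N) (𝓡 N) :=
  ⟨(contMDiffOn_of_mem_maximalAtlas he).mdifferentiableOn (by simp),
    (contMDiffOn_symm_of_mem_maximalAtlas he).mdifferentiableOn (by simp)⟩

/-- The basis of coordinate vectors of the chart `e`. -/
def frameBasis {e : OpenPartialHomeomorph M (EuclideanSpace ℝ (Fin N))} (he : e ∈ charts N M)
    {y : EuclideanSpace ℝ (Fin N)} (hy : y ∈ e.target) :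
    Module.Basis (Fin N) ℝ (TangentSpace (𝓡 N) (e.symm y)) :=
  (EuclideanSpace.basisFun (Fin N) ℝ).toBasis.map
    ((mdifferentiable_of_mem_charts he).symm.mfderiv hy).toLinearEquiv

theorem frameBasis_apply {e : OpenPartialHomeomorph M (EuclideanSpace ℝ (Fin N))}
    (he : e ∈ charts N M) {y : EuclideanSpace ℝ (Fin N)} (hy : y ∈ e.target) (i : Fin N) :
    frameBasis he hy i = frame e y i := by
  have : (EuclideanSpace.basisFun (Fin N) ℝ).toBasis i = EuclideanSpace.single i (1 : ℝ) := by
    rw [OrthonormalBasis.coe_toBasis, EuclideanSpace.basisFun_apply]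
  exact congrArg (mfderiv (𝓡 N) (𝓡 N) e.symm y) this

theorem frameBasis_repr {e : OpenPartialHomeomorph M (EuclideanSpace ℝ (Fin N))}
    (he : e ∈ charts N M) {y : EuclideanSpace ℝ (Fin N)} (hy : y ∈ e.target) (i : Fin N)
    (v : TangentSpace (𝓡 N) (e.symm y)) :
    (frameBasis he hy).repr v i = coframe e y i v := rfl

/-- The standard basis of the tangent space. -/
def stdBasis (x : M) : Module.Basis (Fin N) ℝ (TangentSpace (𝓡 N) x) :=
  (EuclideanSpace.basisFun (Fin N) ℝ).toBasis

theorem stdBasis_apply (x : M) (i : Fin N) :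
    stdBasis x i = (EuclideanSpace.single i (1 : ℝ) : EuclideanSpace ℝ (Fin N)) := by
  have : (EuclideanSpace.basisFun (Fin N) ℝ).toBasis i = EuclideanSpace.single i (1 : ℝ) := by
    rw [OrthonormalBasis.coe_toBasis, EuclideanSpace.basisFun_apply]
  exact this

/-- The matrix of an endomorphism in a basis of the tangent space. -/
def endMat {x : M} (b : Module.Basis (Fin N) ℝ (TangentSpace (𝓡 N) x))
    (A : TangentSpace (𝓡 N) x →L[ℝ] TangentSpace (𝓡 N) x) : Matrix (Fin N) (Fin N) ℝ :=
  LinearMap.toMatrix b b (A : TangentSpace (𝓡 N) x →ₗ[ℝ] TangentSpace (𝓡 N) x)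

theorem endComp_eq {e : OpenPartialHomeomorph M (EuclideanSpace ℝ (Fin N))}
    (he : e ∈ charts N M) {y : EuclideanSpace ℝ (Fin N)} (hy : y ∈ e.target) (A : EndField N M) :
    endComp e A y = endMat (frameBasis he hy) (A (e.symm y)) := by
  ext i j
  rw [endMat, LinearMap.toMatrix_apply, frameBasis_apply, frameBasis_repr]
  rfl

section EndMat

variable {x : M} (b : Module.Basis (Fin N) ℝ (TangentSpace (𝓡 N) x))
  (A B : TangentSpace (𝓡 N) x →L[ℝ] TangentSpace (𝓡 N) x)

theorem endMat_comp : endMat b (A ∘L B) = endMat b A * endMat b B :=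
  LinearMap.toMatrix_comp b b b _ _

theorem endMat_add : endMat b (A + B) = endMat b A + endMat b B :=
  map_add (LinearMap.toMatrix b b) _ _

theorem endMat_sub : endMat b (A - B) = endMat b A - endMat b B :=
  map_sub (LinearMap.toMatrix b b) _ _

theorem endMat_neg_id : endMat b (-ContinuousLinearMap.id ℝ _) = -1 := by
  have := map_neg (LinearMap.toMatrix b b) LinearMap.id
  rw [LinearMap.toMatrix_id] at this
  exact this

theorem det_endMat : (endMat b A).det = LinearMap.det (A : TangentSpace (𝓡 N) x →ₗ[ℝ] _) :=
  LinearMap.det_toMatrix b _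

theorem endMat_sq (h : ∀ v, A (A v) = -v) : endMat b A * endMat b A = -1 := by
  rw [← endMat_comp, ← endMat_neg_id b]
  congr 1
  ext v
  exact h v

end EndMat

namespace GKStructure

variable [IsManifold (𝓡 N) ∞ M] (S : GKStructure N M)

/-- The commutator `[I, J]` at a point. -/
def comm (x : M) : TangentSpace (𝓡 N) x →L[ℝ] TangentSpace (𝓡 N) x :=
  S.I x ∘L S.J x - S.J x ∘L S.I x

/-- Nondegeneracy of the bivector `σ` at a point, stated as invertibility of `[I, J]`. -/
def NondegAt (x : M) : Prop :=
  LinearMap.det (S.comm x : TangentSpace (𝓡 N) x →ₗ[ℝ] TangentSpace (𝓡 N) x) ≠ 0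

/-- As `g` is invertible, `σ = [I, J] g⁻¹` is nondegenerate precisely where `[I, J]` is invertible.
-/
theorem isNondegenerate_iff : S.IsNondegenerate ↔ ∀ x, S.NondegAt x := by
  have hinv : ∀ x, (S.g.inner x).IsInvertible := fun x => isInvertible_of_pos (S.g.pos x)
  constructor
  · intro h x hdet
    obtain ⟨v, hv0, hv⟩ : ∃ v, v ≠ 0 ∧ S.comm x v = 0 := by
      obtain ⟨v, hv, hv0⟩ := Submodule.exists_mem_ne_zero_of_ne_bot
        (LinearMap.bot_lt_ker_of_det_eq_zero hdet).ne'
      exact ⟨v, hv0, hv⟩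
    have e : S.sharp x (S.g.inner x v) = v := (hinv x).inverse_apply_self v
    have := h x (S.g.inner x v) fun β => by
      rw [poisson, e]
      change β (S.comm x v) = 0
      rw [hv, map_zero]
    have hp := S.g.pos x v hv0
    rw [this] at hp
    exact lt_irrefl _ hp
  · intro h x α hα
    have e : S.comm x (S.sharp x α) = 0 := by
      by_contra h0
      exact (S.g.pos x _ h0).ne' (hα (S.g.inner x (S.comm x (S.sharp x α))))
    have e2 : S.sharp x α = 0 := by
      have := (isInvertible_of_det_ne_zero (h x)).injective (e.trans (map_zero _).symm)
      exact this
    have e3 : S.g.inner x (S.sharp x α) = α := (hinv x).self_apply_inverse α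
    rw [← e3, e2, map_zero]

/-- The matrix of the metric in a basis of the tangent space. -/
def gramMat {x : M} (b : Module.Basis (Fin N) ℝ (TangentSpace (𝓡 N) x)) :
    Matrix (Fin N) (Fin N) ℝ :=
  LinearMap.BilinForm.toMatrix b (S.g.inner x).toLinearMap₁₂

theorem metricComp_eq {e : OpenPartialHomeomorph M (EuclideanSpace ℝ (Fin N))}
    (he : e ∈ charts N M) {y : EuclideanSpace ℝ (Fin N)} (hy : y ∈ e.target) :
    metricComp e S.g y = S.gramMat (frameBasis he hy) := by
  ext i j
  rw [gramMat, LinearMap.BilinForm.toMatrix_apply, frameBasis_apply, frameBasis_apply]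
  rfl

section GramMat

variable {x : M} (b : Module.Basis (Fin N) ℝ (TangentSpace (𝓡 N) x))

theorem gramMat_symm : (S.gramMat b)ᵀ = S.gramMat b := by
  ext i j
  rw [Matrix.transpose_apply, gramMat, LinearMap.BilinForm.toMatrix_apply,
    LinearMap.BilinForm.toMatrix_apply]
  exact S.g.symm x _ _

theorem gramMat_pos (v : Fin N → ℝ) (hv : v ≠ 0) : 0 < v ⬝ᵥ S.gramMat b *ᵥ v := by
  have e := LinearMap.BilinForm.toMatrix_apply b (S.g.inner x).toLinearMap₁₂
  set w := b.equivFun.symm v with hw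
  have hw0 : w ≠ 0 := fun h => hv (b.equivFun.symm.map_eq_zero_iff.mp h)
  have h := S.g.pos x w hw0
  have e : S.g.inner x w w = v ⬝ᵥ S.gramMat b *ᵥ v := by
    have := LinearMap.BilinForm.apply_eq_dotProduct_toMatrix_mulVec b
      (S.g.inner x).toLinearMap₁₂ w w
    have hr : ⇑(b.repr w) = v := by
      rw [← Module.Basis.equivFun_apply, hw, LinearEquiv.apply_symm_apply]
    rw [hr] at this
    exact this
  rwa [e] at h

theorem gramMat_det_ne_zero : (S.gramMat b).det ≠ 0 := fun h => by
  obtain ⟨v, hv, hv0⟩ := Matrix.exists_mulVec_eq_zero_iff.mpr h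
  have := S.gramMat_pos b v hv
  rw [hv0, dotProduct_zero] at this
  exact this.ne rfl

theorem gramMat_comp (A : TangentSpace (𝓡 N) x →L[ℝ] TangentSpace (𝓡 N) x)
    (h : ∀ v w, S.g.inner x (A v) (A w) = S.g.inner x v w) :
    (endMat b A)ᵀ * S.gramMat b * endMat b A = S.gramMat b := by
  rw [gramMat, endMat, ← LinearMap.BilinForm.toMatrix_comp b b]
  congr 1
  ext v w
  exact h v w

theorem endMat_comm : endMat b (S.I x) * endMat b (S.J x) - endMat b (S.J x) * endMat b (S.I x)
    = endMat b (S.comm x) := by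
  rw [comm, endMat_sub, endMat_comp, endMat_comp]

end GramMat

theorem localHermI {e : OpenPartialHomeomorph M (EuclideanSpace ℝ (Fin N))}
    (he : e ∈ charts N M) (hg : SmoothMatOn (metricComp e S.g) e.target) :
    LocalHerm (metricComp e S.g) (endComp e S.I) e.target where
  isOpen := e.open_target
  smooth_g := hg
  smooth_I := S.complexI.smooth e he
  symm y hy := by rw [S.metricComp_eq he hy, gramMat_symm]
  det_ne y hy := by rw [S.metricComp_eq he hy]; exact S.gramMat_det_ne_zero _
  sq y hy := by rw [endComp_eq he hy]; exact endMat_sq _ _ (S.complexI.sq _)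
  herm y hy := by
    rw [endComp_eq he hy, S.metricComp_eq he hy]; exact S.gramMat_comp _ _ (S.hermitianI _)
  nij := S.complexI.integrable e he

theorem localHermJ {e : OpenPartialHomeomorph M (EuclideanSpace ℝ (Fin N))}
    (he : e ∈ charts N M) (hg : SmoothMatOn (metricComp e S.g) e.target) :
    LocalHerm (metricComp e S.g) (endComp e S.J) e.target where
  isOpen := e.open_target
  smooth_g := hg
  smooth_I := S.complexJ.smooth e he
  symm y hy := by rw [S.metricComp_eq he hy, gramMat_symm]
  det_ne y hy := by rw [S.metricComp_eq he hy]; exact S.gramMat_det_ne_zero _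
  sq y hy := by rw [endComp_eq he hy]; exact endMat_sq _ _ (S.complexJ.sq _)
  herm y hy := by
    rw [endComp_eq he hy, S.metricComp_eq he hy]; exact S.gramMat_comp _ _ (S.hermitianJ _)
  nij := S.complexJ.integrable e he

theorem det_comm_ne_zero_iff {e : OpenPartialHomeomorph M (EuclideanSpace ℝ (Fin N))}
    (he : e ∈ charts N M) {y : EuclideanSpace ℝ (Fin N)} (hy : y ∈ e.target) :
    (endComp e S.I y * endComp e S.J y - endComp e S.J y * endComp e S.I y).det ≠ 0
      ↔ S.NondegAt (e.symm y) := by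
  rw [endComp_eq he hy, endComp_eq he hy, endMat_comm, det_endMat]
  rfl

theorem localGK {e : OpenPartialHomeomorph M (EuclideanSpace ℝ (Fin N))}
    (he : e ∈ charts N M) (hg : SmoothMatOn (metricComp e S.g) e.target)
    {U : Set (EuclideanSpace ℝ (Fin N))} (hU : IsOpen U) (hUe : U ⊆ e.target)
    (hnd : ∀ y ∈ U, S.NondegAt (e.symm y)) :
    LocalGK (metricComp e S.g) (endComp e S.I) (endComp e S.J) U where
  hermI := (S.localHermI he hg).mono hU hUe
  hermJ := (S.localHermJ he hg).mono hU hUe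
  torsion y hy := S.torsion_eq e he y (hUe hy)
  nondeg y hy := (S.det_comm_ne_zero_iff he (hUe hy)).mpr (hnd y hy)

end GKStructure

end Manifold

section Potential

variable {n : ℕ} {M : Type*} [TopologicalSpace M]
  [ChartedSpace (EuclideanSpace ℝ (Fin (4 * n))) M] [IsManifold (𝓡 (4 * n)) ∞ M]

namespace GKStructure

variable (S : GKStructure (4 * n) M) {x : M}

/-- The volume ratio, in terms of the matrices of `g`, `I`, `J` in the standard basis. -/
theorem volumeRatio_eq (h : S.NondegAt x) : volumeRatio S x =
    topForm (-(2 : ℝ) • (((endMat (stdBasis x) (S.I x) + endMat (stdBasis x) (S.J x))⁻¹)ᵀ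
      * S.gramMat (stdBasis x)))
    / topForm (-(2 : ℝ) • (((endMat (stdBasis x) (S.I x) - endMat (stdBasis x) (S.J x))⁻¹)ᵀ
      * S.gramMat (stdBasis x))) := by
  set b := stdBasis (N := 4 * n) x
  have hI := endMat_sq b _ (S.complexI.sq x)
  have hJ := endMat_sq b _ (S.complexJ.sq x)
  have hQ : (endMat b (S.I x) * endMat b (S.J x) - endMat b (S.J x) * endMat b (S.I x)).det ≠ 0 := by
    rw [endMat_comm, det_endMat]
    exact h
  have key : ∀ A : TangentSpace (𝓡 (4 * n)) x →L[ℝ] TangentSpace (𝓡 (4 * n)) x,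
      (endMat b A).det ≠ 0 →
      topPower (fun u v => -2 * S.g.inner x (A.inverse u) v)
        (fun i => (EuclideanSpace.single i (1 : ℝ) : EuclideanSpace ℝ (Fin (4 * n))))
      = topForm (-(2 : ℝ) • (((endMat b A)⁻¹)ᵀ * S.gramMat b)) := by
    intro A hA
    have hinv : endMat b A.inverse = (endMat b A)⁻¹ := by
      refine (Matrix.inv_eq_right_inv ?_).symm
      rw [← endMat_comp]
      have hAi : A.IsInvertible := isInvertible_of_det_ne_zero (by rwa [← det_endMat b])
      have : A ∘L A.inverse = ContinuousLinearMap.id ℝ _ := by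
        ext1 v
        exact hAi.self_apply_inverse v
      rw [this]
      exact LinearMap.toMatrix_id b
    have hm : (endMat b A.inverse)ᵀ * S.gramMat b
        = Matrix.of fun i j => S.g.inner x (A.inverse (b i)) (b j) := by
      have e := LinearMap.BilinForm.toMatrix_comp b b (S.g.inner x).toLinearMap₁₂
        (A.inverse : TangentSpace (𝓡 (4 * n)) x →ₗ[ℝ] TangentSpace (𝓡 (4 * n)) x) LinearMap.id
      rw [LinearMap.toMatrix_id, Matrix.mul_one] at e
      refine e.symm.trans ?_
      ext i j
      rw [LinearMap.BilinForm.toMatrix_apply]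
      rfl
    have hs : (fun i => (EuclideanSpace.single i (1 : ℝ) : EuclideanSpace ℝ (Fin (4 * n)))) = b :=
      funext fun i => (stdBasis_apply x i).symm
    rw [← hinv, hm]
    refine Eq.trans (congrArg (topPower fun u v => -2 * S.g.inner x (A.inverse u) v) hs) ?_
    rfl
  rw [volumeRatio]
  unfold Fplus Fminus
  rw [key, key, endMat_add, endMat_sub]
  · rw [endMat_sub]; exact det_sub_ne_zero hI hJ hQ
  · rw [endMat_add]; exact det_add_ne_zero hI hJ hQ

/-- The square of the volume ratio is expressed by determinants of endomorphisms, which do not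
depend on a basis. This leads from the standard basis of the tangent space to the coordinate vectors
of an arbitrary chart. -/
theorem volumeRatio_pos_and_sq (h : S.NondegAt x) : 0 < volumeRatio S x ∧
    volumeRatio S x ^ 2
      = LinearMap.det ((S.I x - S.J x : _ →L[ℝ] _) : TangentSpace (𝓡 (4 * n)) x →ₗ[ℝ] _)
        / LinearMap.det ((S.I x + S.J x : _ →L[ℝ] _) : TangentSpace (𝓡 (4 * n)) x →ₗ[ℝ] _) := by
  have hQ : (endMat (stdBasis x) (S.I x) * endMat (stdBasis x) (S.J x)
      - endMat (stdBasis x) (S.J x) * endMat (stdBasis x) (S.I x)).det ≠ 0 := by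
    rw [endMat_comm, det_endMat]
    exact h
  have r := topForm_ratio (S.gramMat_pos (stdBasis x)) (S.gramMat_symm _)
    (endMat_sq _ _ (S.complexI.sq x)) (endMat_sq _ _ (S.complexJ.sq x))
    (S.gramMat_comp _ _ (S.hermitianI x)) (S.gramMat_comp _ _ (S.hermitianJ x)) hQ
  rw [← S.volumeRatio_eq h] at r
  refine ⟨r.1, ?_⟩
  rw [r.2, ← det_endMat (stdBasis x), ← det_endMat (stdBasis x), endMat_add, endMat_sub]

/-- In every chart `Φ = ½ log (det (I - J) / det (I + J))`. -/
theorem ricciPotential_eq_coordPotential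
    {e : OpenPartialHomeomorph M (EuclideanSpace ℝ (Fin (4 * n)))} (he : e ∈ charts (4 * n) M)
    {y : EuclideanSpace ℝ (Fin (4 * n))} (hy : y ∈ e.target) (h : S.NondegAt (e.symm y)) :
    ricciPotential S (e.symm y) = coordPotential (endComp e S.I) (endComp e S.J) y := by
  obtain ⟨h1, h2⟩ := S.volumeRatio_pos_and_sq h
  set b := frameBasis he hy
  have hI := endMat_sq b _ (S.complexI.sq (e.symm y))
  have hJ := endMat_sq b _ (S.complexJ.sq (e.symm y))
  have hQ : (endMat b (S.I (e.symm y)) * endMat b (S.J (e.symm y))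
      - endMat b (S.J (e.symm y)) * endMat b (S.I (e.symm y))).det ≠ 0 := by
    rw [endMat_comm, det_endMat]
    exact h
  have e1 : Real.log (volumeRatio S (e.symm y) ^ 2) = 2 * Real.log (volumeRatio S (e.symm y)) := by
    rw [Real.log_pow]
    norm_num
  rw [ricciPotential, coordPotential, endComp_eq he hy, endComp_eq he hy,
    ← Real.log_div (det_sub_ne_zero hI hJ hQ) (det_add_ne_zero hI hJ hQ), ← endMat_add,
    ← endMat_sub, det_endMat, det_endMat, ← h2, e1]
  ring

end GKStructure

end Potential

/-! ### Evolution of the bivector and of the potential -/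

section TimeSet

theorem zero_mem_timeSet {T : EReal} (hT : 0 < T) : (0 : ℝ) ∈ timeSet T :=
  ⟨le_rfl, by exact_mod_cast hT⟩

theorem timeSet_ordConnected (T : EReal) : (timeSet T).OrdConnected :=
  ⟨fun _ ha _ hb _ hc => ⟨ha.1.trans hc.1, (EReal.coe_le_coe_iff.mpr hc.2).trans_lt hb.2⟩⟩

theorem uniqueDiffOn_timeSet {T : EReal} (hT : 0 < T) : UniqueDiffOn ℝ (timeSet T) := by
  refine uniqueDiffOn_convex (timeSet_ordConnected T).convex ?_
  obtain ⟨δ, hδ, hδT⟩ := EReal.lt_iff_exists_real_btwn.mp hT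
  have hδ' : 0 < δ := by exact_mod_cast hδ
  have hsub : Set.Ioo 0 δ ⊆ timeSet T := fun t ht =>
    ⟨ht.1.le, (EReal.coe_lt_coe_iff.mpr ht.2).trans hδT⟩
  exact ⟨δ / 2, interior_mono hsub (by rw [interior_Ioo]; constructor <;> linarith)⟩

end TimeSet

section MatDeriv

variable {N : ℕ} {A B : ℝ → Matrix (Fin N) (Fin N) ℝ} {A' B' : Matrix (Fin N) (Fin N) ℝ}
  {s : Set ℝ} {t : ℝ}

theorem hasDerivWithinAt_matrix_mul (hA : ∀ i j, HasDerivWithinAt (fun r => A r i j) (A' i j) s t)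
    (hB : ∀ i j, HasDerivWithinAt (fun r => B r i j) (B' i j) s t) (i j : Fin N) :
    HasDerivWithinAt (fun r => (A r * B r) i j) ((A' * B t + A t * B') i j) s t := by
  simp only [Matrix.mul_apply, Matrix.add_apply, ← Finset.sum_add_distrib]
  exact HasDerivWithinAt.fun_sum fun k _ => (hA i k).fun_mul (hB k j)

theorem hasDerivWithinAt_matrix_const (C : Matrix (Fin N) (Fin N) ℝ) (i j : Fin N) :
    HasDerivWithinAt (fun _ : ℝ => C i j) ((0 : Matrix (Fin N) (Fin N) ℝ) i j) s t :=
  hasDerivWithinAt_const _ _ _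

theorem hasDerivWithinAt_det_of_zero
    (hA : ∀ i j, HasDerivWithinAt (fun r => A r i j) 0 s t) :
    HasDerivWithinAt (fun r => (A r).det) 0 s t := by
  have hd : DifferentiableAt ℝ (fun A : Fin N → Fin N → ℝ => (Matrix.of A).det)
      (fun i j => A t i j) := contDiff_det_of.differentiable (by simp) _
  have h1 : HasDerivWithinAt (fun r => (fun i j => A r i j : Fin N → Fin N → ℝ)) 0 s t :=
    hasDerivWithinAt_pi.mpr fun i => hasDerivWithinAt_pi.mpr fun j => hA i j
  have h2 := hd.hasFDerivAt.comp_hasDerivWithinAt t h1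
  rw [map_zero] at h2
  exact h2

end MatDeriv

theorem chernLaplacianCoord_congr {N : ℕ} {g I : MatField N} {f f' : EuclideanSpace ℝ (Fin N) → ℝ}
    {U : Set (EuclideanSpace ℝ (Fin N))} (hU : IsOpen U) (h : ∀ y ∈ U, f y = f' y)
    {y : EuclideanSpace ℝ (Fin N)} (hy : y ∈ U) :
    chernLaplacianCoord g I f y = chernLaplacianCoord g I f' y := by
  have e : ∀ j, ∀ z ∈ U, dcFun I f j z = dcFun I f' j z := fun j z hz => by
    simp only [dcFun, pd_congr hU h _ hz]
  have e2 : extDerivOne (dcFun I f) y = extDerivOne (dcFun I f') y := by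
    ext i j
    simp only [extDerivOne, Matrix.of_apply]
    rw [pd_congr hU (e j) i hy, pd_congr hU (e i) j hy]
  rw [chernLaplacianCoord, e2]
  rfl

namespace IsGKRFSolution

section General

variable {N : ℕ} {M : Type*} [TopologicalSpace M] [ChartedSpace (EuclideanSpace ℝ (Fin N)) M]
  [IsManifold (𝓡 N) ∞ M] {T : EReal} {S : ℝ → GKStructure N M}
  {e : OpenPartialHomeomorph M (EuclideanSpace ℝ (Fin N))} {t : ℝ} {y : EuclideanSpace ℝ (Fin N)}

theorem smooth_metricComp (hS : IsGKRFSolution T S) (he : e ∈ charts N M) (ht : t ∈ timeSet T) :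
    SmoothMatOn (metricComp e (S t).g) e.target := fun i j =>
  (hS.smooth_g e he i j).comp (contDiff_const.prodMk contDiff_id).contDiffOn fun _ hy => ⟨ht, hy⟩

theorem smooth_metricComp_time (hS : IsGKRFSolution T S) (he : e ∈ charts N M)
    (hy : y ∈ e.target) : SmoothMatOn (fun s => metricComp e (S s).g y) (timeSet T) := fun i j =>
  (hS.smooth_g e he i j).comp (contDiff_id.prodMk contDiff_const).contDiffOn fun _ ht => ⟨ht, hy⟩

theorem smooth_endComp_time (hS : IsGKRFSolution T S) (he : e ∈ charts N M)
    (hy : y ∈ e.target) : SmoothMatOn (fun s => endComp e (S s).J y) (timeSet T) := fun i j =>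
  (hS.smooth_J e he i j).comp (contDiff_id.prodMk contDiff_const).contDiffOn fun _ ht => ⟨ht, hy⟩

theorem I_eq (hS : IsGKRFSolution T S) {s : ℝ} (hs : s ∈ timeSet T) (ht : t ∈ timeSet T) :
    (S s).I = (S t).I := (hS.I_fixed s hs).trans (hS.I_fixed t ht).symm

/-- The metric evolves by the Bismut-Ricci form: its derivative `V` satisfies `Iᵀ V = ∂_t ω_I`, as
`I` does not depend on time. -/
theorem exists_deriv_metric (hS : IsGKRFSolution T S) (he : e ∈ charts N M) (ht : t ∈ timeSet T)
    (hy : y ∈ e.target) : ∃ V : Matrix (Fin N) (Fin N) ℝ,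
      (endComp e (S t).I y)ᵀ * V = -(2 : ℝ) • oneOnePart (endComp e (S t).I y)
        (bismutRicci (metricComp e (S t).g) (endComp e (S t).I) y) ∧
      ∀ i j, HasDerivWithinAt (fun s => metricComp e (S s).g y i j) (V i j) (timeSet T) t := by
  set I := endComp e (S t).I y with hI
  set W := -(2 : ℝ) • oneOnePart I (bismutRicci (metricComp e (S t).g) (endComp e (S t).I) y)
  have hI2 : Iᵀ * Iᵀ = -1 := by
    rw [← Matrix.transpose_mul, hI, endComp_eq he hy, endMat_sq _ _ ((S t).complexI.sq _),
      Matrix.transpose_neg, Matrix.transpose_one]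
  refine ⟨-Iᵀ * W, ?_, fun i j => ?_⟩
  · rw [← Matrix.mul_assoc, Matrix.mul_neg, hI2, neg_neg, Matrix.one_mul]
  · have h1 : ∀ i j, HasDerivWithinAt (fun s => (Iᵀ * metricComp e (S s).g y) i j) (W i j)
        (timeSet T) t := fun i j => by
      refine (hS.flow_omega e he t ht y hy i j).congr_of_mem (fun s hs => ?_) ht
      simp only [kahlerForm]
      rw [hS.I_eq hs ht]
    have h2 := hasDerivWithinAt_matrix_mul (hasDerivWithinAt_matrix_const (-Iᵀ)) h1 i j
    rw [Matrix.zero_mul, zero_add] at h2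
    refine h2.congr_of_mem (fun s _ => ?_) ht
    rw [← Matrix.mul_assoc, Matrix.neg_mul, hI2, neg_neg, Matrix.one_mul]

/-- Nondegeneracy is an open condition. -/
theorem exists_localGK (hS : IsGKRFSolution T S) (he : e ∈ charts N M) (ht : t ∈ timeSet T)
    (hy : y ∈ e.target) (hnd : (S t).NondegAt (e.symm y)) : ∃ U, y ∈ U ∧
      LocalGK (metricComp e (S t).g) (endComp e (S t).I) (endComp e (S t).J) U := by
  have hg := hS.smooth_metricComp he ht
  have hI := (S t).localHermI he hg
  have hJ := (S t).localHermJ he hg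
  have hc := (((hI.smooth_I.mul hJ.smooth_I).sub (hJ.smooth_I.mul hI.smooth_I)).det).continuousOn
  have hU := hc.isOpen_inter_preimage e.open_target (isOpen_compl_singleton (x := (0 : ℝ)))
  exact ⟨_, Set.mem_inter hy (((S t).det_comm_ne_zero_iff he hy).mpr hnd),
    (S t).localGK he hg hU Set.inter_subset_left
      fun z hz => ((S t).det_comm_ne_zero_iff he hz.1).mp hz.2⟩

/-- The bivector `[I, J] g⁻¹` in coordinates, at the time `s`. -/
def bivector (S : ℝ → GKStructure N M) (e : OpenPartialHomeomorph M (EuclideanSpace ℝ (Fin N)))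
    (y : EuclideanSpace ℝ (Fin N)) (s : ℝ) : Matrix (Fin N) (Fin N) ℝ :=
  (endComp e (S s).I y * endComp e (S s).J y - endComp e (S s).J y * endComp e (S s).I y)
    * (metricComp e (S s).g y)⁻¹

theorem smooth_bivector (hS : IsGKRFSolution T S) (he : e ∈ charts N M)
    (hy : y ∈ e.target) : SmoothMatOn (bivector S e y) (timeSet T) := by
  have hg := hS.smooth_metricComp_time he hy
  have hJ := hS.smooth_endComp_time he hy
  have hI : SmoothMatOn (fun s => endComp e (S s).I y) (timeSet T) := fun i j =>
    (contDiffOn_const (c := endComp e (S 0).I y i j)).congr fun s hs => by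
      change endComp e (S s).I y i j = endComp e (S 0).I y i j
      rw [hS.I_fixed s hs]
  refine ((hI.mul hJ).sub (hJ.mul hI)).mul (hg.inv fun s _ => ?_)
  rw [(S s).metricComp_eq he hy]
  exact (S s).gramMat_det_ne_zero _

theorem det_bivector_ne_zero_iff (he : e ∈ charts N M) (hy : y ∈ e.target) (s : ℝ) :
    (bivector S e y s).det ≠ 0 ↔ (S s).NondegAt (e.symm y) := by
  have hg : (metricComp e (S s).g y).det ≠ 0 := by
    rw [(S s).metricComp_eq he hy]
    exact (S s).gramMat_det_ne_zero _
  have hg' : ((metricComp e (S s).g y)⁻¹).det ≠ 0 := by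
    rw [Matrix.det_nonsing_inv, Ring.inverse_eq_inv']
    exact inv_ne_zero hg
  rw [← (S s).det_comm_ne_zero_iff he hy, bivector, Matrix.det_mul, mul_ne_zero_iff]
  exact ⟨fun h => h.1, fun h => ⟨h, hg'⟩⟩

/-- The bivector `σ` does not move where it is nondegenerate: differentiation of `σ g = [I, J]`
gives `(∂_t σ) g = [I, ∂_t J] - σ ∂_t g`, which vanishes by `LocalGK.symplectic_variation`. -/
theorem hasDerivWithinAt_bivector (hS : IsGKRFSolution T S) (hT : 0 < T) (he : e ∈ charts N M)
    (ht : t ∈ timeSet T) (hy : y ∈ e.target) (hnd : (S t).NondegAt (e.symm y)) (i j : Fin N) :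
    HasDerivWithinAt (fun s => bivector S e y s i j) 0 (timeSet T) t := by
  obtain ⟨U, hyU, hU⟩ := hS.exists_localGK he ht hy hnd
  obtain ⟨V, hV, hV'⟩ := hS.exists_deriv_metric he ht hy
  have hVe := hU.symplectic_variation hyU hV
  have hJ := hS.flow_J e he t ht y hy
  have hgd : ∀ s, (metricComp e (S s).g y).det ≠ 0 := fun s => by
    rw [(S s).metricComp_eq he hy]
    exact (S s).gramMat_det_ne_zero _
  set L := lieDerivEnd (leeDiff (metricComp e (S t).g) (endComp e (S t).I) (endComp e (S t).J))
    (endComp e (S t).J) y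
  set I := endComp e (S t).I y
  set Q := fun s => I * endComp e (S s).J y - endComp e (S s).J y * I with hQ
  set g := fun s => metricComp e (S s).g y with hg
  have hQ' : ∀ i j, HasDerivWithinAt (fun s => Q s i j) ((I * L - L * I) i j) (timeSet T) t := by
    intro i j
    have h1 := hasDerivWithinAt_matrix_mul (hasDerivWithinAt_matrix_const I) hJ i j
    have h2 := hasDerivWithinAt_matrix_mul hJ (hasDerivWithinAt_matrix_const I) i j
    rw [Matrix.zero_mul, zero_add] at h1
    rw [Matrix.mul_zero, add_zero] at h2
    exact h1.fun_sub h2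
  set P : Matrix (Fin N) (Fin N) ℝ :=
    Matrix.of fun i j => derivWithin (fun s => bivector S e y s i j) (timeSet T) t with hP
  have hP' : ∀ i j, HasDerivWithinAt (fun s => bivector S e y s i j) (P i j) (timeSet T) t :=
    fun i j => (((hS.smooth_bivector he hy i j).differentiableOn (by simp)) t
      ht).hasDerivWithinAt
  have hbg : ∀ s ∈ timeSet T, bivector S e y s * g s = Q s := fun s hs => by
    rw [bivector, Matrix.mul_assoc, Matrix.nonsing_inv_mul _ (isUnit_iff_ne_zero.mpr (hgd s)),
      Matrix.mul_one, hS.I_eq hs ht]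
  have key : P * g t + bivector S e y t * V = I * L - L * I := by
    ext i j
    have h1 := hasDerivWithinAt_matrix_mul hP' hV' i j
    have h2 : HasDerivWithinAt (fun s => (bivector S e y s * g s) i j) ((I * L - L * I) i j)
        (timeSet T) t := (hQ' i j).congr_of_mem (fun s hs => by rw [hbg s hs]) ht
    exact (uniqueDiffOn_timeSet hT t ht).eq_deriv _ h1 h2
  have e1 : bivector S e y t * V = I * L - L * I := by
    rw [hVe, ← Matrix.mul_assoc, ← Matrix.mul_assoc, hbg t ht, hU.mul_inv hyU, Matrix.one_mul]
  rw [e1, add_eq_right] at key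
  have e2 : P = 0 := by
    rw [← Matrix.mul_nonsing_inv_cancel_right (g t) P (isUnit_iff_ne_zero.mpr (hgd t)), key,
      Matrix.zero_mul]
  have := hP' i j
  rwa [e2] at this

/-- Nondegeneracy at a point is preserved: the square of the determinant of the bivector has
vanishing derivative, where the determinant is not zero because the bivector does not move, and
where it is zero because of the square. -/
theorem nondegAt (hS : IsGKRFSolution T S) (hT : 0 < T) (he : e ∈ charts N M)
    (ht : t ∈ timeSet T) (hy : y ∈ e.target) (h0 : (S 0).NondegAt (e.symm y)) :
    (S t).NondegAt (e.symm y) := by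
  set f : ℝ → ℝ := fun s => (bivector S e y s).det with hf
  have hfs : ContDiffOn ℝ ∞ f (timeSet T) := (hS.smooth_bivector he hy).det
  have hder : ∀ s ∈ timeSet T, HasDerivWithinAt (fun s => f s ^ 2) 0 (timeSet T) s := by
    intro s hs
    by_cases h : f s = 0
    · have h1 := ((hfs.differentiableOn (by simp)) s hs).hasDerivWithinAt.fun_pow 2
      simpa [h] using h1
    · have h1 : HasDerivWithinAt f 0 (timeSet T) s := hasDerivWithinAt_det_of_zero
        (hS.hasDerivWithinAt_bivector hT he hs hy ((det_bivector_ne_zero_iff he hy s).mp h))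
      simpa using h1.fun_pow 2
  have h0T := zero_mem_timeSet hT
  have hsub : Set.Icc 0 t ⊆ timeSet T := (timeSet_ordConnected T).out h0T ht
  have hconst : f t ^ 2 = f 0 ^ 2 := by
    refine constant_of_derivWithin_zero (f := fun s => f s ^ 2) (a := 0) (b := t)
      (fun s hs => ((hder s (hsub hs)).mono hsub).differentiableWithinAt) (fun s hs => ?_) t
      ⟨ht.1, le_rfl⟩
    have hs' : s ∈ Set.Icc 0 t := ⟨hs.1, hs.2.le⟩
    exact ((hder s (hsub hs')).mono hsub).derivWithin
      (uniqueDiffOn_Icc (hs.1.trans_lt hs.2) s hs')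
  have hf0 : f 0 ≠ 0 := (det_bivector_ne_zero_iff he hy 0).mpr h0
  refine (det_bivector_ne_zero_iff he hy t).mp fun h => ?_
  have h' : f t = 0 := h
  rw [h', zero_pow two_ne_zero] at hconst
  exact hf0 (pow_eq_zero_iff two_ne_zero |>.mp hconst.symm)

theorem isNondegenerate (hS : IsGKRFSolution T S) (hT : 0 < T) (h0 : (S 0).IsNondegenerate)
    (ht : t ∈ timeSet T) : (S t).IsNondegenerate := by
  rw [GKStructure.isNondegenerate_iff] at h0 ⊢
  intro x
  have hx := mem_chart_target (EuclideanSpace ℝ (Fin N)) x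
  have hy : (chartAt (EuclideanSpace ℝ (Fin N)) x).symm (chartAt (EuclideanSpace ℝ (Fin N)) x x)
      = x := (chartAt _ x).left_inv (mem_chart_source _ x)
  have h := hS.nondegAt hT (IsManifold.chart_mem_maximalAtlas x) ht hx (h0 _)
  rwa [hy] at h

end General

section Potential

variable {n : ℕ} {M : Type*} [TopologicalSpace M]
  [ChartedSpace (EuclideanSpace ℝ (Fin (4 * n))) M] [IsManifold (𝓡 (4 * n)) ∞ M] {T : EReal}
  {S : ℝ → GKStructure (4 * n) M} {t : ℝ}
  {e : OpenPartialHomeomorph M (EuclideanSpace ℝ (Fin (4 * n)))}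

theorem smooth_ricciPotential (hS : IsGKRFSolution T S)
    (h : ∀ t ∈ timeSet T, ∀ x, (S t).NondegAt x) (he : e ∈ charts (4 * n) M) :
    ContDiffOn ℝ ∞ (fun p : ℝ × EuclideanSpace ℝ (Fin (4 * n)) =>
      ricciPotential (S p.1) (e.symm p.2)) (timeSet T ×ˢ e.target) := by
  have hJ : SmoothMatOn (fun p : ℝ × EuclideanSpace ℝ (Fin (4 * n)) => endComp e (S p.1).J p.2)
      (timeSet T ×ˢ e.target) := hS.smooth_J e he
  have hI : SmoothMatOn (fun p : ℝ × EuclideanSpace ℝ (Fin (4 * n)) => endComp e (S p.1).I p.2)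
      (timeSet T ×ˢ e.target) := fun i j =>
    (((S 0).complexI.smooth e he i j).comp contDiff_snd.contDiffOn fun p hp => hp.2).congr
      fun p hp => by
        change endComp e (S p.1).I p.2 i j = endComp e (S 0).I p.2 i j
        rw [hS.I_fixed p.1 hp.1]
  have sqI : ∀ p ∈ timeSet T ×ˢ e.target, endComp e (S p.1).I p.2 * endComp e (S p.1).I p.2 = -1 :=
    fun p hp => by rw [endComp_eq he hp.2]; exact endMat_sq _ _ ((S p.1).complexI.sq _)
  have sqJ : ∀ p ∈ timeSet T ×ˢ e.target, endComp e (S p.1).J p.2 * endComp e (S p.1).J p.2 = -1 :=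
    fun p hp => by rw [endComp_eq he hp.2]; exact endMat_sq _ _ ((S p.1).complexJ.sq _)
  have hnd := fun p (hp : p ∈ timeSet T ×ˢ e.target) =>
    ((S p.1).det_comm_ne_zero_iff he hp.2).mpr (h p.1 hp.1 _)
  have h1 := (hI.sub hJ).det.log fun p hp => det_sub_ne_zero (sqI p hp) (sqJ p hp) (hnd p hp)
  have h2 := (hI.add hJ).det.log fun p hp => det_add_ne_zero (sqI p hp) (sqJ p hp) (hnd p hp)
  refine ((contDiffOn_const (c := (1 / 2 : ℝ))).mul (h1.sub h2)).congr fun p hp => ?_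
  exact (S p.1).ricciPotential_eq_coordPotential he hp.2 (h p.1 hp.1 _)

/-- The Ricci potential solves the heat equation for the Chern Laplacian. -/
theorem hasDerivWithinAt_ricciPotential (hS : IsGKRFSolution T S)
    (h : ∀ t ∈ timeSet T, ∀ x, (S t).NondegAt x) (ht : t ∈ timeSet T) (x : M) :
    HasDerivWithinAt (fun s => ricciPotential (S s) x)
      ((S t).chernLaplacian (ricciPotential (S t)) x) (timeSet T) t := by
  set e := chartAt (EuclideanSpace ℝ (Fin (4 * n))) x with he'
  set y := e x with hy'
  have he : e ∈ charts (4 * n) M := IsManifold.chart_mem_maximalAtlas x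
  have hy : y ∈ e.target := mem_chart_target _ x
  have hx : e.symm y = x := e.left_inv (mem_chart_source _ x)
  have hU : LocalGK (metricComp e (S t).g) (endComp e (S t).I) (endComp e (S t).J) e.target :=
    (S t).localGK he (hS.smooth_metricComp he ht) e.open_target subset_rfl fun z _ => h t ht _
  have hsqI := hU.hermI.sq y hy
  have hsqJ := hU.hermJ.sq y hy
  set I := endComp e (S t).I y
  have hJ := hS.flow_J e he t ht y hy
  have d1 : ∀ i j, HasDerivWithinAt (fun s => (I - endComp e (S s).J y) i j)
      ((0 - lieDerivEnd (leeDiff (metricComp e (S t).g) (endComp e (S t).I) (endComp e (S t).J))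
        (endComp e (S t).J) y) i j) (timeSet T) t := fun i j =>
    (hasDerivWithinAt_matrix_const I i j).fun_sub (hJ i j)
  have d2 : ∀ i j, HasDerivWithinAt (fun s => (I + endComp e (S s).J y) i j)
      ((0 + lieDerivEnd (leeDiff (metricComp e (S t).g) (endComp e (S t).I) (endComp e (S t).J))
        (endComp e (S t).J) y) i j) (timeSet T) t := fun i j =>
    (hasDerivWithinAt_matrix_const I i j).fun_add (hJ i j)
  have l1 := hasDerivWithinAt_log_det d1 (det_sub_ne_zero hsqI hsqJ (hU.nondeg y hy))
  have l2 := hasDerivWithinAt_log_det d2 (det_add_ne_zero hsqI hsqJ (hU.nondeg y hy))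
  have l3 := (l1.fun_sub l2).const_mul (1 / 2 : ℝ)
  have e1 : (S t).chernLaplacian (ricciPotential (S t)) x
      = chernLaplacianCoord (metricComp e (S t).g) (endComp e (S t).I)
        (coordPotential (endComp e (S t).I) (endComp e (S t).J)) y :=
    chernLaplacianCoord_congr e.open_target (fun z hz =>
      (S t).ricciPotential_eq_coordPotential he hz (h t ht _)) hy
  rw [e1, ← hU.neg_trace_eq_chernLaplacian hy]
  rw [trace_inv_sub_add hsqI hsqJ (hU.mul_inv hy), Matrix.mul_zero, Matrix.trace_zero,
    zero_sub] at l3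
  refine l3.congr_of_mem (fun s hs => ?_) ht
  have e2 := (S s).ricciPotential_eq_coordPotential he hy (h s hs _)
  rw [hx] at e2
  rw [e2, coordPotential, hS.I_eq hs ht]

end Potential

end IsGKRFSolution

/-! ### The maximum principle -/

section SecondDerivative

variable {N : ℕ}

/-- The trace of the product of two positive semidefinite matrices is nonnegative. -/
theorem trace_mul_nonneg_of_posSemidef {A B : Matrix (Fin N) (Fin N) ℝ} (hA : A.PosSemidef)
    (hB : B.PosSemidef) : 0 ≤ (A * B).trace := by
  have h := (hA.hadamard hB).dotProduct_mulVec_nonneg (fun _ => (1 : ℝ))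
  have hs : ∀ i j, B j i = B i j := fun i j => by simpa using hB.1.apply i j
  have e : (A * B).trace = star (fun _ : Fin N => (1 : ℝ)) ⬝ᵥ (A.hadamard B) *ᵥ fun _ => 1 := by
    simp [Matrix.trace, Matrix.mul_apply, dotProduct, Matrix.mulVec, Matrix.hadamard, hs]
  rw [e]
  exact h

/-- The second derivative test: at a local maximum the first derivatives vanish and the Hessian is
nonpositive. -/
theorem pd_eq_zero_and_hessian_nonpos {f : EuclideanSpace ℝ (Fin N) → ℝ}
    {U : Set (EuclideanSpace ℝ (Fin N))} (hf : ContDiffOn ℝ ∞ f U) (hU : IsOpen U)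
    {y : EuclideanSpace ℝ (Fin N)} (hy : y ∈ U) (hmax : IsLocalMax f y) :
    (∀ i, pd i f y = 0) ∧
      ∀ v : Fin N → ℝ, v ⬝ᵥ (Matrix.of fun i k => pd i (fun z => pd k f z) y) *ᵥ v ≤ 0 := by
  have hfd : fderiv ℝ f y = 0 := hmax.fderiv_eq_zero
  refine ⟨fun i => by rw [pd, hfd]; rfl, fun v => ?_⟩
  set w : EuclideanSpace ℝ (Fin N) := ∑ i, v i • EuclideanSpace.single i (1 : ℝ) with hw
  have hd2 : DifferentiableAt ℝ (fderiv ℝ f) y :=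
    ((hf.fderiv_of_isOpen hU (m := ∞) (by simp)).contDiffAt (hU.mem_nhds hy)).differentiableAt
      (by simp)
  have e : ∀ i j : Fin N, pd i (fun z => pd j f z) y
      = fderiv ℝ (fderiv ℝ f) y (EuclideanSpace.single i 1) (EuclideanSpace.single j 1) := by
    intro i j
    simp only [pd]
    rw [fderiv_clm_apply hd2 (differentiableAt_const _)]
    simp
  have e2 : v ⬝ᵥ (Matrix.of fun i k => pd i (fun z => pd k f z) y) *ᵥ v
      = fderiv ℝ (fderiv ℝ f) y w w := by
    simp only [hw, map_sum, map_smul, FunLike.coe_sum, Finset.sum_apply,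
      FunLike.coe_smul, Pi.smul_apply, smul_eq_mul, dotProduct, Matrix.mulVec,
      Matrix.of_apply, e, Finset.mul_sum]
    rw [Finset.sum_comm]
    exact Finset.sum_congr rfl fun i _ => Finset.sum_congr rfl fun j _ => by ring
  rw [e2]
  -- reduction to one variable, along the line with direction `w`
  set c : ℝ → EuclideanSpace ℝ (Fin N) := fun s => y + s • w with hc
  have hcd : ∀ s, HasDerivAt c w s := fun s => by
    have h1 := ((hasDerivAt_id s).smul_const w).const_add y
    rwa [one_smul] at h1
  have hc0 : c 0 = y := by simp [hc]
  have hcU : ∀ᶠ s in nhds (0 : ℝ), c s ∈ U := by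
    refine (hcd 0).continuousAt.eventually ?_
    rw [hc0]
    exact hU.mem_nhds hy
  have hder : deriv (f ∘ c) =ᶠ[nhds 0] fun s => fderiv ℝ f (c s) w := by
    filter_upwards [hcU] with s hs
    exact ((ContDiffOn.differentiableAt_of_isOpen hf hU hs).hasFDerivAt.comp_hasDerivAt s
      (hcd s)).deriv
  have hder2 : deriv (deriv (f ∘ c)) 0 = fderiv ℝ (fderiv ℝ f) y w w := by
    rw [hder.deriv_eq]
    have h1 : HasDerivAt (fun s => fderiv ℝ f (c s)) (fderiv ℝ (fderiv ℝ f) y w) 0 := by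
      have h0 : HasFDerivAt (fderiv ℝ f) (fderiv ℝ (fderiv ℝ f) y) (c 0) := by
        rw [hc0]; exact hd2.hasFDerivAt
      exact h0.comp_hasDerivAt 0 (hcd 0)
    have h2 := h1.clm_apply (hasDerivAt_const (0 : ℝ) w)
    simpa using h2.deriv
  have hmax' : IsLocalMax (f ∘ c) 0 := by
    have : Filter.Tendsto c (nhds 0) (nhds y) := by
      rw [← hc0]; exact (hcd 0).continuousAt
    filter_upwards [this.eventually hmax] with s hs
    simpa [hc0] using hs
  rw [← hder2]
  by_contra! hpos
  have hcont : ContinuousAt (f ∘ c) 0 := by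
    refine ContinuousAt.comp ?_ (hcd 0).continuousAt
    rw [hc0]
    exact (ContDiffOn.differentiableAt_of_isOpen hf hU hy).continuousAt
  have hmin := isLocalMin_of_deriv_deriv_pos hpos hmax'.deriv_eq_zero hcont
  have hconst : f ∘ c =ᶠ[nhds 0] fun _ => (f ∘ c) 0 := by
    filter_upwards [hmin, hmax'] with s h1 h2
    exact le_antisymm h2 h1
  have hz : deriv (deriv (f ∘ c)) 0 = 0 := by
    rw [hconst.deriv.deriv_eq]
    simp
  exact hpos.ne' hz

/-- The Chern Laplacian is nonpositive at a local maximum. -/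
theorem chernLaplacianCoord_nonpos {g I : MatField N} {U : Set (EuclideanSpace ℝ (Fin N))}
    (h : LocalHerm g I U) {f : EuclideanSpace ℝ (Fin N) → ℝ} (hf : ContDiffOn ℝ ∞ f U)
    {y : EuclideanSpace ℝ (Fin N)} (hy : y ∈ U)
    (hpos : ∀ v : Fin N → ℝ, v ≠ 0 → 0 < v ⬝ᵥ g y *ᵥ v) (hmax : IsLocalMax f y) :
    chernLaplacianCoord g I f y ≤ 0 := by
  obtain ⟨h1, h2⟩ := pd_eq_zero_and_hessian_nonpos hf h.isOpen hy hmax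
  set A : Matrix (Fin N) (Fin N) ℝ := Matrix.of fun i k => pd i (fun z => pd k f z) y
  have hα : (fun k => pd k f y) = 0 := funext h1
  rw [chernLaplacianCoord_eq h.isOpen h.smooth_I hf hy, (h.hermJet hy).chern_formula, hα]
  have h0 : (Matrix.of fun i => (pdMat i I y)ᵀ *ᵥ (0 : Fin N → ℝ)) = 0 := by
    ext i j
    simp
  rw [h0, Matrix.zero_mul, Matrix.trace_zero, sub_zero]
  have hA : (-A).PosSemidef := by
    refine Matrix.PosSemidef.of_dotProduct_mulVec_nonneg ?_ fun v => ?_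
    · ext i j
      simp only [Matrix.conjTranspose_apply, Matrix.neg_apply, star_trivial, neg_inj]
      exact pd_comm hf h.isOpen hy j i
    · have := h2 v
      rw [star_trivial, Matrix.neg_mulVec, dotProduct_neg]
      linarith
  have hg : (g y).PosDef := by
    refine Matrix.PosDef.of_dotProduct_mulVec_pos ?_ fun {v} hv => ?_
    · rw [Matrix.IsHermitian, Matrix.conjTranspose_eq_transpose_of_trivial, h.symm y hy]
    · rw [star_trivial]
      exact hpos v hv
  have := trace_mul_nonneg_of_posSemidef hg.inv.posSemidef hA
  rw [Matrix.mul_neg, Matrix.trace_neg] at this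
  linarith

theorem chernLaplacianCoord_neg (g I : MatField N) (f : EuclideanSpace ℝ (Fin N) → ℝ)
    (y : EuclideanSpace ℝ (Fin N)) :
    chernLaplacianCoord g I (fun z => -f z) y = -chernLaplacianCoord g I f y := by
  have e : dcFun I (fun z => -f z) = fun j z => -dcFun I f j z := by
    funext j z
    simp [dcFun, pd_neg]
  have e2 : extDerivOne (dcFun I fun z => -f z) y = -extDerivOne (dcFun I f) y := by
    ext i j
    simp only [extDerivOne, e, Matrix.of_apply, Matrix.neg_apply, pd_neg]
    ring
  rw [chernLaplacianCoord, e2, chernLaplacianCoord, formInner, formInner]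
  simp only [Matrix.neg_apply, mul_neg, neg_mul, Finset.sum_neg_distrib]

end SecondDerivative

/-- The weak maximum principle on a compact space: if at the spatial maxima the time derivative is
nonpositive, then upper bounds are preserved. -/
theorem le_of_deriv_nonpos_at_max {M : Type*} [TopologicalSpace M] [CompactSpace M]
    {f f' : ℝ → M → ℝ} {a b : ℝ} (hab : a ≤ b)
    (hc : ContinuousOn (fun p : ℝ × M => f p.1 p.2) (Set.Icc a b ×ˢ Set.univ))
    (hd : ∀ t ∈ Set.Icc a b, ∀ x, HasDerivWithinAt (fun s => f s x) (f' t x) (Set.Icc a b) t)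
    (hmax : ∀ t ∈ Set.Icc a b, ∀ x, (∀ z, f t z ≤ f t x) → f' t x ≤ 0)
    {m : ℝ} (hm : ∀ x, f a x ≤ m) (x : M) : f b x ≤ m := by
  refine le_of_forall_pos_le_add fun δ hδ => ?_
  -- the slope `ε` with `ε (b - a) ≤ δ`
  set ε := δ / (b - a + 1) with hε
  have hba : 0 < b - a + 1 := by linarith
  have hε0 : 0 < ε := div_pos hδ hba
  have hεδ : ε * (b - a) ≤ δ := by
    have : ε * (b - a + 1) = δ := div_mul_cancel₀ _ hba.ne'
    linarith
  set w : ℝ × M → ℝ := fun p => f p.1 p.2 - ε * (p.1 - a) with hw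
  have hwc : ContinuousOn w (Set.Icc a b ×ˢ Set.univ) :=
    hc.sub (by fun_prop)
  obtain ⟨⟨t, z⟩, htz, hmaxw⟩ := (isCompact_Icc.prod isCompact_univ).exists_isMaxOn
    ⟨(b, x), ⟨hab, le_rfl⟩, Set.mem_univ _⟩ hwc
  have ht : t ∈ Set.Icc a b := htz.1
  have hbx : f b x - ε * (b - a) ≤ f t z - ε * (t - a) :=
    hmaxw (show (b, x) ∈ Set.Icc a b ×ˢ Set.univ from ⟨⟨hab, le_rfl⟩, Set.mem_univ _⟩)
  rcases eq_or_lt_of_le ht.1 with rfl | hat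
  · have := hm z
    linarith
  -- at a maximum of `w` with `a < t` the left derivative of `w` in time is nonnegative, so that the
  -- time derivative of `f` is at least `ε`
  · exfalso
    have hle := hmax t ht z fun z' => by
      have h : f t z' - ε * (t - a) ≤ f t z - ε * (t - a) :=
        hmaxw (show (t, z') ∈ Set.Icc a b ×ˢ Set.univ from ⟨ht, Set.mem_univ _⟩)
      linarith
    have hder : HasDerivWithinAt (fun s => f s z - ε * (s - a)) (f' t z - ε * 1)
        (Set.Icc a b) t :=
      (hd t ht z).fun_sub (((hasDerivWithinAt_id t _).sub_const a).const_mul ε)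
    have hmaxt : IsMaxOn (fun s => f s z - ε * (s - a)) (Set.Icc a b) t := fun s hs =>
      hmaxw (show (s, z) ∈ Set.Icc a b ×ˢ Set.univ from ⟨hs, Set.mem_univ _⟩)
    have hcone : a - t ∈ posTangentConeAt (Set.Icc a b) t :=
      sub_mem_posTangentConeAt_of_segment_subset
        ((convex_Icc a b).segment_subset ht ⟨le_rfl, hab⟩)
    have := hmaxt.localize.hasFDerivWithinAt_nonpos hder.hasFDerivWithinAt hcone
    simp only [ContinuousLinearMap.toSpanSingleton_apply, smul_eq_mul] at this
    nlinarith

namespace IsGKRFSolution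

variable {n : ℕ} {M : Type*} [TopologicalSpace M]
  [ChartedSpace (EuclideanSpace ℝ (Fin (4 * n))) M] [IsManifold (𝓡 (4 * n)) ∞ M] {T : EReal}
  {S : ℝ → GKStructure (4 * n) M} {t : ℝ}

theorem continuousOn_ricciPotential (hS : IsGKRFSolution T S)
    (h : ∀ t ∈ timeSet T, ∀ x, (S t).NondegAt x) :
    ContinuousOn (fun p : ℝ × M => ricciPotential (S p.1) p.2) (timeSet T ×ˢ Set.univ) := by
  rintro ⟨t, x⟩ ⟨ht, -⟩
  set e := chartAt (EuclideanSpace ℝ (Fin (4 * n))) x with he'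
  have he : e ∈ charts (4 * n) M := IsManifold.chart_mem_maximalAtlas x
  have hx : x ∈ e.source := mem_chart_source _ x
  have hs := (hS.smooth_ricciPotential h he).continuousOn
  have hmaps : Set.MapsTo (fun p : ℝ × M => (p.1, e p.2)) (timeSet T ×ˢ e.source)
      (timeSet T ×ˢ e.target) := fun p hp => ⟨hp.1, e.map_source hp.2⟩
  have hc : ContinuousOn (fun p : ℝ × M => (p.1, e p.2)) (timeSet T ×ˢ e.source) :=
    continuousOn_fst.prodMk (e.continuousOn.comp continuousOn_snd fun p hp => hp.2)
  have h1 : ContinuousOn (fun p : ℝ × M => ricciPotential (S p.1) p.2) (timeSet T ×ˢ e.source) :=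
    (hs.comp hc hmaps).congr fun p hp => by
      simp only [Function.comp]
      rw [e.left_inv hp.2]
  have hn : timeSet T ×ˢ e.source ∈ nhdsWithin (t, x) (timeSet T ×ˢ Set.univ) := by
    rw [nhdsWithin_prod_eq, nhdsWithin_univ]
    exact Filter.prod_mem_prod self_mem_nhdsWithin (e.open_source.mem_nhds hx)
  exact (h1 (t, x) ⟨ht, hx⟩).mono_of_mem_nhdsWithin hn

/-- The sign `c` serves to treat maxima and minima of the potential at the same time. -/
theorem chernLaplacianCoord_ricciPotential_nonpos (hS : IsGKRFSolution T S)
    (h : ∀ t ∈ timeSet T, ∀ x, (S t).NondegAt x) (ht : t ∈ timeSet T) {c : ℝ} (hc : c = 1 ∨ c = -1)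
    {e : OpenPartialHomeomorph M (EuclideanSpace ℝ (Fin (4 * n)))} (he : e ∈ charts (4 * n) M)
    {y : EuclideanSpace ℝ (Fin (4 * n))} (hy : y ∈ e.target)
    (hx : ∀ z, c * ricciPotential (S t) z ≤ c * ricciPotential (S t) (e.symm y)) :
    c * chernLaplacianCoord (metricComp e (S t).g) (endComp e (S t).I)
      (fun y => ricciPotential (S t) (e.symm y)) y ≤ 0 := by
  have hL := (S t).localHermI he (hS.smooth_metricComp he ht)
  have hsm : ContDiffOn ℝ ∞ (fun y => ricciPotential (S t) (e.symm y)) e.target :=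
    (hS.smooth_ricciPotential h he).comp (f := fun y => (t, y))
      (contDiff_const.prodMk contDiff_id).contDiffOn fun _ hy => ⟨ht, hy⟩
  have hpos : ∀ v : Fin (4 * n) → ℝ, v ≠ 0 → 0 < v ⬝ᵥ metricComp e (S t).g y *ᵥ v :=
    fun v hv => by
      rw [(S t).metricComp_eq he hy]
      exact (S t).gramMat_pos _ v hv
  rcases hc with rfl | rfl
  · rw [one_mul]
    have hmax : ∀ z, ricciPotential (S t) (e.symm z) ≤ ricciPotential (S t) (e.symm y) :=
      fun z => by simpa only [one_mul] using hx (e.symm z)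
    exact chernLaplacianCoord_nonpos hL hsm hy hpos (Filter.Eventually.of_forall hmax)
  · rw [neg_one_mul, ← chernLaplacianCoord_neg]
    have hmax : ∀ z, -ricciPotential (S t) (e.symm z) ≤ -ricciPotential (S t) (e.symm y) :=
      fun z => by simpa only [neg_one_mul] using hx (e.symm z)
    exact chernLaplacianCoord_nonpos hL hsm.neg hy hpos (Filter.Eventually.of_forall hmax)

theorem chernLaplacian_nonpos (hS : IsGKRFSolution T S)
    (h : ∀ t ∈ timeSet T, ∀ x, (S t).NondegAt x) (ht : t ∈ timeSet T) {c : ℝ} (hc : c = 1 ∨ c = -1)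
    (x : M) (hx : ∀ z, c * ricciPotential (S t) z ≤ c * ricciPotential (S t) x) :
    c * (S t).chernLaplacian (ricciPotential (S t)) x ≤ 0 := by
  have hex : (chartAt (EuclideanSpace ℝ (Fin (4 * n))) x).symm (chartAt _ x x) = x :=
    (chartAt _ x).left_inv (mem_chart_source _ x)
  refine hS.chernLaplacianCoord_ricciPotential_nonpos h ht hc (IsManifold.chart_mem_maximalAtlas x)
    (mem_chart_target _ x) fun z => ?_
  rw [hex]
  exact hx z

/-- On a compact manifold bounds for `± Φ` are preserved. -/
theorem ricciPotential_le [CompactSpace M] (hS : IsGKRFSolution T S)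
    (h : ∀ t ∈ timeSet T, ∀ x, (S t).NondegAt x) {c : ℝ} (hc : c = 1 ∨ c = -1) {a b : ℝ}
    (ha : a ∈ timeSet T) (hb : b ∈ timeSet T) (hab : a ≤ b) {m : ℝ}
    (hm : ∀ x, c * ricciPotential (S a) x ≤ m) (x : M) : c * ricciPotential (S b) x ≤ m := by
  have hsub : Set.Icc a b ⊆ timeSet T := (timeSet_ordConnected T).out ha hb
  refine le_of_deriv_nonpos_at_max (f := fun t x => c * ricciPotential (S t) x)
    (f' := fun t x => c * (S t).chernLaplacian (ricciPotential (S t)) x) hab ?_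
    (fun t ht x => ?_) (fun t ht x hx => hS.chernLaplacian_nonpos h (hsub ht) hc x hx) hm x
  · exact continuousOn_const.mul ((hS.continuousOn_ricciPotential h).mono
      (Set.prod_mono hsub subset_rfl))
  · exact ((hS.hasDerivWithinAt_ricciPotential h (hsub ht) x).mono hsub).const_mul c

theorem bddAbove_ricciPotential [CompactSpace M] (hS : IsGKRFSolution T S)
    (h : ∀ t ∈ timeSet T, ∀ x, (S t).NondegAt x) (ht : t ∈ timeSet T) :
    BddAbove (Set.range fun x => |ricciPotential (S t) x|) := by
  refine (isCompact_range ?_).bddAbove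
  have : Continuous fun x => ricciPotential (S t) x := by
    rw [← continuousOn_univ]
    exact (hS.continuousOn_ricciPotential h).comp (f := fun x : M => (t, x))
      (Continuous.continuousOn (by fun_prop)) fun x _ => ⟨ht, Set.mem_univ _⟩
  exact this.abs

theorem antitoneOn_iSup_ricciPotential [CompactSpace M] (hS : IsGKRFSolution T S)
    (h : ∀ t ∈ timeSet T, ∀ x, (S t).NondegAt x) :
    AntitoneOn (fun t => ⨆ x, |ricciPotential (S t) x|) (timeSet T) := by
  intro a ha b hb hab
  rcases isEmpty_or_nonempty M with hM | hM
  · simp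
  have hle : ∀ x, |ricciPotential (S a) x| ≤ ⨆ x, |ricciPotential (S a) x| :=
    le_ciSup (hS.bddAbove_ricciPotential h ha)
  refine ciSup_le fun x => abs_le'.mpr ⟨?_, ?_⟩
  · have := hS.ricciPotential_le h (Or.inl rfl) ha hb hab
      (fun z => by rw [one_mul]; exact (le_abs_self _).trans (hle z)) x
    rwa [one_mul] at this
  · have := hS.ricciPotential_le h (Or.inr rfl) ha hb hab
      (fun z => by rw [neg_one_mul]; exact (neg_le_abs _).trans (hle z)) x
    rwa [neg_one_mul] at this

end IsGKRFSolution

end GKRF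

end

theorem mainTheorem10 (n : ℕ) {M : Type*} [TopologicalSpace M] [T2Space M]
    [SecondCountableTopology M] [ChartedSpace (EuclideanSpace ℝ (Fin (4 * n))) M]
    [IsManifold (𝓡 (4 * n)) ∞ M] (T : EReal) (hT : 0 < T)
    (S : ℝ → GKRF.GKStructure (4 * n) M) (hS : GKRF.IsGKRFSolution T S)
    (h0 : (S 0).IsNondegenerate) :
    (∀ t ∈ GKRF.timeSet T, (S t).IsNondegenerate ∧ ∀ x, 0 < GKRF.volumeRatio (S t) x) ∧
    (∀ e ∈ GKRF.charts (4 * n) M,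
      ContDiffOn ℝ ∞ (fun p : ℝ × EuclideanSpace ℝ (Fin (4 * n)) =>
        GKRF.ricciPotential (S p.1) (e.symm p.2)) (GKRF.timeSet T ×ˢ e.target)) ∧
    (∀ t ∈ GKRF.timeSet T, ∀ x : M,
      HasDerivWithinAt (fun s => GKRF.ricciPotential (S s) x)
        ((S t).chernLaplacian (GKRF.ricciPotential (S t)) x) (GKRF.timeSet T) t) ∧
    (CompactSpace M →
      (∀ t ∈ GKRF.timeSet T, BddAbove (Set.range fun x => |GKRF.ricciPotential (S t) x|)) ∧
      AntitoneOn (fun t => ⨆ x, |GKRF.ricciPotential (S t) x|) (GKRF.timeSet T)) := by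
  have h : ∀ t ∈ GKRF.timeSet T, ∀ x, (S t).NondegAt x := fun t ht =>
    (S t).isNondegenerate_iff.mp (hS.isNondegenerate hT h0 ht)
  exact ⟨fun t ht => ⟨hS.isNondegenerate hT h0 ht,
      fun x => ((S t).volumeRatio_pos_and_sq (h t ht x)).1⟩,
    fun e he => hS.smooth_ricciPotential h he,
    fun t ht x => hS.hasDerivWithinAt_ricciPotential h ht x,
    fun _ => ⟨fun t ht => hS.bddAbove_ricciPotential h ht, hS.antitoneOn_iSup_ricciPotential h⟩⟩
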